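/- **Setting.** There are $n\ge 1$ jobs $J_1,\dots,J_n$, all available at time $0$; job $J_j$ has a processing time $p_j\ge 0$ and a cost function $f_j$ that is real-valued and non-decreasing on $[0,\infty)$. A machine processes the jobs in batches, with a setup time $s\ge 0$ directly before each (nonempty) batch; the number of jobs in a batch is not restricted ($b\ge n$). The processing time of a batch is the sum of the processing times of its jobs, and all jobs of a batch start and complete with their batch. On the jobs there is a strict partial order $\prec$: if $J_i\prec J_j$, then $J_i$ must be in an earlier batch than $J_j$ and $C_i\le S_j$, where $C_i$ is the completion time of $J_i$ (that of its batch) and $S_j$ the start time of the batch of $J_j$. A schedule is a partition of the jobs into batches together with the start times of the batches; it is feasible if $\prec$ is respected and the batches with their setups do not overlap and lie in $[0,\infty)$. Let $C_{\max}(\sigma)=\max_j C_j(\sigma)$ and $f_{\max}(\sigma)=\max_j f_j(C_j(\sigma))$. A feasible $\sigma$ is Pareto optimal, and $(C_{\max}(\sigma),f_{\max}(\sigma))$ is a Pareto optimal point, if no feasible $\sigma'$ has $C_{\max}(\sigma')\le C_{\max}(\sigma)$ and $f_{\max}(\sigma')\le f_{\max}(\sigma)$ with at least one strict inequality. The order $\prec$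 is given by inverse adjacency lists: for each $J_j$ the list of its direct predecessors, i.e. the $J_p\prec J_j$ for which there is no $J_k$ with $J_p\prec J_k\prec J_j$. The machine model is a random access machine with natural-number and real registers and arrays, in which every memory access, addition, subtraction, comparison, test and evaluation $f_j(t)$ takes one step. **Algorithms.** A candidate set family (CSF) $F=(\mathcal J_1,\dots,\mathcal J_n)$ is a partition of the jobs into possibly empty sets; $O(j,F)=i$ means $J_j\in\mathcal J_i$. *Algorithm AUX2* (input: $F$ and $y\in\mathbb R\cup\{+\infty\}$) repeats the following. Let $B_i=\mathcal J_i$ for $i=1,\dots,n$, and schedule $B_1,\dots,B_n$ in this order from time $0$ without idle time, an empty batch having setup time and processing time $0$; let $C(B_i)$ be the completion times. For $i=n,n-1,\dots,1$ and for each $J_j\in B_i$: let $k_1\le i$ be the largest index with $f_j(C(B_{k_1}))<y$; if there is none, return $\varnothing$. Otherwise set $O(j,F)$ to $k=\min\{k_1,O(j,F)\}$. If $k<i$, move $J_j$ from $\mathcal J_i$ to $\mathcal J_k$; if $\mathcal J_i$ has become empty, return $\varnothing$; otherwise replace, for each $J_p$ in the inverse adjacency list of $J_j$, the number $O(p,F)$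 by $\min\{k-1,O(p,F)\}$ ($J_p$ itself is moved only when its own batch is handled). If no job was moved in the whole round, return the current schedule; otherwise start the next round with the changed $F$. *Algorithm MAIN2.* Let $F$ initially be given by: $\mathcal J_i$ is the set of vertices of out-degree $0$ in the graph of direct precedences with $\mathcal J_{i+1},\dots,\mathcal J_n$ removed, $i=n,n-1,\dots,1$. Let $y=+\infty$, $u=0$, $\Omega=\varnothing$. Run AUX2 with the current $F$ (which it changes) and $y$. If it returns a schedule $\sigma_{u+1}$: if $u>0$ and $C_{\max}(\sigma_u)<C_{\max}(\sigma_{u+1})$, append $(C_{\max}(\sigma_u),f_{\max}(\sigma_u),\sigma_u)$ to $\Omega$; set $\pi^*=\sigma_{u+1}$, $y=f_{\max}(\sigma_{u+1})$, increase $u$ by $1$, and run AUX2 again. If it returns $\varnothing$: append $(C_{\max}(\sigma_u),f_{\max}(\sigma_u),\sigma_u)$ to $\Omega$ and return $\Omega$ and $\pi^*$. **Theorem.** There is a constant $c$ such that on every instance of $1|\prec,\text{s-batch},b\ge n|(C_{\max},f_{\max})$ with $n$ jobs Algorithm MAIN2 (implemented as an explicit program for the machine above) terminates after at most $c\,n^3$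 steps, and its output has the following properties. The points $(C_{\max},f_{\max})$ listed in $\Omega$ are exactly the Pareto optimal points, each listed once, in order of strictly increasing $C_{\max}$; the schedule listed with each point is a Pareto optimal schedule with these objective values. Consequently, $1|\prec,\text{s-batch},b\ge n|f_{\max}$ is solved in $O(n^3)$ time: the returned schedule $\pi^*$ is feasible and has minimum $f_{\max}$ among all feasible schedules. -/

import Mathlib

/-! ## The scheduling problem `1 | ≺, s-batch, b ≥ n | (C_max, f_max)` -/

namespace SBatch

/-- An instance with `n ≥ 1` jobs (indexed by `Fin n`): setup time `s`, processing times `p`,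
regular cost functions `f`, a strict precedence relation `prec` (a strict partial order), and
the inverse adjacency lists `preds` of its graph of direct precedences. -/
structure Inst (n : ℕ) where
  n_pos : 0 < n
  s : ℝ
  s_nonneg : 0 ≤ s
  p : Fin n → ℝ
  p_nonneg : ∀ j, 0 ≤ p j
  f : Fin n → ℝ → ℝ
  f_mono : ∀ j, MonotoneOn (f j) (Set.Ici 0)
  prec : Fin n → Fin n → Prop
  prec_irrefl : ∀ j, ¬ prec j j
  prec_trans : ∀ i j k, prec i j → prec j k → prec i k
  preds : Fin n → List (Fin n)
  preds_nodup : ∀ j, (preds j).Nodup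
  mem_preds : ∀ i j, i ∈ preds j ↔ prec i j ∧ ¬ ∃ k, prec i k ∧ prec k j

/-- A schedule: a partition of the jobs into batches (`batch j` is the index of the batch that
contains job `j`) and the start time of every batch (after its setup). -/
structure Schedule (n : ℕ) where
  batch : Fin n → ℕ
  start : ℕ → ℝ

namespace Schedule

variable {n : ℕ}

/-- The `i`-th batch contains at least one job. -/
def NonemptyBatch (σ : Schedule n) (i : ℕ) : Prop := ∃ j, σ.batch j = i

/-- Completion time of the `i`-th batch: its start time plus the total processing time of its
jobs. -/
def batchEnd (I : Inst n) (σ : Schedule n) (i : ℕ) : ℝ :=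
  σ.start i + ∑ j with σ.batch j = i, I.p j

/-- Completion time of a job: that of its batch. -/
def C (I : Inst n) (σ : Schedule n) (j : Fin n) : ℝ := σ.batchEnd I (σ.batch j)

/-- Feasible schedules. The batches are indexed from left to right by `1, …, n`, the empty ones
(if any) coming first. The machine needs a setup of length `s` directly before each nonempty batch;
idle time is allowed and the number of jobs in a batch is not restricted (`b ≥ n`).
If `i ≺ j` then `i` is in an earlier batch than `j` and is completed before the batch of `j`
starts. (For `p j > 0` the first of these two conditions follows from the second; it only excludes
that jobs of length zero share a batch with their predecessors.) -/
structure Feasible (I : Inst n) (σ : Schedule n) : Prop where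
  one_le_batch : ∀ j, 1 ≤ σ.batch j
  batch_le : ∀ j, σ.batch j ≤ n
  empty_first : ∀ i i', σ.NonemptyBatch i → i ≤ i' → i' ≤ n → σ.NonemptyBatch i'
  first_setup : ∀ i, σ.NonemptyBatch i → I.s ≤ σ.start i
  no_overlap : ∀ i i', σ.NonemptyBatch i → σ.NonemptyBatch i' → i < i' →
    σ.batchEnd I i + I.s ≤ σ.start i'
  precedence : ∀ i j, I.prec i j →
    σ.batch i < σ.batch j ∧ σ.C I i ≤ σ.start (σ.batch j)

end Schedule

theorem Inst.univ_nonempty {n : ℕ} (I : Inst n) : (Finset.univ : Finset (Fin n)).Nonempty :=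
  ⟨⟨0, I.n_pos⟩, Finset.mem_univ _⟩

namespace Schedule

variable {n : ℕ}

/-- The makespan `max_j C_j`. -/
noncomputable def Cmax (I : Inst n) (σ : Schedule n) : ℝ :=
  Finset.univ.sup' I.univ_nonempty fun j => σ.C I j

/-- The maximum cost `max_j f_j(C_j)`. -/
noncomputable def fmax (I : Inst n) (σ : Schedule n) : ℝ :=
  Finset.univ.sup' I.univ_nonempty fun j => I.f j (σ.C I j)

/-- Pareto optimal schedules with respect to `(C_max, f_max)`. -/
def ParetoOptimal (I : Inst n) (σ : Schedule n) : Prop :=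
  σ.Feasible I ∧ ¬ ∃ τ : Schedule n, τ.Feasible I ∧
    τ.Cmax I ≤ σ.Cmax I ∧ τ.fmax I ≤ σ.fmax I ∧ (τ.Cmax I < σ.Cmax I ∨ τ.fmax I < σ.fmax I)

end Schedule

/-- The set of Pareto optimal points. -/
def paretoPoints {n : ℕ} (I : Inst n) : Set (ℝ × ℝ) :=
  {v | ∃ σ : Schedule n, σ.ParetoOptimal I ∧ v = (σ.Cmax I, σ.fmax I)}

/-! ## A random access machine with a step count

Programs are built from assignments, conditionals and while loops over a fixed finite collection of
registers and (two-dimensional) arrays, holding natural numbers or real numbers. Every read,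
write, constant, test, arithmetic operation (addition and truncated subtraction of natural numbers,
addition of reals), comparison and evaluation `f_j(t)` of a cost function takes one step. -/

/-- Registers holding natural numbers. -/
inductive NVar
  | n | i | j | c | q | pr | k | k1 | u | num | inf | moved | status | go
  deriving DecidableEq

/-- Arrays of natural numbers. -/
inductive NArr
  | np | pred | deg | ord | bat | size | cnt | piB | omB
  deriving DecidableEq

/-- Registers holding real numbers. -/
inductive RVar
  | s | y | fm | piC
  deriving DecidableEq

/-- Arrays of real numbers. -/
inductive RArr
  | p | bp | S | C | piS | omS | omC | omF
  deriving DecidableEq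

/-- Memory contents. -/
structure Mem where
  nv : NVar → ℕ
  na : NArr → ℕ → ℕ → ℕ
  rv : RVar → ℝ
  ra : RArr → ℕ → ℕ → ℝ

/-- Expressions with natural number values; `get a e e'` reads the array entry `a[e][e']`. -/
inductive NExp
  | lit (v : ℕ)
  | var (x : NVar)
  | get (a : NArr) (e e' : NExp)
  | add (e e' : NExp)
  | sub (e e' : NExp)

/-- Expressions with real values; `cost e r` is the call `f_e(r)`. -/
inductive RExp
  | zero
  | var (x : RVar)
  | get (a : RArr) (e e' : NExp)
  | add (r r' : RExp)
  | cost (e : NExp) (r : RExp)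

/-- Tests. -/
inductive BExp
  | ltN (e e' : NExp)
  | eqN (e e' : NExp)
  | ltR (r r' : RExp)
  | not (b : BExp)
  | and (b b' : BExp)
  | or (b b' : BExp)

/-- Programs. -/
inductive Stmt
  | setN (x : NVar) (e : NExp)
  | putN (a : NArr) (i i' : NExp) (e : NExp)
  | setR (x : RVar) (r : RExp)
  | putR (a : RArr) (i i' : NExp) (r : RExp)
  | seq (c d : Stmt)
  | ite (b : BExp) (c d : Stmt)
  | when (b : BExp) (c : Stmt)
  | loop (b : BExp) (c : Stmt)

/-- Sequential composition. -/
infixr:30 " ⨟ " => Stmt.seq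

namespace NExp

def eval (m : Mem) : NExp → ℕ
  | lit v => v
  | var x => m.nv x
  | get a e e' => m.na a (e.eval m) (e'.eval m)
  | add e e' => e.eval m + e'.eval m
  | sub e e' => e.eval m - e'.eval m

/-- Number of steps of the evaluation. -/
def time : NExp → ℕ
  | lit _ => 1
  | var _ => 1
  | get _ e e' => e.time + e'.time + 1
  | add e e' => e.time + e'.time + 1
  | sub e e' => e.time + e'.time + 1

end NExp

namespace RExp

noncomputable def eval (f : ℕ → ℝ → ℝ) (m : Mem) : RExp → ℝ
  | zero => 0
  | var x => m.rv x
  | get a e e' => m.ra a (e.eval m) (e'.eval m)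
  | add r r' => r.eval f m + r'.eval f m
  | cost e r => f (e.eval m) (r.eval f m)

/-- Number of steps of the evaluation. -/
def time : RExp → ℕ
  | zero => 1
  | var _ => 1
  | get _ e e' => e.time + e'.time + 1
  | add r r' => r.time + r'.time + 1
  | cost e r => e.time + r.time + 1

end RExp

namespace BExp

def Holds (f : ℕ → ℝ → ℝ) (m : Mem) : BExp → Prop
  | ltN e e' => e.eval m < e'.eval m
  | eqN e e' => e.eval m = e'.eval m
  | ltR r r' => r.eval f m < r'.eval f m
  | not b => ¬ b.Holds f m
  | and b b' => b.Holds f m ∧ b'.Holds f m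
  | or b b' => b.Holds f m ∨ b'.Holds f m

/-- Number of steps of the evaluation. -/
def time : BExp → ℕ
  | ltN e e' => e.time + e'.time + 1
  | eqN e e' => e.time + e'.time + 1
  | ltR r r' => r.time + r'.time + 1
  | not b => b.time + 1
  | and b b' => b.time + b'.time + 1
  | or b b' => b.time + b'.time + 1

end BExp

namespace Mem

def setN (m : Mem) (x : NVar) (v : ℕ) : Mem :=
  { m with nv := Function.update m.nv x v }

def putN (m : Mem) (a : NArr) (i i' v : ℕ) : Mem :=
  { m with
    na := Function.update m.na a (Function.update (m.na a) i (Function.update (m.na a i) i' v)) }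

def setR (m : Mem) (x : RVar) (v : ℝ) : Mem :=
  { m with rv := Function.update m.rv x v }

def putR (m : Mem) (a : RArr) (i i' : ℕ) (v : ℝ) : Mem :=
  { m with
    ra := Function.update m.ra a (Function.update (m.ra a) i (Function.update (m.ra a i) i' v)) }

end Mem

/-- `Exec f c m t m'`: with cost functions `f`, the program `c` started in memory `m` terminates
after exactly `t` steps in memory `m'`. -/
inductive Exec (f : ℕ → ℝ → ℝ) : Stmt → Mem → ℕ → Mem → Prop
  | setN (x : NVar) (e : NExp) (m : Mem) :
      Exec f (.setN x e) m (e.time + 1) (m.setN x (e.eval m))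
  | putN (a : NArr) (i i' e : NExp) (m : Mem) :
      Exec f (.putN a i i' e) m (i.time + i'.time + e.time + 1)
        (m.putN a (i.eval m) (i'.eval m) (e.eval m))
  | setR (x : RVar) (r : RExp) (m : Mem) :
      Exec f (.setR x r) m (r.time + 1) (m.setR x (r.eval f m))
  | putR (a : RArr) (i i' : NExp) (r : RExp) (m : Mem) :
      Exec f (.putR a i i' r) m (i.time + i'.time + r.time + 1)
        (m.putR a (i.eval m) (i'.eval m) (r.eval f m))
  | seq {c d : Stmt} {m m' m'' : Mem} {t t' : ℕ} :
      Exec f c m t m' → Exec f d m' t' m'' → Exec f (.seq c d) m (t + t') m''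
  | ite_true {b : BExp} {c d : Stmt} {m m' : Mem} {t : ℕ} :
      b.Holds f m → Exec f c m t m' → Exec f (.ite b c d) m (b.time + 1 + t) m'
  | ite_false {b : BExp} {c d : Stmt} {m m' : Mem} {t : ℕ} :
      ¬ b.Holds f m → Exec f d m t m' → Exec f (.ite b c d) m (b.time + 1 + t) m'
  | when_true {b : BExp} {c : Stmt} {m m' : Mem} {t : ℕ} :
      b.Holds f m → Exec f c m t m' → Exec f (.when b c) m (b.time + 1 + t) m'
  | when_false {b : BExp} {c : Stmt} {m : Mem} :
      ¬ b.Holds f m → Exec f (.when b c) m (b.time + 1) m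
  | loop_true {b : BExp} {c : Stmt} {m m' m'' : Mem} {t t' : ℕ} :
      b.Holds f m → Exec f c m t m' → Exec f (.loop b c) m' t' m'' →
      Exec f (.loop b c) m (b.time + 1 + t + t') m''
  | loop_false {b : BExp} {c : Stmt} {m : Mem} :
      ¬ b.Holds f m → Exec f (.loop b c) m (b.time + 1) m

/-- The machine is deterministic: running time and result are determined by program and input. -/
theorem Exec.det {f : ℕ → ℝ → ℝ} {c : Stmt} {m m₁ m₂ : Mem} {t₁ t₂ : ℕ}
    (h₁ : Exec f c m t₁ m₁) (h₂ : Exec f c m t₂ m₂) : t₁ = t₂ ∧ m₁ = m₂ := by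
  induction h₁ generalizing t₂ m₂ with
  | setN => cases h₂; exact ⟨rfl, rfl⟩
  | putN => cases h₂; exact ⟨rfl, rfl⟩
  | setR => cases h₂; exact ⟨rfl, rfl⟩
  | putR => cases h₂; exact ⟨rfl, rfl⟩
  | seq _ _ ih ih' =>
    cases h₂ with
    | seq k k' =>
      obtain ⟨rfl, rfl⟩ := ih k
      obtain ⟨rfl, rfl⟩ := ih' k'
      exact ⟨rfl, rfl⟩
  | ite_true hb _ ih =>
    cases h₂ with
    | ite_true _ k => obtain ⟨rfl, rfl⟩ := ih k; exact ⟨rfl, rfl⟩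
    | ite_false hb' _ => exact absurd hb hb'
  | ite_false hb _ ih =>
    cases h₂ with
    | ite_true hb' _ => exact absurd hb' hb
    | ite_false _ k => obtain ⟨rfl, rfl⟩ := ih k; exact ⟨rfl, rfl⟩
  | when_true hb _ ih =>
    cases h₂ with
    | when_true _ k => obtain ⟨rfl, rfl⟩ := ih k; exact ⟨rfl, rfl⟩
    | when_false hb' => exact absurd hb hb'
  | when_false hb =>
    cases h₂ with
    | when_true hb' _ => exact absurd hb' hb
    | when_false _ => exact ⟨rfl, rfl⟩
  | loop_true hb _ _ ih ih' =>
    cases h₂ with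
    | loop_true _ k k' =>
      obtain ⟨rfl, rfl⟩ := ih k
      obtain ⟨rfl, rfl⟩ := ih' k'
      exact ⟨rfl, rfl⟩
    | loop_false hb' => exact absurd hb hb'
  | loop_false hb =>
    cases h₂ with
    | loop_true hb' _ _ => exact absurd hb' hb
    | loop_false _ => exact ⟨rfl, rfl⟩

/-- `for x = a, a + 1, …, b - 1 do body`. -/
def forUp (x : NVar) (a b : NExp) (body : Stmt) : Stmt :=
  .setN x a ⨟ .loop (.ltN (.var x) b) (body ⨟ .setN x (.add (.var x) (.lit 1)))

/-! ### Abbreviations for reading and writing one-dimensional arrays -/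

abbrev NExp.get1 (a : NArr) (e : NExp) : NExp := .get a e (.lit 0)
abbrev RExp.get1 (a : RArr) (e : NExp) : RExp := .get a e (.lit 0)
abbrev Stmt.putN1 (a : NArr) (i e : NExp) : Stmt := .putN a i (.lit 0) e
abbrev Stmt.putR1 (a : RArr) (i : NExp) (r : RExp) : Stmt := .putR a i (.lit 0) r

/-! ## The algorithm

Input: `n`, `s`, `p[j]`, and the inverse adjacency lists `pred[j][0], …, pred[j][np[j] - 1]`.
The current candidate set family `F = (𝒥_1, …, 𝒥_n)` is stored through the ordinal numbers
`ord[j]` (`= i` if `j ∈ 𝒥_i`) and the cardinalities `cnt[i] = |𝒥_i|`; batch `B_i` is the list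
`bat[i][0], …, bat[i][size[i] - 1]`. -/

/-- Initial candidate set family: `𝒥_i` consists of the vertices of out-degree zero in the graph
without `𝒥_{i+1} ∪ … ∪ 𝒥_n`, for `i = n, n - 1, …, 1`. Here `deg[j]` is the out-degree of `j`
in what is left of the graph, and `bat[i]` lists the elements of `𝒥_i`. -/
def initCSF : Stmt :=
  forUp .j (.lit 0) (.var .n) (.putN1 .deg (.var .j) (.lit 0)) ⨟
  forUp .j (.lit 0) (.var .n)
    (forUp .q (.lit 0) (.get1 .np (.var .j))
      (.setN .pr (.get .pred (.var .j) (.var .q)) ⨟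
       .putN1 .deg (.var .pr) (.add (.get1 .deg (.var .pr)) (.lit 1)))) ⨟
  .putN1 .size (.var .n) (.lit 0) ⨟
  forUp .j (.lit 0) (.var .n)
    (.when (.eqN (.get1 .deg (.var .j)) (.lit 0))
      (.putN1 .ord (.var .j) (.var .n) ⨟
       .putN .bat (.var .n) (.get1 .size (.var .n)) (.var .j) ⨟
       .putN1 .size (.var .n) (.add (.get1 .size (.var .n)) (.lit 1)))) ⨟
  .setN .i (.sub (.var .n) (.lit 1)) ⨟
  .loop (.ltN (.lit 0) (.var .i))
    (.putN1 .size (.var .i) (.lit 0) ⨟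
     .setN .k (.add (.var .i) (.lit 1)) ⨟
     forUp .c (.lit 0) (.get1 .size (.var .k))
      (.setN .j (.get .bat (.var .k) (.var .c)) ⨟
       forUp .q (.lit 0) (.get1 .np (.var .j))
        (.setN .pr (.get .pred (.var .j) (.var .q)) ⨟
         .putN1 .deg (.var .pr) (.sub (.get1 .deg (.var .pr)) (.lit 1)) ⨟
         .when (.eqN (.get1 .deg (.var .pr)) (.lit 0))
          (.putN1 .ord (.var .pr) (.var .i) ⨟
           .putN .bat (.var .i) (.get1 .size (.var .i)) (.var .pr) ⨟
           .putN1 .size (.var .i) (.add (.get1 .size (.var .i)) (.lit 1))))) ⨟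
     .setN .i (.sub (.var .i) (.lit 1)))

/-- Form the batches `B_i = 𝒥_i`; `bp[i]` is the processing time of `B_i`. -/
def formBatches : Stmt :=
  forUp .i (.lit 0) (.add (.var .n) (.lit 1))
    (.putN1 .size (.var .i) (.lit 0) ⨟
     .putN1 .cnt (.var .i) (.lit 0) ⨟
     .putR1 .bp (.var .i) .zero) ⨟
  forUp .j (.lit 0) (.var .n)
    (.setN .i (.get1 .ord (.var .j)) ⨟
     .putN .bat (.var .i) (.get1 .size (.var .i)) (.var .j) ⨟
     .putN1 .size (.var .i) (.add (.get1 .size (.var .i)) (.lit 1)) ⨟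
     .putN1 .cnt (.var .i) (.add (.get1 .cnt (.var .i)) (.lit 1)) ⨟
     .putR1 .bp (.var .i) (.add (.get1 .bp (.var .i)) (.get1 .p (.var .j))))

/-- Schedule the batches without idle time: start times `S[i]`, completion times `C[i]`. An empty
batch has no setup. -/
def scheduleBatches : Stmt :=
  .putR1 .C (.lit 0) .zero ⨟
  forUp .i (.lit 1) (.add (.var .n) (.lit 1))
    (.ite (.eqN (.get1 .size (.var .i)) (.lit 0))
      (.putR1 .S (.var .i) (.get1 .C (.sub (.var .i) (.lit 1))))
      (.putR1 .S (.var .i) (.add (.get1 .C (.sub (.var .i) (.lit 1))) (.var .s))) ⨟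
     .putR1 .C (.var .i) (.add (.get1 .S (.var .i)) (.get1 .bp (.var .i))))

/-- The test `f_j(C(B_{k1})) < y`, where `inf = 1` encodes `y = +∞`. -/
def costOK : BExp :=
  .or (.eqN (.var .inf) (.lit 1)) (.ltR (.cost (.var .j) (.get1 .C (.var .k1))) (.var .y))

/-- Handle job `j` of batch `B_i`: find the largest index `k1 ≤ i` with `f_j(C(B_{k1})) < y`
(return `∅`, that is `status = 0`, if there is none), set the ordinal number of `j` to
`k = min {k1, ord[j]}`, and if `k < i` then move `j` from `𝒥_i` to `𝒥_k`, return `∅` if `𝒥_i` has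
become empty, and otherwise lower the ordinal number of each direct predecessor of `j` to at most
`k - 1`. -/
def handleJob : Stmt :=
  .setN .k1 (.var .i) ⨟
  .loop (.and (.ltN (.lit 0) (.var .k1)) (.not costOK)) (.setN .k1 (.sub (.var .k1) (.lit 1))) ⨟
  .ite (.eqN (.var .k1) (.lit 0))
    (.setN .status (.lit 0))
    (.setN .k (.get1 .ord (.var .j)) ⨟
     .when (.ltN (.var .k1) (.var .k)) (.setN .k (.var .k1)) ⨟
     .putN1 .ord (.var .j) (.var .k) ⨟
     .when (.ltN (.var .k) (.var .i))
      (.setN .moved (.lit 1) ⨟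
       .putN1 .cnt (.var .i) (.sub (.get1 .cnt (.var .i)) (.lit 1)) ⨟
       .putN1 .cnt (.var .k) (.add (.get1 .cnt (.var .k)) (.lit 1)) ⨟
       .ite (.eqN (.get1 .cnt (.var .i)) (.lit 0))
        (.setN .status (.lit 0))
        (forUp .q (.lit 0) (.get1 .np (.var .j))
          (.setN .pr (.get .pred (.var .j) (.var .q)) ⨟
           .when (.ltN (.sub (.var .k) (.lit 1)) (.get1 .ord (.var .pr)))
            (.putN1 .ord (.var .pr) (.sub (.var .k) (.lit 1)))))))

/-- Adjust `F`: handle the batches `B_n, B_{n-1}, …, B_1` in this order. -/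
def adjust : Stmt :=
  .setN .moved (.lit 0) ⨟
  .setN .i (.var .n) ⨟
  .loop (.and (.ltN (.lit 0) (.var .i)) (.eqN (.var .status) (.lit 2)))
    (.setN .c (.lit 0) ⨟
     .loop (.and (.ltN (.var .c) (.get1 .size (.var .i))) (.eqN (.var .status) (.lit 2)))
      (.setN .j (.get .bat (.var .i) (.var .c)) ⨟
       handleJob ⨟
       .setN .c (.add (.var .c) (.lit 1))) ⨟
     .setN .i (.sub (.var .i) (.lit 1)))

/-- Algorithm AUX2 for the current candidate set family and bound `y`. It ends with `status = 0` if
it returns `∅`, and with `status = 1` if it returns a schedule, which is then the one given by `ord`,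
`S` and `C`. -/
def aux2 : Stmt :=
  .setN .status (.lit 2) ⨟
  .loop (.eqN (.var .status) (.lit 2))
    (formBatches ⨟ scheduleBatches ⨟ adjust ⨟
     .when (.and (.eqN (.var .status) (.lit 2)) (.eqN (.var .moved) (.lit 0)))
      (.setN .status (.lit 1)))

/-- Include `(C_max(σ_u), f_max(σ_u), σ_u)` into `Ω` as entry number `num + 1`. The schedule `σ_u`
is kept in `piB`, `piS`, its makespan in `piC`, its maximum cost is `y`. -/
def recordPoint : Stmt :=
  .setN .num (.add (.var .num) (.lit 1)) ⨟
  .putR1 .omC (.var .num) (.var .piC) ⨟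
  .putR1 .omF (.var .num) (.var .y) ⨟
  forUp .j (.lit 0) (.var .n) (.putN .omB (.var .num) (.var .j) (.get1 .piB (.var .j))) ⨟
  forUp .i (.lit 1) (.add (.var .n) (.lit 1))
    (.putR .omS (.var .num) (.var .i) (.get1 .piS (.var .i)))

/-- `π* := σ_{u+1}`, `y := f_max(σ_{u+1})`. -/
def saveSchedule : Stmt :=
  .setR .fm (.cost (.lit 0) (.get1 .C (.get1 .ord (.lit 0)))) ⨟
  forUp .j (.lit 0) (.var .n)
    (.putN1 .piB (.var .j) (.get1 .ord (.var .j)) ⨟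
     .when (.ltR (.var .fm) (.cost (.var .j) (.get1 .C (.get1 .ord (.var .j)))))
      (.setR .fm (.cost (.var .j) (.get1 .C (.get1 .ord (.var .j)))))) ⨟
  forUp .i (.lit 1) (.add (.var .n) (.lit 1)) (.putR1 .piS (.var .i) (.get1 .S (.var .i))) ⨟
  .setR .piC (.get1 .C (.var .n)) ⨟
  .setR .y (.var .fm) ⨟
  .setN .inf (.lit 0)

/-- Algorithm MAIN2. -/
def main2 : Stmt :=
  initCSF ⨟
  .setN .u (.lit 0) ⨟
  .setN .inf (.lit 1) ⨟
  .setN .num (.lit 0) ⨟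
  .setN .go (.lit 1) ⨟
  .loop (.eqN (.var .go) (.lit 1))
    (aux2 ⨟
     .ite (.eqN (.var .status) (.lit 1))
      (.when (.and (.ltN (.lit 0) (.var .u)) (.ltR (.var .piC) (.get1 .C (.var .n)))) recordPoint ⨟
       saveSchedule ⨟
       .setN .u (.add (.var .u) (.lit 1)))
      (recordPoint ⨟ .setN .go (.lit 0)))

/-! ## Input and output -/

variable {n : ℕ}

/-- The cost functions as seen by the machine. -/
noncomputable def Inst.oracle (I : Inst n) (j : ℕ) (t : ℝ) : ℝ :=
  if h : j < n then I.f ⟨j, h⟩ t else 0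

/-- The memory `m` contains the instance `I` (the rest of the memory is arbitrary). -/
structure Inst.LoadedIn (I : Inst n) (m : Mem) : Prop where
  n_eq : m.nv .n = n
  s_eq : m.rv .s = I.s
  p_eq : ∀ j : Fin n, m.ra .p j 0 = I.p j
  np_eq : ∀ j : Fin n, m.na .np j 0 = (I.preds j).length
  pred_eq : ∀ (j : Fin n) (q : Fin (I.preds j).length), m.na .pred j q = ((I.preds j).get q : ℕ)

/-- The schedule in the `κ`-th entry of the output list `Ω`. -/
def outSchedule (n : ℕ) (m : Mem) (κ : ℕ) : Schedule n where
  batch j := m.na .omB κ j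
  start i := m.ra .omS κ i

/-- The point `(C_max, f_max)` in the `κ`-th entry of the output list `Ω`. -/
def outPoint (m : Mem) (κ : ℕ) : ℝ × ℝ := (m.ra .omC κ 0, m.ra .omF κ 0)

/-- The output schedule `π*`. -/
def outBest (n : ℕ) (m : Mem) : Schedule n where
  batch j := m.na .piB j 0
  start i := m.ra .piS i 0

end SBatch

namespace SBatch

/-! ### Precedence relations and completion times -/

/-! Batches are numbered so that the last one is always `n`. The ordinal numbers of the family are
kept as upper bounds on the batch index of every job in every feasible schedule whose costs all
satisfy `ok`, that is, lie below the current bound `y` (any cost is allowed at first). If `F`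
consists of such bounds and its nonempty sets are `a, …, n`, then in any such schedule the jobs done
by batch `k` include all jobs with `F j ≤ k`, and at least as many setups have occurred. Hence the
idle-free schedule for `F` completes each batch no later (`Schedule.Feasible.compl_le`). Two
conclusions follow: it has minimum makespan among the schedules with costs in `ok`, and a job whose
cost is too high at the completion time of batch `k` of `F` cannot be in batch `k`. The second
justifies lowering ordinal numbers in AUX2; predecessors are lowered with their successors
(`Inst.Partial.bounding`).

The delicate point is that AUX2 may give up as soon as some set becomes empty, although a feasible
schedule could fill that batch with jobs from later sets. For this reason `Inst.Bounding` speaks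
about all prefixes of the family: the jobs of the first `i` sets, taken alone and shifted so that
they end with batch `i`, also obey the bounds. Shifting the prefix part of a hypothetical schedule
shows that its last job belongs to set `i` and completes no earlier than batch `i` of `F`. But every
job has left set `i` because it, or one of its successors, is too expensive at that time
(`Inst.Bounding.not_feasible`, `Inst.Partial.not_feasible_of_empty`).

The initial family is `n` minus the length of a longest path of successors; it bounds all schedules
because each of its jobs outside set `n` has a direct successor in the next set.

For MAIN2, each schedule found has minimum makespan for its cost bound, and costs strictly decrease
while makespans do not. A schedule is therefore Pareto optimal when the next one has a larger
makespan or does not exist, and every Pareto optimal point is met in this way.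

The running time is amortized against the sum of the ordinal numbers, which is at most `n * n` and
never increases. A search over `d` indices moves the job by at least `d` places; updating the
predecessors costs `O(n)` and happens only after a move; the remaining work of a round is `O(n)`,
and a round without a move ends AUX2. After the first call, every successful call of AUX2 makes a
move, since otherwise the old schedule would beat its own cost. Thus `O(n)` steps are charged per
unit of the sum.

The program part is a weakest-precondition calculus (`Run`) with exact step counts, a syntactic
frame rule (`Exec.agree`), and loop rules with time in the invariant. -/

theorem Inst.prec_of_mem_preds {n : ℕ} (I : Inst n) {i j : Fin n} (h : i ∈ I.preds j) :
    I.prec i j := ((I.mem_preds i j).1 h).1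

theorem Inst.prec_wf {n : ℕ} (I : Inst n) : WellFounded I.prec := by
  have : IsTrans (Fin n) I.prec := ⟨I.prec_trans⟩
  have : Std.Irrefl I.prec := ⟨I.prec_irrefl⟩
  exact Finite.wellFounded_of_trans_of_irrefl _

theorem Inst.prec_swap_wf {n : ℕ} (I : Inst n) : WellFounded (Function.swap I.prec) := by
  have : IsTrans (Fin n) (Function.swap I.prec) := ⟨fun a b c h h' => I.prec_trans c b a h' h⟩
  have : Std.Irrefl (Function.swap I.prec) := ⟨I.prec_irrefl⟩
  exact Finite.wellFounded_of_trans_of_irrefl _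

/-- Every precedence starts with a direct one. -/
theorem Inst.exists_mem_preds {n : ℕ} (I : Inst n) {i j : Fin n} (h : I.prec i j) :
    ∃ k, i ∈ I.preds k ∧ (k = j ∨ I.prec k j) := by
  -- A minimal job above `i` and at most `j` has nothing strictly between `i` and itself, so `i`
  -- precedes it directly.
  obtain ⟨k, ⟨hik, hkj⟩, hmin⟩ :=
    I.prec_wf.has_min {k | I.prec i k ∧ (k = j ∨ I.prec k j)} ⟨j, h, Or.inl rfl⟩
  refine ⟨k, (I.mem_preds i k).2 ⟨hik, ?_⟩, hkj⟩
  rintro ⟨l, hil, hlk⟩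
  refine hmin l ⟨hil, Or.inr ?_⟩ hlk
  rcases hkj with rfl | hkj
  · exact hlk
  · exact I.prec_trans _ _ _ hlk hkj

theorem Inst.lt_of_prec {n : ℕ} (I : Inst n) {F : Fin n → ℕ}
    (hF : ∀ i j, i ∈ I.preds j → F i < F j) {i j : Fin n} (h : I.prec i j) : F i < F j := by
  induction i using I.prec_swap_wf.induction with
  | _ i ih =>
    obtain ⟨k, hik, rfl | hkj⟩ := I.exists_mem_preds h
    · exact hF _ _ hik
    · exact (hF _ _ hik).trans (ih k (I.prec_of_mem_preds hik) hkj)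

theorem Inst.cost_le {n : ℕ} (I : Inst n) (j : Fin n) {x y : ℝ} (hx : 0 ≤ x) (h : x ≤ y) :
    I.f j x ≤ I.f j y := I.f_mono j hx (hx.trans h) h

theorem Inst.sum_p_nonneg {n : ℕ} (I : Inst n) (s : Finset (Fin n)) : 0 ≤ ∑ j ∈ s, I.p j :=
  Finset.sum_nonneg fun j _ => I.p_nonneg j

theorem Inst.sum_p_mono {n : ℕ} (I : Inst n) {s t : Finset (Fin n)} (h : s ⊆ t) :
    ∑ j ∈ s, I.p j ≤ ∑ j ∈ t, I.p j :=
  Finset.sum_le_sum_of_subset_of_nonneg h fun j _ _ => I.p_nonneg j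

/-- Completion time of the `k`-th batch of the schedule without idle time for the batches given by
the ordinal numbers `F`, where `a` is the index of the first nonempty batch. -/
noncomputable def Inst.compl {n : ℕ} (I : Inst n) (F : Fin n → ℕ) (a k : ℕ) : ℝ :=
  ∑ j with F j ≤ k, I.p j + ((k + 1 - a : ℕ) : ℝ) * I.s

theorem Inst.compl_nonneg {n : ℕ} (I : Inst n) (F : Fin n → ℕ) (a k : ℕ) : 0 ≤ I.compl F a k :=
  add_nonneg (I.sum_p_nonneg _) (mul_nonneg (Nat.cast_nonneg _) I.s_nonneg)

theorem Inst.compl_mono {n : ℕ} (I : Inst n) (F : Fin n → ℕ) (a : ℕ) : Monotone (I.compl F a) := by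
  intro k l h
  refine add_le_add (I.sum_p_mono fun x hx => ?_)
    (mul_le_mul_of_nonneg_right (by exact_mod_cast (by omega)) I.s_nonneg)
  simp only [Finset.mem_filter, Finset.mem_univ, true_and] at hx ⊢
  exact hx.trans h

/-- The ordinal numbers `F` respect the precedences, and `a, …, n` are the nonempty batches. -/
structure Inst.IsCSF {n : ℕ} (I : Inst n) (F : Fin n → ℕ) (a : ℕ) : Prop where
  one_le : 1 ≤ a
  a_le_n : a ≤ n
  a_le : ∀ j, a ≤ F j
  le_n : ∀ j, F j ≤ n
  surj : ∀ i, a ≤ i → i ≤ n → ∃ j, F j = i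
  mono : ∀ i j, i ∈ I.preds j → F i < F j

/-- The truncated subtraction `k + 1 - a` gives the leading empty batches no setup, in agreement
with the convention of the algorithm. -/
theorem Inst.compl_eq_zero {n : ℕ} (I : Inst n) {F : Fin n → ℕ} {a : ℕ} (hF : ∀ j, a ≤ F j) {k : ℕ}
    (hk : k < a) : I.compl F a k = 0 := by
  have h1 : ({j | F j ≤ k} : Finset (Fin n)) = ∅ := by
    ext j
    have := hF j
    simp only [Finset.mem_filter, Finset.mem_univ, true_and, Finset.notMem_empty, iff_false]
    omega
  have h2 : k + 1 - a = 0 := by omega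
  simp [Inst.compl, h1, h2]

theorem Inst.sum_le_succ {n : ℕ} (I : Inst n) (F : Fin n → ℕ) (k : ℕ) :
    ∑ j with F j ≤ k + 1, I.p j = ∑ j with F j ≤ k, I.p j + ∑ j with F j = k + 1, I.p j := by
  rw [← Finset.sum_union]
  · congr 1
    ext j
    simp only [Finset.mem_filter, Finset.mem_univ, true_and, Finset.mem_union]
    omega
  · rw [Finset.disjoint_left]
    intro j
    simp only [Finset.mem_filter, Finset.mem_univ, true_and]
    omega

theorem Inst.compl_succ {n : ℕ} (I : Inst n) (F : Fin n → ℕ) (a k : ℕ) :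
    I.compl F a (k + 1) =
      (I.compl F a k + if a ≤ k + 1 then I.s else 0) + ∑ j with F j = k + 1, I.p j := by
  rw [Inst.compl, Inst.compl, I.sum_le_succ]
  split_ifs with h
  · have : k + 1 + 1 - a = (k + 1 - a) + 1 := by omega
    rw [this]; push_cast; ring
  · have h1 : k + 1 + 1 - a = 0 := by omega
    have h2 : k + 1 - a = 0 := by omega
    rw [h1, h2]; ring

/-! ### Schedules without idle time -/

/-- On its nonempty batches, `σ` is the schedule without idle time given by `F`. -/
structure Inst.Realizes {n : ℕ} (I : Inst n) (F : Fin n → ℕ) (a : ℕ) (σ : Schedule n) : Prop where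
  batch_eq : ∀ j, σ.batch j = F j
  start_eq : ∀ i, a ≤ i → i ≤ n → σ.start i = I.compl F a i - ∑ j with F j = i, I.p j

namespace Inst.Realizes

variable {n : ℕ} {I : Inst n} {F : Fin n → ℕ} {a : ℕ} {σ : Schedule n}

theorem batchEnd_eq (h : I.Realizes F a σ) {i : ℕ} (hi : a ≤ i) (hin : i ≤ n) :
    σ.batchEnd I i = I.compl F a i := by
  simp [Schedule.batchEnd, h.batch_eq, h.start_eq i hi hin]

theorem C_eq (h : I.Realizes F a σ) (hF : I.IsCSF F a) (j : Fin n) :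
    σ.C I j = I.compl F a (F j) := by
  rw [Schedule.C, h.batch_eq, h.batchEnd_eq (hF.a_le j) (hF.le_n j)]

theorem start_eq' (h : I.Realizes F a σ) {k : ℕ} (hk : a ≤ k + 1) (hkn : k + 1 ≤ n) :
    σ.start (k + 1) = I.compl F a k + I.s := by
  rw [h.start_eq _ hk hkn, I.compl_succ, if_pos hk]; ring

theorem feasible (h : I.Realizes F a σ) (hF : I.IsCSF F a) : σ.Feasible I := by
  have hne : ∀ i, σ.NonemptyBatch i → a ≤ i ∧ i ≤ n := by
    rintro i ⟨j, rfl⟩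
    rw [h.batch_eq]
    exact ⟨hF.a_le j, hF.le_n j⟩
  have hstart : ∀ i i', a ≤ i → i < i' → i' ≤ n → σ.batchEnd I i + I.s ≤ σ.start i' := by
    intro i i' h1 h2 h3
    obtain ⟨k, rfl⟩ : ∃ k, i' = k + 1 := ⟨i' - 1, by omega⟩
    rw [h.batchEnd_eq h1 (by omega), h.start_eq' (by omega) h3]
    have := I.compl_mono F a (show i ≤ k by omega)
    linarith
  refine ⟨fun j => ?_, fun j => ?_, ?_, ?_, ?_, ?_⟩
  · rw [h.batch_eq]; exact hF.one_le.trans (hF.a_le j)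
  · rw [h.batch_eq]; exact hF.le_n j
  · intro i i' hi hii' hi'
    obtain ⟨j, hj⟩ := hF.surj i' ((hne i hi).1.trans hii') hi'
    exact ⟨j, (h.batch_eq j).trans hj⟩
  · intro i hi
    obtain ⟨h1, h2⟩ := hne i hi
    have := hF.one_le
    obtain ⟨k, rfl⟩ : ∃ k, i = k + 1 := ⟨i - 1, by omega⟩
    rw [h.start_eq' h1 h2]
    have := I.compl_nonneg F a k
    linarith
  · intro i i' hi hi' hlt
    exact hstart i i' (hne i hi).1 hlt (hne i' hi').2
  · intro i j hij
    have hlt : σ.batch i < σ.batch j := by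
      rw [h.batch_eq, h.batch_eq]
      exact I.lt_of_prec hF.mono hij
    refine ⟨hlt, ?_⟩
    have := hstart _ _ (hne _ ⟨i, rfl⟩).1 hlt (hne _ ⟨j, rfl⟩).2
    have hs := I.s_nonneg
    rw [Schedule.C]
    linarith

theorem Cmax_eq (h : I.Realizes F a σ) (hF : I.IsCSF F a) : σ.Cmax I = I.compl F a n := by
  refine le_antisymm (Finset.sup'_le _ _ fun j _ => ?_) ?_
  · rw [h.C_eq hF]; exact I.compl_mono F a (hF.le_n j)
  · obtain ⟨j, hj⟩ := hF.surj n hF.a_le_n le_rfl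
    have := Finset.le_sup' (fun j => σ.C I j) (Finset.mem_univ j)
    rwa [h.C_eq hF, hj] at this

theorem fmax_eq (h : I.Realizes F a σ) (hF : I.IsCSF F a) :
    σ.fmax I = Finset.univ.sup' I.univ_nonempty fun j => I.f j (I.compl F a (F j)) := by
  unfold Schedule.fmax
  congr 1
  ext j
  rw [h.C_eq hF]

end Inst.Realizes

/-! ### Lower bounds for feasible schedules -/

/-- From the first nonempty batch `b` on, all batches are nonempty, so each contributes a setup and
its processing time. Idle time can only delay the ends. -/
theorem Schedule.Feasible.le_batchEnd {n : ℕ} {I : Inst n} {σ : Schedule n} (h : σ.Feasible I) :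
    ∃ b, (∀ x, b ≤ σ.batch x) ∧ (∃ x, σ.batch x = b) ∧ ∀ k, b ≤ k → k ≤ n →
      ∑ x with σ.batch x ≤ k, I.p x + ((k : ℝ) + 1 - b) * I.s ≤ σ.batchEnd I k := by
  obtain ⟨x, -, hx⟩ := Finset.exists_min_image Finset.univ σ.batch I.univ_nonempty
  refine ⟨σ.batch x, fun z => hx z (Finset.mem_univ z), ⟨x, rfl⟩, fun k hk => ?_⟩
  induction k, hk using Nat.le_induction with
  | base =>
    intro _
    have h1 := h.first_setup _ ⟨x, rfl⟩
    have h2 : ({z | σ.batch z ≤ σ.batch x} : Finset (Fin n)) =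
        ({z | σ.batch z = σ.batch x} : Finset (Fin n)) := by
      ext z
      have := hx z (Finset.mem_univ z)
      simp only [Finset.mem_filter, Finset.mem_univ, true_and]
      omega
    rw [Schedule.batchEnd, h2]
    linarith
  | succ k hk ih =>
    intro hkn
    have h1 := ih (by omega)
    have h2 := h.no_overlap k (k + 1) (h.empty_first _ k ⟨x, rfl⟩ hk (by omega))
      (h.empty_first _ (k + 1) ⟨x, rfl⟩ (by omega) hkn) (by omega)
    rw [I.sum_le_succ, Schedule.batchEnd]
    push_cast
    linarith

/-- With smaller batch indices, `σ` has processed more jobs and made at least as many setups by the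
end of batch `k`. Some job must lie in a batch up to `k`, because the start times of empty batches
are arbitrary. -/
theorem Schedule.Feasible.compl_le {n : ℕ} {I : Inst n} {σ : Schedule n} (h : σ.Feasible I)
    {F : Fin n → ℕ} {a : ℕ} (hF : I.IsCSF F a) (hle : ∀ j, σ.batch j ≤ F j) {k : ℕ} (hk : k ≤ n)
    (hne : ∃ j, σ.batch j ≤ k) : I.compl F a k ≤ σ.batchEnd I k := by
  obtain ⟨b, hb, -, hend⟩ := h.le_batchEnd
  obtain ⟨j, hj⟩ := hne
  refine le_trans ?_ (hend k ((hb j).trans hj) hk)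
  refine add_le_add (I.sum_p_mono fun x hx => ?_) (mul_le_mul_of_nonneg_right ?_ I.s_nonneg)
  · simp only [Finset.mem_filter, Finset.mem_univ, true_and] at hx ⊢
    exact (hle x).trans hx
  -- A job of the first set of `F` shows that `σ` starts with a batch of index at most `a`.
  · obtain ⟨x, hx⟩ := hF.surj a le_rfl hF.a_le_n
    have h1 : b ≤ a := ((hb x).trans (hle x)).trans hx.le
    have h2 : b ≤ k := (hb j).trans hj
    have h3 : ((k + 1 - a : ℕ) : ℝ) ≤ ((k + 1 - b : ℕ) : ℝ) := by exact_mod_cast (by omega)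
    rw [Nat.cast_sub (by omega : b ≤ k + 1)] at h3
    exact_mod_cast h3

theorem Schedule.Feasible.compl_le_C {n : ℕ} {I : Inst n} {σ : Schedule n} (h : σ.Feasible I)
    {F : Fin n → ℕ} {a : ℕ} (hF : I.IsCSF F a) (hle : ∀ j, σ.batch j ≤ F j) (j : Fin n) :
    I.compl F a (σ.batch j) ≤ σ.C I j :=
  h.compl_le hF hle (h.batch_le j) ⟨j, le_rfl⟩

theorem Schedule.Feasible.compl_le_Cmax {n : ℕ} {I : Inst n} {σ : Schedule n} (h : σ.Feasible I)
    {F : Fin n → ℕ} {a : ℕ} (hF : I.IsCSF F a) (hle : ∀ j, σ.batch j ≤ F j) :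
    I.compl F a n ≤ σ.Cmax I := by
  obtain ⟨j, hj⟩ := h.empty_first _ n ⟨⟨0, I.n_pos⟩, rfl⟩ (h.batch_le _) le_rfl
  have h1 := h.compl_le hF hle le_rfl ⟨j, hj.le⟩
  have h2 := Finset.le_sup' (fun j => σ.C I j) (Finset.mem_univ j)
  simp only [Schedule.C, hj] at h2
  exact h1.trans h2

/-! ### Upper bounds on batch indices -/

/-- `F` bounds the batch indices of all schedules with costs in `ok`, also of those for the jobs
in the first `i` sets of `F` alone when these end with batch `i`. -/
def Inst.Bounding {n : ℕ} (I : Inst n) (ok : ℝ → Prop) (F : Fin n → ℕ) : Prop :=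
  ∀ (i b : ℕ) (τ : Fin n → ℕ), i ≤ n → (∀ j, F j ≤ i → b ≤ τ j ∧ τ j ≤ i) →
    (∀ x j, x ∈ I.preds j → F j ≤ i → τ x < τ j) →
    (∀ j, F j ≤ i →
      ok (I.f j (∑ x with F x ≤ i ∧ τ x ≤ τ j, I.p x + ((τ j : ℝ) + 1 - b) * I.s))) →
    ∀ j, F j ≤ i → τ j ≤ F j

namespace Inst.Bounding

variable {n : ℕ} {I : Inst n} {ok ok' : ℝ → Prop} {F : Fin n → ℕ}

theorem imp (h : I.Bounding ok F) (hok : ∀ x, ok' x → ok x) : I.Bounding ok' F :=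
  fun i b τ hi h1 h2 h3 => h i b τ hi h1 h2 fun j hj => hok _ (h3 j hj)

/-- This is the case of the full prefix `i = n`. The costs required there are evaluated without idle
time, hence are no larger than those of `σ`. -/
theorem batch_le (h : I.Bounding ok F) (hF : ∀ j, F j ≤ n) (hok : ∀ x y, x ≤ y → ok y → ok x)
    {σ : Schedule n} (hσ : σ.Feasible I) (hc : ∀ j, ok (I.f j (σ.C I j))) (j : Fin n) :
    σ.batch j ≤ F j := by
  obtain ⟨b, hb, -, hend⟩ := hσ.le_batchEnd
  refine h n b σ.batch le_rfl (fun j _ => ⟨hb j, hσ.batch_le j⟩)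
    (fun x j hx _ => (hσ.precedence x j (I.prec_of_mem_preds hx)).1) (fun j _ => ?_) j (hF j)
  refine hok _ _ (I.cost_le j ?_ ?_) (hc j)
  · refine add_nonneg (I.sum_p_nonneg _) (mul_nonneg ?_ I.s_nonneg)
    have : (b : ℝ) ≤ σ.batch j := by exact_mod_cast hb j
    linarith
  · refine le_trans (le_of_eq ?_) (hend _ (hb j) (hσ.batch_le j))
    simp [hF]

end Inst.Bounding

/-- Contiguous ordinal numbers in which every job has a successor in the next set bound the
batch indices of all schedules. -/
theorem Inst.bounding_of_tight {n : ℕ} (I : Inst n) {F : Fin n → ℕ} (ok : ℝ → Prop)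
    (htight : ∀ j, F j < n → ∃ j', j ∈ I.preds j' ∧ F j' = F j + 1) : I.Bounding ok F := by
  intro i b τ hi h1 h2 _ j hj
  -- Induction on the distance to the last set of the prefix: a direct successor in the next set
  -- satisfies the bound, and `τ` is strictly smaller at `j`. Costs play no role.
  obtain ⟨d, hd⟩ : ∃ d, F j + d = i := ⟨i - F j, by omega⟩
  induction d generalizing j with
  | zero => have := (h1 j hj).2; omega
  | succ d ih =>
    obtain ⟨j', hj', hF⟩ := htight j (by omega)
    have h3 := ih j' (by omega) (by omega)
    have h4 := h2 j j' hj' (by omega)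
    omega

/-- No schedule has all costs in `ok` if, for each job of some batch of `F`, the job or one of its
successors must complete before the completion time of that batch. -/
theorem Inst.Bounding.not_feasible {n : ℕ} {I : Inst n} {ok : ℝ → Prop} {F : Fin n → ℕ} {a : ℕ}
    (h : I.Bounding ok F) (hF : I.IsCSF F a) (hok : ∀ x y, x ≤ y → ok y → ok x) {i : ℕ}
    (hai : a ≤ i) (hin : i ≤ n)
    (hi : ∀ j, F j = i → ∃ j₀, (j₀ = j ∨ I.prec j j₀) ∧ ¬ ok (I.f j₀ (I.compl F a i)))
    {σ : Schedule n} (hσ : σ.Feasible I) : ¬ ∀ j, ok (I.f j (σ.C I j)) := by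
  intro hc
  have hle := h.batch_le hF.le_n hok hσ hc
  obtain ⟨bM, hbM, -, hend⟩ := hσ.le_batchEnd
  set L : Finset (Fin n) := {j | F j ≤ i} with hL
  have memL : ∀ x, x ∈ L ↔ F x ≤ i := fun x => by simp [hL]
  obtain ⟨w, hw⟩ := hF.surj i hai hin
  have hLne : L.Nonempty := ⟨w, (memL w).2 hw.le⟩
  obtain ⟨v, hvL, hv⟩ := Finset.exists_max_image L σ.batch hLne
  obtain ⟨u, huL, hu⟩ := Finset.exists_min_image L σ.batch hLne
  have hvi : σ.batch v ≤ i := (hle v).trans ((memL v).1 hvL)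
  -- Shift the jobs of `L` to the right by `r`, so that the last of them lands in batch `i` and the
  -- first in batch `σ.batch u + r`. The prefix form of `Bounding` applies to the shifted indices.
  obtain ⟨r, hr⟩ : ∃ r, σ.batch v + r = i := ⟨i - σ.batch v, by omega⟩
  have hup := h i (σ.batch u + r) (fun j => σ.batch j + r) hin ?_ ?_ ?_
  · have hvF := hup v ((memL v).1 hvL)
    have hFv : F v = i := le_antisymm ((memL v).1 hvL) (by simpa [hr] using hvF)
    obtain ⟨x, hx⟩ := hF.surj a le_rfl hF.a_le_n
    have hxL : x ∈ L := (memL x).2 (hx.le.trans hai)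
    have hua : σ.batch u + r ≤ a := by
      have h1 := hup x ((memL x).1 hxL)
      have h2 := hu x hxL
      omega
    obtain ⟨j₀, hj₀, hbad⟩ := hi v hFv
    -- When `v` completes, all of `L` has been processed. The shifted indices occupy `σ.batch u + r
    -- ≤ a` to `i`, so at least `i + 1 - a` setups have been made.
    have hCv : I.compl F a i ≤ σ.C I v := by
      refine le_trans ?_ (hend _ (hbM v) (hσ.batch_le v))
      refine add_le_add (I.sum_p_mono fun z hz => ?_) (mul_le_mul_of_nonneg_right ?_ I.s_nonneg)
      · simp only [Finset.mem_filter, Finset.mem_univ, true_and] at hz ⊢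
        exact hv z ((memL z).2 hz)
      · have h1 := hbM u
        have h3 : ((i + 1 - a : ℕ) : ℝ) + bM ≤ ((σ.batch v + 1 : ℕ) : ℝ) := by
          exact_mod_cast (by omega)
        push_cast at h3
        linarith
    have hCj : σ.C I v ≤ σ.C I j₀ := by
      rcases hj₀ with rfl | hj₀
      · exact le_rfl
      · exact (hσ.precedence _ _ hj₀).2.trans
          (le_add_of_nonneg_right (I.sum_p_nonneg _))
    exact hbad (hok _ _ (I.cost_le j₀ (I.compl_nonneg _ _ _) (hCv.trans hCj)) (hc j₀))
  · intro j hj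
    have h1 := hu j ((memL j).2 hj)
    have h2 := hv j ((memL j).2 hj)
    omega
  · intro x j hx _
    have := (hσ.precedence x j (I.prec_of_mem_preds hx)).1
    omega
  · intro j hj
    have huj : σ.batch u ≤ σ.batch j := hu j ((memL j).2 hj)
    have huj' : (σ.batch u : ℝ) ≤ σ.batch j := by exact_mod_cast huj
    -- The shift cancels in the number of setups, and restricting to `L` only removes processing
    -- time, so the costs in the prefix do not exceed those in `σ`.
    refine hok _ _ (I.cost_le j ?_ ?_) (hc j)
    · refine add_nonneg (I.sum_p_nonneg _) (mul_nonneg ?_ I.s_nonneg)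
      push_cast
      linarith
    · refine le_trans ?_ (hend _ (hbM j) (hσ.batch_le j))
      refine add_le_add (I.sum_p_mono fun z hz => ?_) (mul_le_mul_of_nonneg_right ?_ I.s_nonneg)
      · simp only [Finset.mem_filter, Finset.mem_univ, true_and] at hz ⊢
        omega
      · have : (bM : ℝ) ≤ σ.batch u := by exact_mod_cast hbM u
        push_cast
        linarith

/-! ### One round of AUX2 -/

/-- State of a round of AUX2 that started with the ordinal numbers `B`, after the jobs in `H` have
been handled; `o` are the current ordinal numbers. -/
structure Inst.Partial {n : ℕ} (I : Inst n) (ok : ℝ → Prop) (B : Fin n → ℕ) (a : ℕ)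
    (H : Finset (Fin n)) (o : Fin n → ℕ) : Prop where
  le : ∀ j, o j ≤ B j
  -- Each lowered ordinal number has a reason: the job's own cost is too high in all later batches
  -- up to `B j`, or a handled direct successor has itself been lowered. Both the preservation of
  -- the bounds and the infeasibility proof follow these reasons along successors.
  tight : ∀ j, o j = B j ∨
    (j ∈ H ∧ 1 ≤ o j ∧ ok (I.f j (I.compl B a (o j))) ∧
      ∀ k, o j < k → k ≤ B j → ¬ ok (I.f j (I.compl B a k))) ∨
    ∃ j', j ∈ I.preds j' ∧ j' ∈ H ∧ o j = o j' - 1 ∧ o j' < B j'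
  pred : ∀ x j, x ∈ I.preds j → j ∈ H → o x ≤ o j - 1
  stay : ∀ j ∈ H, o j = B j → ok (I.f j (I.compl B a (B j)))
  up : ∀ x j, x ∈ I.preds j → x ∈ H → j ∈ H

/-- The set of the family to which a job belongs during a round. -/
def current {n : ℕ} (B : Fin n → ℕ) (H : Finset (Fin n)) (o : Fin n → ℕ) (j : Fin n) : ℕ :=
  if j ∈ H then o j else B j

/-- The ordinal numbers after job `j` has been handled. -/
def handled {n : ℕ} (I : Inst n) (o : Fin n → ℕ) (j : Fin n) (k : ℕ) (x : Fin n) : ℕ :=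
  if x = j then k else if x ∈ I.preds j then min (o x) (k - 1) else o x

theorem Inst.not_mem_preds_self {n : ℕ} (I : Inst n) (j : Fin n) : j ∉ I.preds j :=
  fun h => I.prec_irrefl j (I.prec_of_mem_preds h)

theorem Inst.Partial.empty {n : ℕ} (I : Inst n) (ok : ℝ → Prop) (B : Fin n → ℕ) (a : ℕ) :
    I.Partial ok B a ∅ B :=
  ⟨fun _ => le_rfl, fun _ => Or.inl rfl, by simp, by simp, by simp⟩

/-- Only `j` and its direct predecessors change. None of these is in `H`, since `H` is closed under
direct successors and does not contain `j`; so everything known about handled jobs persists. -/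
theorem Inst.Partial.insert {n : ℕ} {I : Inst n} {ok : ℝ → Prop} {B : Fin n → ℕ} {a : ℕ}
    {H : Finset (Fin n)} {o : Fin n → ℕ} (h : I.Partial ok B a H o) (hB : I.IsCSF B a)
    {j : Fin n} (hj : j ∉ H) (hsucc : ∀ j', j ∈ I.preds j' → j' ∈ H) {k₁ k : ℕ} (h1 : 1 ≤ k₁)
    (hk₁ : k₁ ≤ B j) (hgood : ok (I.f j (I.compl B a k₁)))
    (hbad : ∀ l, k₁ < l → l ≤ B j → ¬ ok (I.f j (I.compl B a l))) (hk : k = min k₁ (o j)) :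
    I.Partial ok B a (insert j H) (handled I o j k) := by
  have hpredH : ∀ x, x ∈ I.preds j → x ∉ H := fun x hx hxH => hj (h.up x j hx hxH)
  have hself : handled I o j k j = k := by simp [handled]
  have hH : ∀ x ∈ H, handled I o j k x = o x := by
    intro x hx
    have h2 : x ≠ j := by rintro rfl; exact hj hx
    have h3 : x ∉ I.preds j := fun h3 => hpredH x h3 hx
    simp [handled, h2, h3]
  have hle : ∀ x, x ≠ j → handled I o j k x ≤ o x := by
    intro x hx
    unfold handled
    rw [if_neg hx]
    split_ifs
    · exact min_le_left _ _
    · exact le_rfl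
  have hkB : k ≤ B j := hk ▸ (min_le_left _ _).trans hk₁
  refine ⟨fun x => ?_, fun x => ?_, fun x y hxy hy => ?_, fun x hx hxB => ?_, fun x y hxy hx => ?_⟩
  · by_cases hx : x = j
    · rw [hx, hself]; exact hkB
    · exact (hle x hx).trans (h.le x)
  · by_cases hx : x = j
    · subst hx
      rw [hself]
      -- Either the cost decides the minimum and becomes the reason, or the ordinal number stays and
      -- keeps its old reason.
      rcases le_or_gt k₁ (o x) with h2 | h2
      · rw [min_eq_left h2] at hk
        subst hk
        exact Or.inr (Or.inl ⟨Finset.mem_insert_self _ _, h1, hgood, hbad⟩)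
      · rw [min_eq_right h2.le] at hk
        subst hk
        rcases h.tight x with h3 | ⟨h3, -⟩ | ⟨j', h3, h4, h5, h6⟩
        · exact Or.inl h3
        · exact absurd h3 hj
        · exact Or.inr (Or.inr ⟨j', h3, Finset.mem_insert_of_mem h4, by rwa [hH j' h4],
            by rwa [hH j' h4]⟩)
    -- A predecessor that is really lowered has `j` as its reason. Then `k ≤ o x ≤ B x < B j`, so
    -- `j` has been lowered as well.
    · by_cases hxp : x ∈ I.preds j ∧ k - 1 < o x
      · refine Or.inr (Or.inr ⟨j, hxp.1, Finset.mem_insert_self _ _, ?_, ?_⟩)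
        · rw [hself]; simp only [handled, if_neg hx, if_pos hxp.1]; omega
        · rw [hself]
          have h2 := h.le x
          have h3 := hB.mono x j hxp.1
          omega
      · have hx' : handled I o j k x = o x := by
          unfold handled
          rw [if_neg hx]
          split_ifs with h2
          · have : ¬ k - 1 < o x := fun h3 => hxp ⟨h2, h3⟩
            omega
          · rfl
        rw [hx']
        rcases h.tight x with h3 | ⟨h3, h4⟩ | ⟨j', h3, h4, h5, h6⟩
        · exact Or.inl h3
        · exact Or.inr (Or.inl ⟨Finset.mem_insert_of_mem h3, h4⟩)
        · exact Or.inr (Or.inr ⟨j', h3, Finset.mem_insert_of_mem h4, by rwa [hH j' h4],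
            by rwa [hH j' h4]⟩)
  · have hxj : x ≠ y := by rintro rfl; exact I.not_mem_preds_self _ hxy
    rcases Finset.mem_insert.1 hy with rfl | hy
    · rw [hself]
      simp only [handled, if_neg hxj, if_pos hxy]
      exact min_le_right _ _
    · have h2 := h.pred x y hxy hy
      rw [hH y hy]
      by_cases hx : x = j
      · subst hx
        rw [hself, hk]
        exact (min_le_right _ _).trans h2
      · exact (hle x hx).trans h2
  · rcases Finset.mem_insert.1 hx with rfl | hx
    · rw [hself] at hxB
      have h2 : k ≤ k₁ := hk ▸ min_le_left _ _
      have : B x = k₁ := by omega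
      rwa [this]
    · rw [hH x hx] at hxB
      exact h.stay x hx hxB
  · rcases Finset.mem_insert.1 hx with rfl | hx
    · exact Finset.mem_insert_of_mem (hsucc y hxy)
    · exact Finset.mem_insert_of_mem (h.up x y hxy hx)

theorem Inst.Partial.not_feasible_of_empty {n : ℕ} {I : Inst n} {ok : ℝ → Prop} {B : Fin n → ℕ}
    {a : ℕ} {H : Finset (Fin n)} {o : Fin n → ℕ} (h : I.Partial ok B a H o)
    (hbd : I.Bounding ok B) (hB : I.IsCSF B a) (hok : ∀ x y, x ≤ y → ok y → ok x) {i : ℕ}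
    (hai : a ≤ i) (hin : i ≤ n) (hi : ∀ j, current B H o j ≠ i)
    {σ : Schedule n} (hσ : σ.Feasible I) : ¬ ∀ j, ok (I.f j (σ.C I j)) := by
  refine hbd.not_feasible hB hok hai hin (fun j hj => ?_) hσ
  -- Follow the reasons along successors. If `j` was lowered because of `j'`, then `o j' ≤ i`; since
  -- set `i` is empty, `o j' < i`, and the argument repeats with `j'`. The chain ends at a job too
  -- expensive at the completion time of batch `i`.
  have key : ∀ j, i ≤ B j → o j < i →
      ∃ j₀, (j₀ = j ∨ I.prec j j₀) ∧ ¬ ok (I.f j₀ (I.compl B a i)) := by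
    intro j
    induction j using I.prec_swap_wf.induction with
    | _ j ih =>
      intro h1 h2
      rcases h.tight j with h3 | ⟨-, -, -, h3⟩ | ⟨j', h3, h4, h5, h6⟩
      · omega
      · exact ⟨j, Or.inl rfl, h3 i h2 h1⟩
      · have h7 := hB.mono j j' h3
        have h8 := hi j'
        rw [current, if_pos h4] at h8
        have hp := I.prec_of_mem_preds h3
        obtain ⟨j₀, h9, h10⟩ := ih j' hp (by omega) (by omega)
        refine ⟨j₀, Or.inr ?_, h10⟩
        rcases h9 with rfl | h9
        · exact hp
        · exact I.prec_trans _ _ _ hp h9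
  refine key j hj.ge ?_
  have h1 := hi j
  unfold current at h1
  have h2 := h.le j
  split_ifs at h1 <;> omega

/-- A feasible schedule with costs in `ok` would put `j` into a batch `k ≤ B j` and complete it no
earlier than batch `k` of `B`. This justifies returning `∅` when no index `k₁` exists. -/
theorem Inst.Bounding.not_feasible_of_cost {n : ℕ} {I : Inst n} {ok : ℝ → Prop} {B : Fin n → ℕ}
    {a : ℕ} (hbd : I.Bounding ok B) (hB : I.IsCSF B a) (hok : ∀ x y, x ≤ y → ok y → ok x)
    {j : Fin n} (hj : ∀ k, 1 ≤ k → k ≤ B j → ¬ ok (I.f j (I.compl B a k)))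
    {σ : Schedule n} (hσ : σ.Feasible I) : ¬ ∀ j, ok (I.f j (σ.C I j)) := by
  intro hc
  have hle := hbd.batch_le hB.le_n hok hσ hc
  exact hj _ (hσ.one_le_batch j) (hle j)
    (hok _ _ (I.cost_le j (I.compl_nonneg _ _ _) (hσ.compl_le_C hB hle j)) (hc j))

theorem Inst.Partial.bounding {n : ℕ} {I : Inst n} {ok : ℝ → Prop} {B : Fin n → ℕ}
    {a : ℕ} {H : Finset (Fin n)} {o : Fin n → ℕ} (h : I.Partial ok B a H o)
    (hbd : I.Bounding ok B) (hB : I.IsCSF B a) (hok : ∀ x y, x ≤ y → ok y → ok x) :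
    I.Bounding ok o := by
  intro i b τ hi h1 h2 h3
  -- The jobs with `B j ≤ i` form a smaller prefix, to which the old bounds apply; for the others `τ
  -- j ≤ i < B j`.
  have hτB : ∀ j, o j ≤ i → τ j ≤ B j := by
    intro j hj
    by_cases hjB : B j ≤ i
    · refine hbd i b τ hi (fun x hx => h1 x ((h.le x).trans hx))
        (fun x y hxy hy => h2 x y hxy ((h.le y).trans hy)) (fun y hy => ?_) j hjB
      have hyi := (h.le y).trans hy
      refine hok _ _ (I.cost_le y ?_ ?_) (h3 y hyi)
      · refine add_nonneg (I.sum_p_nonneg _) (mul_nonneg ?_ I.s_nonneg)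
        have : (b : ℝ) ≤ τ y := by exact_mod_cast (h1 y hyi).1
        linarith
      · refine add_le_add_left (I.sum_p_mono fun x hx => ?_) _
        simp only [Finset.mem_filter, Finset.mem_univ, true_and] at hx ⊢
        exact ⟨(h.le x).trans hx.1, hx.2⟩
    · have := (h1 j hj).2
      omega
  intro j
  induction j using I.prec_swap_wf.induction with
  | _ j ih =>
    intro hj
    rcases h.tight j with h4 | ⟨-, -, -, h4⟩ | ⟨j', h4, h5, h6, h7⟩
    · rw [h4]; exact hτB j hj
    · by_contra! hlt
      -- By `hτB`, every job with `B x ≤ τ j` also has `τ x ≤ τ j`. Hence `j` completes in `τ` no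
      -- earlier than batch `τ j` of `B`, where its cost is too high.
      refine h4 (τ j) hlt (hτB j hj) (hok _ _ (I.cost_le j (I.compl_nonneg _ _ _) ?_) (h3 j hj))
      have hji := (h1 j hj).2
      refine add_le_add (I.sum_p_mono fun x hx => ?_) (mul_le_mul_of_nonneg_right ?_ I.s_nonneg)
      · simp only [Finset.mem_filter, Finset.mem_univ, true_and] at hx ⊢
        have h5 : o x ≤ i := (h.le x).trans (hx.trans hji)
        exact ⟨h5, (hτB x h5).trans hx⟩
      · have hbj := (h1 j hj).1
        rcases le_or_gt a (τ j) with haj | haj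
        · obtain ⟨x, hx⟩ := hB.surj a le_rfl hB.a_le_n
          have h5 : o x ≤ i := (h.le x).trans (by omega)
          have h6 := (h1 x h5).1
          have h7 := hτB x h5
          have h8 : ((τ j + 1 - a : ℕ) : ℝ) + b ≤ ((τ j + 1 : ℕ) : ℝ) := by
            exact_mod_cast (by omega)
          push_cast at h8
          linarith
        · have h5 : τ j + 1 - a = 0 := by omega
          have h6 : (b : ℝ) ≤ τ j := by exact_mod_cast hbj
          rw [h5]
          push_cast
          linarith
    · by_cases hj' : o j' ≤ i
      · have h8 := ih j' (I.prec_of_mem_preds h4) hj'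
        have h9 := h2 j j' h4 hj'
        omega
      · have h8 := (h1 j hj).2
        omega

/-- The sets from `a` on are nonempty by assumption, so only the sets below `a`, into which jobs may
have been moved, could leave a gap. -/
theorem Inst.Partial.isCSF {n : ℕ} {I : Inst n} {ok : ℝ → Prop} {B : Fin n → ℕ}
    {a : ℕ} {o : Fin n → ℕ} (h : I.Partial ok B a Finset.univ o) (hB : I.IsCSF B a)
    (hne : ∀ i, a ≤ i → i ≤ n → ∃ j, o j = i) : ∃ a', I.IsCSF o a' := by
  have hup : ∀ j, o j < a → ∃ j', o j' = o j + 1 := by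
    intro j
    induction j using I.prec_swap_wf.induction with
    | _ j ih =>
      intro hj
      rcases h.tight j with h1 | ⟨-, h1, h2, h3⟩ | ⟨j', h1, -, h3, -⟩
      · have := hB.a_le j; omega
      -- Below `a` all completion times are zero. A job lowered by its own cost therefore never
      -- stops below `a - 1`: the next index would be just as good.
      · rcases Nat.lt_or_ge (o j + 1) a with h4 | h4
        · have h5 := h3 (o j + 1) (by omega) (h4.le.trans (hB.a_le j))
          rw [I.compl_eq_zero hB.a_le h4, ← I.compl_eq_zero hB.a_le hj] at h5
          exact absurd h2 h5
        · exact hne (o j + 1) h4 (by have := hB.a_le_n; omega)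
      · rcases Nat.eq_zero_or_pos (o j') with h4 | h4
        · obtain ⟨x, hx⟩ := ih j' (I.prec_of_mem_preds h1) (by omega)
          exact ⟨x, by omega⟩
        · exact ⟨j', by omega⟩
  obtain ⟨m, -, hm⟩ := Finset.exists_min_image Finset.univ o I.univ_nonempty
  have hmin : ∀ j, o m ≤ o j := fun j => hm j (Finset.mem_univ j)
  have hsurj : ∀ i, o m ≤ i → i ≤ n → ∃ j, o j = i := by
    intro i hi
    induction i, hi using Nat.le_induction with
    | base => exact fun _ => ⟨m, rfl⟩
    | succ i hi ih =>
      intro hin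
      obtain ⟨j, rfl⟩ := ih (by omega)
      rcases Nat.lt_or_ge (o j) a with h1 | h1
      · exact hup j h1
      · exact hne _ (by omega) hin
  -- The truncated `k - 1` may have produced the ordinal number `0`. Then all `n + 1` sets `0, …, n`
  -- would be nonempty, which is impossible with `n` jobs.
  have hone : 1 ≤ o m := by
    by_contra! hlt
    have h0 : o m = 0 := by omega
    have hsub : Finset.range (n + 1) ⊆ Finset.univ.image o := by
      intro i hi
      obtain ⟨j, hj⟩ := hsurj i (by omega) (by simpa [Nat.lt_succ_iff] using hi)
      exact Finset.mem_image.2 ⟨j, Finset.mem_univ j, hj⟩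
    have h1 := Finset.card_le_card hsub
    have h2 : (Finset.univ.image o).card ≤ n := by
      simpa using Finset.card_image_le (s := (Finset.univ : Finset (Fin n))) (f := o)
    rw [Finset.card_range] at h1
    omega
  refine ⟨o m, hone, (h.le m).trans (hB.le_n m), hmin, fun j => (h.le j).trans (hB.le_n j), hsurj,
    fun x j hx => ?_⟩
  have h1 := h.pred x j hx (Finset.mem_univ j)
  have h2 := hmin j
  omega

/-! ### Reasoning about programs -/

/-- The program `c` started in memory `m` terminates, and its running time and the final memory
satisfy `Q`. -/
def Run (f : ℕ → ℝ → ℝ) (c : Stmt) (m : Mem) (Q : ℕ → Mem → Prop) : Prop :=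
  ∃ t m', Exec f c m t m' ∧ Q t m'

section Rules

variable {f : ℕ → ℝ → ℝ} {m : Mem} {Q : ℕ → Mem → Prop}

theorem Run.imp {c : Stmt} {Q' : ℕ → Mem → Prop} (h : Run f c m Q)
    (hQ : ∀ t m', Q t m' → Q' t m') : Run f c m Q' := by
  obtain ⟨t, m', he, hq⟩ := h
  exact ⟨t, m', he, hQ _ _ hq⟩

theorem run_seq {c d : Stmt} :
    Run f (c ⨟ d) m Q ↔ Run f c m fun t m' => Run f d m' fun t' m'' => Q (t + t') m'' := by
  constructor
  · rintro ⟨t, m', he, hq⟩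
    cases he with
    | seq h1 h2 => exact ⟨_, _, h1, _, _, h2, hq⟩
  · rintro ⟨t, m', h1, t', m'', h2, hq⟩
    exact ⟨_, _, .seq h1 h2, hq⟩

theorem run_setN {x : NVar} {e : NExp} :
    Run f (.setN x e) m Q ↔ Q (e.time + 1) (m.setN x (e.eval m)) := by
  constructor
  · rintro ⟨t, m', he, hq⟩
    cases he
    exact hq
  · exact fun h => ⟨_, _, .setN _ _ _, h⟩

theorem run_putN {a : NArr} {i i' e : NExp} : Run f (.putN a i i' e) m Q ↔
    Q (i.time + i'.time + e.time + 1) (m.putN a (i.eval m) (i'.eval m) (e.eval m)) := by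
  constructor
  · rintro ⟨t, m', he, hq⟩
    cases he
    exact hq
  · exact fun h => ⟨_, _, .putN _ _ _ _ _, h⟩

theorem run_setR {x : RVar} {r : RExp} :
    Run f (.setR x r) m Q ↔ Q (r.time + 1) (m.setR x (r.eval f m)) := by
  constructor
  · rintro ⟨t, m', he, hq⟩
    cases he
    exact hq
  · exact fun h => ⟨_, _, .setR _ _ _, h⟩

theorem run_putR {a : RArr} {i i' : NExp} {r : RExp} : Run f (.putR a i i' r) m Q ↔
    Q (i.time + i'.time + r.time + 1) (m.putR a (i.eval m) (i'.eval m) (r.eval f m)) := by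
  constructor
  · rintro ⟨t, m', he, hq⟩
    cases he
    exact hq
  · exact fun h => ⟨_, _, .putR _ _ _ _ _, h⟩

theorem run_ite {b : BExp} {c d : Stmt} : Run f (.ite b c d) m Q ↔
    (b.Holds f m → Run f c m fun t m' => Q (b.time + 1 + t) m') ∧
    (¬ b.Holds f m → Run f d m fun t m' => Q (b.time + 1 + t) m') := by
  constructor
  · rintro ⟨t, m', he, hq⟩
    cases he with
    | ite_true hb h => exact ⟨fun _ => ⟨_, _, h, hq⟩, fun h' => absurd hb h'⟩
    | ite_false hb h => exact ⟨fun h' => absurd h' hb, fun _ => ⟨_, _, h, hq⟩⟩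
  · rintro ⟨h1, h2⟩
    by_cases hb : b.Holds f m
    · obtain ⟨t, m', h, hq⟩ := h1 hb
      exact ⟨_, _, .ite_true hb h, hq⟩
    · obtain ⟨t, m', h, hq⟩ := h2 hb
      exact ⟨_, _, .ite_false hb h, hq⟩

theorem run_when {b : BExp} {c : Stmt} : Run f (.when b c) m Q ↔
    (b.Holds f m → Run f c m fun t m' => Q (b.time + 1 + t) m') ∧
    (¬ b.Holds f m → Q (b.time + 1) m) := by
  constructor
  · rintro ⟨t, m', he, hq⟩
    cases he with
    | when_true hb h => exact ⟨fun _ => ⟨_, _, h, hq⟩, fun h' => absurd hb h'⟩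
    | when_false hb => exact ⟨fun h' => absurd h' hb, fun _ => hq⟩
  · rintro ⟨h1, h2⟩
    by_cases hb : b.Holds f m
    · obtain ⟨t, m', h, hq⟩ := h1 hb
      exact ⟨_, _, .when_true hb h, hq⟩
    · exact ⟨_, _, .when_false hb, h2 hb⟩

end Rules

/-! ### Memory access -/

namespace Mem

variable (m : Mem)

@[simp] theorem nv_setN (x y : NVar) (v : ℕ) :
    (m.setN x v).nv y = if y = x then v else m.nv y := by
  simp [setN, Function.update_apply]
@[simp] theorem na_setN (x : NVar) (v : ℕ) : (m.setN x v).na = m.na := rfl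
@[simp] theorem rv_setN (x : NVar) (v : ℕ) : (m.setN x v).rv = m.rv := rfl
@[simp] theorem ra_setN (x : NVar) (v : ℕ) : (m.setN x v).ra = m.ra := rfl
@[simp] theorem nv_putN (a : NArr) (i i' v : ℕ) : (m.putN a i i' v).nv = m.nv := rfl
@[simp] theorem na_putN (a a' : NArr) (i i' j j' v : ℕ) :
    (m.putN a i i' v).na a' j j' = if a' = a ∧ j = i ∧ j' = i' then v else m.na a' j j' := by
  by_cases h1 : a' = a <;> by_cases h2 : j = i <;> by_cases h3 : j' = i' <;> subst_vars <;>
    simp_all [putN]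
@[simp] theorem rv_putN (a : NArr) (i i' v : ℕ) : (m.putN a i i' v).rv = m.rv := rfl
@[simp] theorem ra_putN (a : NArr) (i i' v : ℕ) : (m.putN a i i' v).ra = m.ra := rfl
@[simp] theorem nv_setR (x : RVar) (v : ℝ) : (m.setR x v).nv = m.nv := rfl
@[simp] theorem na_setR (x : RVar) (v : ℝ) : (m.setR x v).na = m.na := rfl
@[simp] theorem rv_setR (x z : RVar) (v : ℝ) :
    (m.setR x v).rv z = if z = x then v else m.rv z := by
  simp [setR, Function.update_apply]
@[simp] theorem ra_setR (x : RVar) (v : ℝ) : (m.setR x v).ra = m.ra := rfl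
@[simp] theorem nv_putR (a : RArr) (i i' : ℕ) (v : ℝ) : (m.putR a i i' v).nv = m.nv := rfl
@[simp] theorem na_putR (a : RArr) (i i' : ℕ) (v : ℝ) : (m.putR a i i' v).na = m.na := rfl
@[simp] theorem rv_putR (a : RArr) (i i' : ℕ) (v : ℝ) : (m.putR a i i' v).rv = m.rv := rfl
@[simp] theorem ra_putR (a a' : RArr) (i i' j j' : ℕ) (v : ℝ) :
    (m.putR a i i' v).ra a' j j' = if a' = a ∧ j = i ∧ j' = i' then v else m.ra a' j j' := by
  by_cases h1 : a' = a <;> by_cases h2 : j = i <;> by_cases h3 : j' = i' <;> subst_vars <;>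
    simp_all [putR]

end Mem

/-! ### What a program leaves unchanged -/

namespace Stmt

/-- Registers and arrays assigned by a program. -/
def wN : Stmt → List NVar
  | setN x _ => [x]
  | putN .. => []
  | setR .. => []
  | putR .. => []
  | seq c d => c.wN ++ d.wN
  | ite _ c d => c.wN ++ d.wN
  | when _ c => c.wN
  | loop _ c => c.wN

/-- See `wN`. -/
def wNA : Stmt → List NArr
  | setN .. => []
  | putN a .. => [a]
  | setR .. => []
  | putR .. => []
  | seq c d => c.wNA ++ d.wNA
  | ite _ c d => c.wNA ++ d.wNA
  | when _ c => c.wNA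
  | loop _ c => c.wNA

/-- See `wN`. -/
def wR : Stmt → List RVar
  | setN .. => []
  | putN .. => []
  | setR x _ => [x]
  | putR .. => []
  | seq c d => c.wR ++ d.wR
  | ite _ c d => c.wR ++ d.wR
  | when _ c => c.wR
  | loop _ c => c.wR

/-- See `wN`. -/
def wRA : Stmt → List RArr
  | setN .. => []
  | putN .. => []
  | setR .. => []
  | putR a .. => [a]
  | seq c d => c.wRA ++ d.wRA
  | ite _ c d => c.wRA ++ d.wRA
  | when _ c => c.wRA
  | loop _ c => c.wRA

end Stmt

/-- The memories `m` and `m'` agree on everything that `c` does not assign. -/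
structure Agree (c : Stmt) (m m' : Mem) : Prop where
  nv : ∀ x, x ∉ c.wN → m'.nv x = m.nv x
  na : ∀ a, a ∉ c.wNA → m'.na a = m.na a
  rv : ∀ x, x ∉ c.wR → m'.rv x = m.rv x
  ra : ∀ a, a ∉ c.wRA → m'.ra a = m.ra a

theorem Agree.refl (c : Stmt) (m : Mem) : Agree c m m :=
  ⟨fun _ _ => rfl, fun _ _ => rfl, fun _ _ => rfl, fun _ _ => rfl⟩

theorem Agree.trans {c : Stmt} {m m' m'' : Mem} (h : Agree c m m') (h' : Agree c m' m'') :
    Agree c m m'' :=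
  ⟨fun x hx => (h'.nv x hx).trans (h.nv x hx), fun x hx => (h'.na x hx).trans (h.na x hx),
    fun x hx => (h'.rv x hx).trans (h.rv x hx), fun x hx => (h'.ra x hx).trans (h.ra x hx)⟩

/-- This is the frame rule. The assigned registers and arrays are computed from the syntax, so later
preservation claims reduce to `decide`. -/
theorem Exec.agree {f : ℕ → ℝ → ℝ} {c : Stmt} {m m' : Mem} {t : ℕ} (h : Exec f c m t m') :
    Agree c m m' := by
  induction h with
  | setN x e m => exact ⟨fun y hy => by simp_all [Stmt.wN], by simp, by simp, by simp⟩
  | setR x e m => exact ⟨by simp, by simp, fun z hz => by simp_all [Stmt.wR], by simp⟩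
  | putN a i i' e m =>
    exact ⟨by simp, fun y hy => by ext; simp_all [Stmt.wNA], by simp, by simp⟩
  | putR a i i' e m =>
    exact ⟨by simp, by simp, by simp, fun y hy => by ext; simp_all [Stmt.wRA]⟩
  | seq _ _ ih ih' =>
    constructor <;> intro x hx
    · simp only [Stmt.wN, List.mem_append, not_or] at hx
      rw [ih'.nv x hx.2, ih.nv x hx.1]
    · simp only [Stmt.wNA, List.mem_append, not_or] at hx
      rw [ih'.na x hx.2, ih.na x hx.1]
    · simp only [Stmt.wR, List.mem_append, not_or] at hx
      rw [ih'.rv x hx.2, ih.rv x hx.1]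
    · simp only [Stmt.wRA, List.mem_append, not_or] at hx
      rw [ih'.ra x hx.2, ih.ra x hx.1]
  | ite_true _ _ ih =>
    constructor <;> intro x hx
    · exact ih.nv x fun h => hx (List.mem_append_left _ h)
    · exact ih.na x fun h => hx (List.mem_append_left _ h)
    · exact ih.rv x fun h => hx (List.mem_append_left _ h)
    · exact ih.ra x fun h => hx (List.mem_append_left _ h)
  | ite_false _ _ ih =>
    constructor <;> intro x hx
    · exact ih.nv x fun h => hx (List.mem_append_right _ h)
    · exact ih.na x fun h => hx (List.mem_append_right _ h)
    · exact ih.rv x fun h => hx (List.mem_append_right _ h)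
    · exact ih.ra x fun h => hx (List.mem_append_right _ h)
  | when_true _ _ ih => exact ⟨ih.nv, ih.na, ih.rv, ih.ra⟩
  | when_false _ => exact ⟨by simp, by simp, by simp, by simp⟩
  | loop_true _ _ _ ih ih' =>
    constructor <;> intro x hx
    · rw [ih'.nv x hx, ih.nv x hx]
    · rw [ih'.na x hx, ih.na x hx]
    · rw [ih'.rv x hx, ih.rv x hx]
    · rw [ih'.ra x hx, ih.ra x hx]
  | loop_false _ => exact ⟨by simp, by simp, by simp, by simp⟩

theorem Run.agree {f : ℕ → ℝ → ℝ} {c : Stmt} {m : Mem} {Q : ℕ → Mem → Prop} (h : Run f c m Q) :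
    Run f c m fun t m' => Q t m' ∧ Agree c m m' := by
  obtain ⟨t, m', he, hq⟩ := h
  exact ⟨t, m', he, hq, he.agree⟩

/-! ### Invariant rules for loops -/

section LoopRules

variable {f : ℕ → ℝ → ℝ} {m : Mem} {Q : ℕ → Mem → Prop}

/-- Rule for loops: `Inv v t m'` is an invariant that holds with elapsed time `t` and decreasing
variant `v`. -/
theorem run_loop {b : BExp} {c : Stmt} (Inv : ℕ → ℕ → Mem → Prop) {v : ℕ} (h0 : Inv v 0 m)
    (hstep : ∀ v t m', Agree c m m' → Inv v t m' → b.Holds f m' →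
      Run f c m' fun t' m'' => ∃ v' < v, Inv v' (t + (b.time + 1 + t')) m'')
    (hend : ∀ v t m', Agree c m m' → Inv v t m' → ¬ b.Holds f m' → Q (t + (b.time + 1)) m') :
    Run f (.loop b c) m Q := by
  suffices h : ∀ v t m', Agree c m m' → Inv v t m' →
      Run f (.loop b c) m' fun t' m'' => Q (t + t') m'' by
    simpa using h v 0 m (Agree.refl _ _) h0
  intro v
  induction v using Nat.strong_induction_on with
  | _ v ih =>
    intro t m' ha hm
    by_cases hb : b.Holds f m'
    · obtain ⟨t₁, m₁, he, v', hv', hi⟩ := hstep v t m' ha hm hb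
      obtain ⟨t₂, m₂, he', hq⟩ := ih v' hv' _ _ (ha.trans he.agree) hi
      refine ⟨_, _, .loop_true hb he he', ?_⟩
      simpa only [add_assoc] using hq
    · exact ⟨_, _, .loop_false hb, hend v t m' ha hm hb⟩

/-- Rule for `forUp` with a constant time bound for the body. -/
theorem run_forUp {x : NVar} {a b : NExp} {body : Stmt} (lo hi T : ℕ) (Inv : ℕ → Mem → Prop)
    (hx : x ∉ body.wN) (ha : a.eval m = lo) (hlh : lo ≤ hi) (h0 : Inv lo (m.setN x lo))
    (hb : ∀ i m', Agree (forUp x a b body) m m' → Inv i m' → b.eval m' = hi)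
    (hstep : ∀ i m', lo ≤ i → i < hi → Agree (forUp x a b body) m m' → m'.nv x = i → Inv i m' →
      Run f body m' fun t' m'' => t' ≤ T ∧ Inv (i + 1) (m''.setN x (i + 1)))
    (hend : ∀ t m', Agree (forUp x a b body) m m' →
      t ≤ (hi - lo) * (T + b.time + 7) + a.time + b.time + 4 → Inv hi m' → Q t m') :
    Run f (forUp x a b body) m Q := by
  have hagree : ∀ m', Agree (body ⨟ .setN x (.add (.var x) (.lit 1))) (m.setN x lo) m' →
      Agree (forUp x a b body) m m' := by
    intro m' h
    refine ⟨fun z hz => ?_, h.na, h.rv, h.ra⟩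
    simp only [forUp, Stmt.wN, List.mem_append, List.mem_singleton, not_or] at hz
    rw [h.nv z (by simpa [Stmt.wN] using hz.2), Mem.nv_setN, if_neg hz.1]
  have hrun : Run f (forUp x a b body) m fun t m' =>
      (t ≤ (hi - lo) * (T + b.time + 7) + a.time + b.time + 4 ∧ Inv hi m') := by
    rw [forUp, run_seq, run_setN, ha]
    -- Besides the body, an iteration costs `b.time + 3` for the test and `4` for the increment, in
    -- total `b.time + 7`. The initial assignment and the last test give `a.time + b.time + 4`.
    refine run_loop (v := hi - lo) (fun v t m' => ∃ i, lo ≤ i ∧ i ≤ hi ∧ v = hi - i ∧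
      t ≤ (i - lo) * (T + b.time + 7) ∧ m'.nv x = i ∧ Inv i m')
      ⟨lo, le_rfl, hlh, rfl, by simp, by simp, h0⟩ ?_ ?_
    · rintro v t m' hag ⟨i, h1, h2, rfl, h3, h4, h4'⟩ h5
      simp only [BExp.Holds, NExp.eval, h4, hb i m' (hagree _ hag) h4'] at h5
      rw [run_seq]
      refine (hstep i m' h1 h5 (hagree _ hag) h4 h4').agree.imp fun t' m'' h6 => ?_
      rw [run_setN]
      have h6' : m''.nv x = i := (h6.2.nv x hx).trans h4
      refine ⟨hi - (i + 1), by omega, i + 1, by omega, by omega, rfl, ?_, ?_, ?_⟩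
      · have h7 : i + 1 - lo = (i - lo) + 1 := by omega
        have h8 := h6.1.1
        rw [h7, Nat.add_mul, Nat.one_mul]
        simp only [BExp.time, NExp.time]
        omega
      · simp [NExp.eval, h6']
      · simpa [NExp.eval, h6'] using h6.1.2
    · rintro v t m' hag ⟨i, h1, h2, rfl, h3, h4, h4'⟩ h5
      simp only [BExp.Holds, NExp.eval, h4, hb i m' (hagree _ hag) h4'] at h5
      obtain rfl : i = hi := by omega
      refine ⟨?_, h4'⟩
      simp only [BExp.time, NExp.time]
      omega
  exact hrun.agree.imp fun t m' h => hend t m' h.2 h.1.1 h.1.2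

end LoopRules

/-- The program `c` does not change the memory cells that hold the instance. -/
def KeepsInput (c : Stmt) : Prop :=
  .n ∉ c.wN ∧ .s ∉ c.wR ∧ .p ∉ c.wRA ∧ .np ∉ c.wNA ∧ .pred ∉ c.wNA

theorem Inst.LoadedIn.of_agree {n : ℕ} {I : Inst n} {c : Stmt} {m m' : Mem} (h : I.LoadedIn m)
    (ha : Agree c m m') (hc : KeepsInput c) : I.LoadedIn m' :=
  ⟨(ha.nv _ hc.1).trans h.n_eq, (ha.rv _ hc.2.1).trans h.s_eq,
    fun j => by rw [ha.ra _ hc.2.2.1, h.p_eq], fun j => by rw [ha.na _ hc.2.2.2.1, h.np_eq],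
    fun j q => by rw [ha.na _ hc.2.2.2.2, h.pred_eq]⟩

/-! ### Forming and scheduling the batches -/

section

variable {n : ℕ} {f : ℕ → ℝ → ℝ} {m : Mem} {Q : ℕ → Mem → Prop}

/-- `bat[i]` lists the jobs in `l`. -/
def HoldsList (m : Mem) (i : ℕ) (l : List (Fin n)) : Prop :=
  m.na .size i 0 = l.length ∧ ∀ (c : ℕ) (x : Fin n), l[c]? = some x → m.na .bat i c = x

/-- The jobs with ordinal number `i` among the first `q` jobs. -/
def members (B : Fin n → ℕ) (i q : ℕ) : List (Fin n) :=
  ((List.finRange n).take q).filter (B · = i)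

theorem members_succ (B : Fin n → ℕ) (i : ℕ) {q : ℕ} (hq : q < n) :
    members B i (q + 1) = members B i q ++ if B ⟨q, hq⟩ = i then [⟨q, hq⟩] else [] := by
  have h : (List.finRange n).take (q + 1) = (List.finRange n).take q ++ [⟨q, hq⟩] := by
    rw [List.take_add_one]
    simp [hq]
  rw [members, members, h, List.filter_append, List.filter_singleton]
  by_cases h : B ⟨q, hq⟩ = i <;> simp [h]

theorem mem_members (B : Fin n → ℕ) (i : ℕ) (j : Fin n) : j ∈ members B i n ↔ B j = i := by
  have : (List.finRange n).take n = List.finRange n := List.take_of_length_le (by simp)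
  simp [members, this]

theorem members_nodup (B : Fin n → ℕ) (i q : ℕ) : (members B i q).Nodup :=
  (((List.nodup_finRange n).sublist (List.take_sublist _ _))).filter _

theorem members_toFinset (B : Fin n → ℕ) (i : ℕ) :
    (members B i n).toFinset = ({j | B j = i} : Finset (Fin n)) := by
  ext j
  simp [mem_members]

theorem HoldsList.append {m m' : Mem} {i : ℕ} {l : List (Fin n)} (h : HoldsList m i l) {j : Fin n}
    (hs : m'.na .size i 0 = m.na .size i 0 + 1)
    (hb : ∀ c, m'.na .bat i c = if c = m.na .size i 0 then (j : ℕ) else m.na .bat i c) :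
    HoldsList m' i (l ++ [j]) := by
  refine ⟨by rw [hs, h.1]; simp, fun c x hc => ?_⟩
  rw [hb, h.1]
  rcases lt_trichotomy c l.length with h1 | h1 | h1
  · rw [List.getElem?_append_left h1] at hc
    rw [if_neg h1.ne, h.2 c x hc]
  · subst h1
    simp at hc
    simp [hc]
  · rw [List.getElem?_eq_none (by simp; omega)] at hc
    simp at hc

theorem HoldsList.congr {m m' : Mem} {i : ℕ} {l : List (Fin n)} (h : HoldsList m i l)
    (hs : m'.na .size i 0 = m.na .size i 0) (hb : ∀ c, m'.na .bat i c = m.na .bat i c) :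
    HoldsList m' i l :=
  ⟨hs.trans h.1, fun c x hc => (hb c).trans (h.2 c x hc)⟩

/-- The lists, cardinalities and processing times of the batches given by `B` are in memory, up to
the `q`-th job. -/
def Formed (I : Inst n) (B : Fin n → ℕ) (q : ℕ) (m : Mem) : Prop :=
  ∀ i ≤ n, HoldsList m i (members B i q) ∧ m.na .cnt i 0 = (members B i q).length ∧
    m.ra .bp i 0 = ((members B i q).map I.p).sum

theorem Formed.size_eq {I : Inst n} {B : Fin n → ℕ} (h : Formed I B n m) {i : ℕ} (hi : i ≤ n) :
    m.na .size i 0 = (Finset.univ.filter (B · = i)).card := by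
  rw [(h i hi).1.1, ← members_toFinset, List.toFinset_card_of_nodup (members_nodup _ _ _)]

theorem Formed.cnt_eq {I : Inst n} {B : Fin n → ℕ} (h : Formed I B n m) {i : ℕ} (hi : i ≤ n) :
    m.na .cnt i 0 = (Finset.univ.filter (B · = i)).card := by
  rw [(h i hi).2.1, ← members_toFinset, List.toFinset_card_of_nodup (members_nodup _ _ _)]

theorem Formed.bp_eq {I : Inst n} {B : Fin n → ℕ} (h : Formed I B n m) {i : ℕ} (hi : i ≤ n) :
    m.ra .bp i 0 = ∑ j with B j = i, I.p j := by
  rw [(h i hi).2.2, ← members_toFinset, List.sum_toFinset _ (members_nodup _ _ _)]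

theorem run_formBatches {I : Inst n} (hm : I.LoadedIn m) {B : Fin n → ℕ}
    (hord : ∀ j : Fin n, m.na .ord j 0 = B j) :
    Run f formBatches m fun t m' => t ≤ 80 * (n + 1) ∧ Formed I B n m' := by
  rw [formBatches, run_seq]
  refine run_forUp 0 (n + 1) 20 (fun i m' => ∀ i' < i, m'.na .size i' 0 = 0 ∧
    m'.na .cnt i' 0 = 0 ∧ m'.ra .bp i' 0 = 0) (by decide) rfl (by omega) (by simp) ?_ ?_ ?_
  · intro i m' ha _
    simp [NExp.eval, ha.nv .n (by decide), hm.n_eq]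
  · intro i m' _ hi ha hx h
    simp only [run_seq, run_putN, run_putR, Stmt.putN1, Stmt.putR1]
    refine ⟨by simp [NExp.time, RExp.time], fun i' hi' => ?_⟩
    by_cases h1 : i' = i
    · simp [NExp.eval, RExp.eval, hx, h1]
    · simpa [NExp.eval, RExp.eval, hx, h1] using h i' (by omega)
  · intro t₁ m₁ ha₁ ht₁ h1
    have hm₁ := hm.of_agree ha₁ (by unfold KeepsInput; decide)
    have hord₁ : ∀ j : Fin n, m₁.na .ord j 0 = B j := fun j => by
      rw [ha₁.na .ord (by decide), hord]
    refine run_forUp 0 n 42 (fun q m' => Formed I B q m') (by decide) rfl (by omega) ?_ ?_ ?_ ?_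
    · intro i hi
      obtain ⟨h2, h3, h4⟩ := h1 i (by omega)
      simp [HoldsList, members, h2, h3, h4]
    · intro i m' ha _
      simp [NExp.eval, ha.nv .n (by decide), hm₁.n_eq]
    · intro q m' _ hq ha hx h
      simp only [run_seq, run_putN, run_putR, run_setN, Stmt.putN1, Stmt.putR1]
      refine ⟨by simp [NExp.time, RExp.time], fun i hi => ?_⟩
      have hoq : m'.na .ord q 0 = B ⟨q, hq⟩ := by
        rw [ha.na .ord (by decide)]; exact hord₁ ⟨q, hq⟩
      have hpq : m'.ra .p q 0 = I.p ⟨q, hq⟩ := by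
        rw [ha.ra .p (by decide)]; exact hm₁.p_eq ⟨q, hq⟩
      obtain ⟨h2, h3, h4⟩ := h i hi
      rw [members_succ B i hq]
      by_cases h5 : B ⟨q, hq⟩ = i
      · refine ⟨?_, ?_, ?_⟩
        · rw [if_pos h5]
          refine h2.append ?_ fun c => ?_
          · simp [NExp.eval, hx, hoq, h5]
          · simp [NExp.eval, hx, hoq, h5]
        · simp [NExp.eval, hx, hoq, h5, h3]
        · simp [NExp.eval, RExp.eval, hx, hoq, h5, hpq, h4]
      · have h5' : ¬ i = B ⟨q, hq⟩ := fun h => h5 h.symm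
        refine ⟨?_, ?_, ?_⟩
        · rw [if_neg h5, List.append_nil]
          refine h2.congr ?_ fun c => ?_
          · simp [NExp.eval, hx, hoq, h5']
          · simp [NExp.eval, hx, hoq, h5']
        · simp [NExp.eval, hx, hoq, h5, h5', h3]
        · simp [NExp.eval, RExp.eval, hx, hoq, h5, h5', h4]
    · intro t₂ m₂ _ ht₂ h2
      refine ⟨?_, h2⟩
      simp only [NExp.time] at ht₁ ht₂
      omega

theorem run_scheduleBatches {I : Inst n} (hm : I.LoadedIn m) {B : Fin n → ℕ} {a : ℕ}
    (hB : I.IsCSF B a) (h : Formed I B n m) :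
    Run f scheduleBatches m fun t m' => t ≤ 80 * (n + 1) ∧
      (∀ i ≤ n, m'.ra .C i 0 = I.compl B a i) ∧
      ∀ i, 1 ≤ i → i ≤ n → m'.ra .S i 0 = I.compl B a i - ∑ j with B j = i, I.p j := by
  rw [scheduleBatches, run_seq, Stmt.putR1, run_putR]
  refine run_forUp 1 (n + 1) 35 (fun i m' => (∀ i' < i, m'.ra .C i' 0 = I.compl B a i') ∧
      ∀ i', 1 ≤ i' → i' < i → m'.ra .S i' 0 = I.compl B a i' - ∑ j with B j = i', I.p j)
      (by decide) rfl (by omega) ⟨?_, ?_⟩ ?_ ?_ ?_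
  · intro i' hi'
    obtain rfl : i' = 0 := by omega
    simp [NExp.eval, RExp.eval, I.compl_eq_zero hB.a_le hB.one_le]
  · intro i' h1 h2
    omega
  · intro i m' ha _
    simp [NExp.eval, ha.nv .n (by decide), hm.n_eq]
  · rintro i m' hi1 hi ha hx ⟨h1, h2⟩
    obtain ⟨k, rfl⟩ : ∃ k, i = k + 1 := ⟨i - 1, by omega⟩
    have hbp : m'.ra .bp (k + 1) 0 = ∑ j with B j = k + 1, I.p j := by
      rw [ha.ra .bp (by decide), Mem.ra_putR, if_neg (by simp), h.bp_eq (by omega)]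
    have hs : m'.rv .s = I.s := by rw [ha.rv .s (by decide), Mem.rv_putR, hm.s_eq]
    have hsz : m'.na .size (k + 1) 0 = (Finset.univ.filter (B · = k + 1)).card := by
      rw [ha.na .size (by decide), Mem.na_putR, h.size_eq (by omega)]
    have hC := h1 k (by omega)
    -- The program decides about the setup by the size of the batch, whereas `compl` does so by
    -- comparison with `a`; contiguity makes these equivalent.
    have hzero : m'.na .size (k + 1) 0 = 0 ↔ ¬ a ≤ k + 1 := by
      rw [hsz, Finset.card_eq_zero, Finset.filter_eq_empty_iff]
      constructor
      · intro h3 h4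
        obtain ⟨j, hj⟩ := hB.surj (k + 1) h4 (by omega)
        exact h3 (Finset.mem_univ j) hj
      · intro h3 j _ hj
        have := hB.a_le j
        omega
    have key : ∀ t'' m'', t'' ≤ 17 → m''.nv = m'.nv → (∀ i, m''.ra .bp i 0 = m'.ra .bp i 0) →
        (∀ i, m''.ra .C i 0 = m'.ra .C i 0) → (∀ i', m''.ra .S i' 0 = if i' = k + 1 then
          I.compl B a (k + 1) - ∑ j with B j = k + 1, I.p j else m'.ra .S i' 0) →
        Run f (.putR .C (.var .i) (.lit 0) (.add (.get1 .S (.var .i)) (.get1 .bp (.var .i)))) m''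
        fun t' m''' => t'' + t' ≤ 35 ∧
          ((∀ i' < k + 1 + 1, (m'''.setN .i (k + 1 + 1)).ra .C i' 0 = I.compl B a i') ∧
          ∀ i', 1 ≤ i' → i' < k + 1 + 1 → (m'''.setN .i (k + 1 + 1)).ra .S i' 0 =
            I.compl B a i' - ∑ j with B j = i', I.p j) := by
      intro t'' m'' ht hnv hbp' hC' hS'
      rw [run_putR]
      refine ⟨by simp [NExp.time, RExp.time]; omega, fun i' hi' => ?_, fun i' hi1' hi' => ?_⟩
      · by_cases h3 : i' = k + 1
        · simp [NExp.eval, RExp.eval, hnv, hx, h3, hbp', hbp, hS']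
        · simp [NExp.eval, RExp.eval, hnv, hx, h3, hC', h1 i' (by omega)]
      · by_cases h3 : i' = k + 1
        · simp [NExp.eval, RExp.eval, hnv, hx, h3, hS']
        · simp [NExp.eval, RExp.eval, hnv, hx, h3, hS', h2 i' hi1' (by omega)]
    simp only [run_seq, run_ite, Stmt.putR1]
    constructor
    · intro h3
      have h4 : ¬ a ≤ k + 1 := by rw [← hzero]; simpa [BExp.Holds, NExp.eval, hx] using h3
      rw [run_putR]
      refine key _ _ ?_ ?_ ?_ ?_ fun i' => ?_
      · simp [NExp.time, RExp.time, BExp.time]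
      · simp
      · simp
      · simp
      · simp [NExp.eval, RExp.eval, hx, I.compl_succ, h4, hC]
    · intro h3
      have h4 : a ≤ k + 1 := by
        by_contra h5
        exact h3 (by simpa [BExp.Holds, NExp.eval, hx] using hzero.2 h5)
      rw [run_putR]
      refine key _ _ ?_ ?_ ?_ ?_ fun i' => ?_
      · simp [NExp.time, RExp.time, BExp.time]
      · simp
      · simp
      · simp
      · simp [NExp.eval, RExp.eval, hx, I.compl_succ, h4, hC, hs]
  · rintro t m' _ ht ⟨h1, h2⟩
    refine ⟨?_, fun i hi => h1 i (by omega), fun i hi hi' => h2 i hi (by omega)⟩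
    simp only [NExp.time, RExp.time] at ht ⊢
    omega

end

/-! ### Handling a job -/

section

variable {n : ℕ} {f : ℕ → ℝ → ℝ} {m : Mem}

theorem Inst.oracle_apply (I : Inst n) (j : Fin n) (t : ℝ) : I.oracle j t = I.f j t := by
  simp [Inst.oracle]

theorem Inst.length_preds_le (I : Inst n) (j : Fin n) : (I.preds j).length ≤ n := by
  simpa using (I.preds_nodup j).length_le_card

/-- `ok` is the set of costs below the bound `y` that is stored in memory. -/
def BoundedBy (ok : ℝ → Prop) (m : Mem) : Prop :=
  ∀ r, ok r ↔ m.nv .inf = 1 ∨ r < m.rv .y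

theorem BoundedBy.of_agree {ok : ℝ → Prop} {c : Stmt} {m m' : Mem} (h : BoundedBy ok m)
    (ha : Agree c m m') (h1 : .inf ∉ c.wN) (h2 : .y ∉ c.wR) : BoundedBy ok m' := fun r => by
  rw [h r, ha.nv _ h1, ha.rv _ h2]

theorem BoundedBy.down {ok : ℝ → Prop} (h : BoundedBy ok m) (x y : ℝ) (hxy : x ≤ y) (hy : ok y) :
    ok x := by
  rw [h] at hy ⊢
  exact hy.imp_right hxy.trans_lt

theorem BoundedBy.holds_costOK {I : Inst n} {ok : ℝ → Prop} (h : BoundedBy ok m) {j : Fin n}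
    (hj : m.nv .j = j) {r : ℝ} (hr : m.ra .C (m.nv .k1) 0 = r) :
    costOK.Holds I.oracle m ↔ ok (I.f j r) := by
  rw [h, costOK]
  simp [BExp.Holds, NExp.eval, RExp.eval, hj, hr, I.oracle_apply]

/-- The time is linear in the number `d` of rejected indices, so that it can be charged to the
distance by which the job moves. Tests do not short-circuit: `C[0]` is also read, which is why `hC`
includes index `0`. -/
theorem run_findIndex {I : Inst n} {ok : ℝ → Prop} (hok : BoundedBy ok m) {j : Fin n}
    (hj : m.nv .j = j) {i : ℕ} (hi : m.nv .k1 = i) {C : ℕ → ℝ}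
    (hC : ∀ l ≤ i, m.ra .C l 0 = C l) :
    Run I.oracle (.loop (.and (.ltN (.lit 0) (.var .k1)) (.not costOK))
      (.setN .k1 (.sub (.var .k1) (.lit 1)))) m fun t m' =>
      ∃ d, m'.nv .k1 + d = i ∧ t ≤ 25 * d + 20 ∧
        (∀ l, m'.nv .k1 < l → l ≤ i → ¬ ok (I.f j (C l))) ∧
        (1 ≤ m'.nv .k1 → ok (I.f j (C (m'.nv .k1)))) := by
  refine run_loop (v := i) (fun v t m' => m'.nv .k1 = v ∧ ∃ d, m'.nv .k1 + d = i ∧ t ≤ 25 * d ∧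
    ∀ l, m'.nv .k1 < l → l ≤ i → ¬ ok (I.f j (C l))) ?_ ?_ ?_
  · exact ⟨hi, 0, by omega, by omega, fun l _ _ => by omega⟩
  · rintro v t m' ha ⟨rfl, d, h1, h2, h3⟩ h4
    have hcost := (hok.of_agree ha (by decide) (by decide)).holds_costOK (I := I)
      ((ha.nv .j (by decide)).trans hj) ((congrFun (congrFun (ha.ra .C (by decide)) _) _).trans
        (hC (m'.nv .k1) (by omega)))
    simp only [BExp.Holds, NExp.eval] at h4
    rw [hcost] at h4
    rw [run_setN]
    refine ⟨m'.nv .k1 - 1, by omega, ?_, d + 1, ?_, ?_, ?_⟩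
    · simp [NExp.eval]
    · simp [NExp.eval]; omega
    · simp [BExp.time, NExp.time, costOK, RExp.time]; omega
    · intro l h5 h6
      simp [NExp.eval] at h5
      by_cases h7 : l = m'.nv .k1
      · rw [h7]; exact h4.2
      · exact h3 l (by omega) h6
  · rintro v t m' ha ⟨rfl, d, h1, h2, h3⟩ h4
    have hcost := (hok.of_agree ha (by decide) (by decide)).holds_costOK (I := I)
      ((ha.nv .j (by decide)).trans hj) ((congrFun (congrFun (ha.ra .C (by decide)) _) _).trans
        (hC (m'.nv .k1) (by omega)))
    simp only [BExp.Holds, NExp.eval] at h4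
    rw [hcost] at h4
    refine ⟨d, h1, ?_, h3, fun h5 => ?_⟩
    · simp [BExp.time, NExp.time, costOK, RExp.time]; omega
    · by_contra h6
      exact h4 ⟨by omega, h6⟩

theorem run_lowerPreds {I : Inst n} (hm : I.LoadedIn m) {j : Fin n} (hj : m.nv .j = j)
    {o : Fin n → ℕ} (ho : ∀ x : Fin n, m.na .ord x 0 = o x) :
    Run f (forUp .q (.lit 0) (.get1 .np (.var .j))
      (.setN .pr (.get .pred (.var .j) (.var .q)) ⨟
        .when (.ltN (.sub (.var .k) (.lit 1)) (.get1 .ord (.var .pr)))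
          (.putN1 .ord (.var .pr) (.sub (.var .k) (.lit 1))))) m fun t m' =>
      t ≤ 40 * (n + 1) ∧ ∀ x : Fin n, m'.na .ord x 0 =
        if x ∈ I.preds j then min (o x) (m.nv .k - 1) else o x := by
  refine run_forUp 0 (I.preds j).length 25 (fun q m' => ∀ x : Fin n, m'.na .ord x 0 =
    if x ∈ (I.preds j).take q then min (o x) (m.nv .k - 1) else o x) (by decide) rfl (by omega)
    (by simpa using ho) ?_ ?_ ?_
  · intro i m' ha _
    simp [NExp.eval, ha.nv .j (by decide), hj, ha.na .np (by decide), hm.np_eq]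
  · intro q m' _ hq ha hx h
    have hpr : m'.na .pred (m'.nv .j) q = (I.preds j)[q] := by
      rw [ha.nv .j (by decide), hj, ha.na .pred (by decide)]
      exact hm.pred_eq j ⟨q, hq⟩
    have hk : m'.nv .k = m.nv .k := ha.nv .k (by decide)
    have htake : (I.preds j).take (q + 1) = (I.preds j).take q ++ [(I.preds j)[q]] := by
      rw [List.take_add_one]; simp [hq]
    have hpo := h (I.preds j)[q]
    simp only [run_seq, run_when, run_putN, run_setN, Stmt.putN1]
    constructor
    · intro h1
      simp [BExp.Holds, NExp.eval, hx, hpr, hk] at h1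
      refine ⟨by simp [NExp.time, BExp.time], fun x => ?_⟩
      simp only [Mem.na_setN, Mem.na_putN, Mem.nv_setN, NExp.eval, hx, hpr, hk, htake,
        List.mem_append, List.mem_singleton]
      by_cases h2 : x = (I.preds j)[q]
      · rw [hpo] at h1
        rw [h2]
        split_ifs at h1 <;> simp <;> omega
      · have h2' : ¬ (x : ℕ) = ((I.preds j)[q] : Fin n) := fun h => h2 (Fin.ext h)
        simp [h2, h2', h x]
    · intro h1
      simp [BExp.Holds, NExp.eval, hx, hpr, hk] at h1
      refine ⟨by simp [NExp.time, BExp.time], fun x => ?_⟩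
      simp only [Mem.na_setN, htake, List.mem_append, List.mem_singleton, h x]
      by_cases h2 : x = (I.preds j)[q]
      · rw [hpo] at h1
        rw [h2]
        split_ifs at h1 <;> simp [*]
      · simp [h2]
  · intro t m' _ ht h
    have := I.length_preds_le j
    refine ⟨?_, by simpa using h⟩
    simp only [NExp.time] at ht
    omega

/-- No feasible schedule has all its costs in `ok`. -/
def Inst.Infeasible (I : Inst n) (ok : ℝ → Prop) : Prop :=
  ∀ σ : Schedule n, σ.Feasible I → ¬ ∀ j, ok (I.f j (σ.C I j))

/-- Memory during a round of AUX2 after the jobs in `H` have been handled. -/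
structure Inst.RoundState (I : Inst n) (ok : ℝ → Prop) (B : Fin n → ℕ) (a : ℕ)
    (H : Finset (Fin n)) (o : Fin n → ℕ) (m : Mem) : Prop where
  ord : ∀ x : Fin n, m.na .ord x 0 = o x
  cnt : ∀ i ≤ n, m.na .cnt i 0 = (Finset.univ.filter (current B H o · = i)).card
  part : I.Partial ok B a H o
  ne : ∀ i, a ≤ i → i ≤ n → ∃ x, current B H o x = i
  moved : m.nv .moved = 0 ↔ ∀ x, current B H o x = B x

/-- Lowering the ordinal number of a predecessor does not move it yet: it is unhandled and still
counted in its old set. Only `j` changes its set. -/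
theorem current_insert {I : Inst n} {B : Fin n → ℕ} {H : Finset (Fin n)} {o : Fin n → ℕ}
    {j : Fin n} (hup : ∀ x, x ∈ I.preds j → x ∉ H) (k : ℕ) :
    current B (insert j H) (handled I o j k) = Function.update (current B H o) j k := by
  funext x
  by_cases h1 : x = j
  · simp [current, handled, h1]
  · by_cases h2 : x ∈ H
    · have h3 : x ∉ I.preds j := fun h => hup x h h2
      simp [current, handled, h1, h2, h3]
    · simp [current, h1, h2]

theorem card_filter_update {g : Fin n → ℕ} {j : Fin n} {k : ℕ} (hk : k ≠ g j) (i : ℕ) :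
    (Finset.univ.filter (Function.update g j k · = i)).card =
      if i = g j then (Finset.univ.filter (g · = i)).card - 1
      else if i = k then (Finset.univ.filter (g · = i)).card + 1
      else (Finset.univ.filter (g · = i)).card := by
  split_ifs with h1 h2
  · have : Finset.univ.filter (Function.update g j k · = i) =
        (Finset.univ.filter (g · = i)).erase j := by
      ext x
      by_cases hx : x = j
      · simp [hx, h1, hk]
      · simp [hx]
    rw [this, Finset.card_erase_of_mem (by simp [h1])]
  · have : Finset.univ.filter (Function.update g j k · = i) =
        insert j (Finset.univ.filter (g · = i)) := by
      ext x
      by_cases hx : x = j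
      · simp [hx, h2]
      · simp [hx]
    rw [this, Finset.card_insert_of_notMem (by simp only [Finset.mem_filter, not_and]; omega)]
  · congr 1
    ext x
    by_cases hx : x = j
    · simp only [hx, Finset.mem_filter, Function.update_self]
      omega
    · simp [hx]

/-- The time bound is amortized: each place by which `j` moves down pays `150 * (n + 1)` steps, and
the constant `150` pays for a job that stays. -/
theorem run_handleJob {I : Inst n} {ok : ℝ → Prop} {B : Fin n → ℕ} {a : ℕ} {H : Finset (Fin n)}
    {o : Fin n → ℕ} (hm : I.LoadedIn m) (hok : BoundedBy ok m) (hB : I.IsCSF B a)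
    (hbd : I.Bounding ok B) (hC : ∀ i ≤ n, m.ra .C i 0 = I.compl B a i)
    (h : I.RoundState ok B a H o m) {j : Fin n} (hj : m.nv .j = j) (hi : m.nv .i = B j)
    (hjH : j ∉ H) (hsucc : ∀ j', j ∈ I.preds j' → j' ∈ H) (hst : m.nv .status = 2) :
    Run I.oracle handleJob m fun t m' =>
      (m'.nv .status = 0 ∧ I.Infeasible ok ∧ t ≤ 150 * (n + 1)) ∨
      (m'.nv .status = 2 ∧ ∃ k o', I.RoundState ok B a (insert j H) o' m' ∧
        current B (insert j H) o' = Function.update (current B H o) j k ∧ k ≤ B j ∧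
        t + 150 * (n + 1) * k ≤ 150 * (n + 1) * B j + 150) := by
  have hBj := hB.le_n j
  have haj := hB.a_le j
  have hcj : current B H o j = B j := by simp [current, hjH]
  have hupj : ∀ x, x ∈ I.preds j → x ∉ H := fun x hx hxH => hjH (h.part.up x j hx hxH)
  rw [handleJob, run_seq, run_setN, run_seq]
  refine (run_findIndex (I := I) (ok := ok) (j := j) (i := B j) (C := I.compl B a)
    (by simpa [BoundedBy] using hok) (by simpa using hj) (by simpa [NExp.eval] using hi)
    (fun l hl => by simpa using hC l (hl.trans hBj))).agree.imp ?_
  rintro t₁ m₁ ⟨⟨d, hd, ht₁, hbad, hgood⟩, ha₁⟩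
  have hst₁ : m₁.nv .status = 2 := by rw [ha₁.nv _ (by decide)]; simpa using hst
  have hi₁ : m₁.nv .i = B j := by rw [ha₁.nv _ (by decide)]; simpa using hi
  have hj₁ : m₁.nv .j = j := by rw [ha₁.nv _ (by decide)]; simpa using hj
  have hord₁ : ∀ x : Fin n, m₁.na .ord x 0 = o x := fun x => by
    rw [ha₁.na _ (by decide)]; simpa using h.ord x
  have hcnt₁ : ∀ i ≤ n, m₁.na .cnt i 0 = (Finset.univ.filter (current B H o · = i)).card :=
    fun i hi => by rw [ha₁.na _ (by decide)]; simpa using h.cnt i hi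
  have hmov₁ : m₁.nv .moved = m.nv .moved := by rw [ha₁.nv _ (by decide)]; simp
  have hm₁ : I.LoadedIn m₁ := by
    refine Inst.LoadedIn.of_agree ?_ ha₁ (by unfold KeepsInput; decide)
    exact ⟨by simpa using hm.n_eq, by simpa using hm.s_eq, by simpa using hm.p_eq,
      by simpa using hm.np_eq, by simpa using hm.pred_eq⟩
  clear ha₁
  generalize hk₁ : m₁.nv .k1 = k₁ at *
  rw [run_ite]
  refine ⟨fun hz => ?_, fun hz => ?_⟩
  · simp only [BExp.Holds, NExp.eval, hk₁] at hz
    subst hz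
    rw [run_setN]
    refine Or.inl ⟨by simp [NExp.eval], fun σ hσ => ?_, ?_⟩
    · exact hbd.not_feasible_of_cost hB hok.down (fun k h1 h2 => hbad k (by omega) h2) hσ
    · simp [NExp.time, BExp.time]; omega
  · simp only [BExp.Holds, NExp.eval, hk₁] at hz
    have hk₁pos : 1 ≤ k₁ := by omega
    set k := min k₁ (o j) with hk
    have hkB : k ≤ B j := by omega
    have hpart := h.part.insert hB hjH hsucc hk₁pos (by omega) (hgood hk₁pos) hbad hk
    have hcur := current_insert (B := B) (o := o) hupj k
    have hcur' : ∀ i, (∃ x, current B (insert j H) (handled I o j k) x = i) ∨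
        ∀ x, current B (insert j H) (handled I o j k) x ≠ i := fun i => by
      by_cases hx : ∃ x, current B (insert j H) (handled I o j k) x = i
      · exact Or.inl hx
      · exact Or.inr fun x hx' => hx ⟨x, hx'⟩
    -- the program from the assignment to `ord[j]` on
    have rest : ∀ (t₂ : ℕ → ℕ) m₂, (∀ t, t₂ t ≤ 25 * d + 60 + t) →
        m₂.nv = Function.update m₁.nv .k k →
        m₂.na = m₁.na → m₂.rv = m₁.rv → m₂.ra = m₁.ra → Run I.oracle
        (.putN1 .ord (.var .j) (.var .k) ⨟
         .when (.ltN (.var .k) (.var .i))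
          (.setN .moved (.lit 1) ⨟
           .putN1 .cnt (.var .i) (.sub (.get1 .cnt (.var .i)) (.lit 1)) ⨟
           .putN1 .cnt (.var .k) (.add (.get1 .cnt (.var .k)) (.lit 1)) ⨟
           .ite (.eqN (.get1 .cnt (.var .i)) (.lit 0))
            (.setN .status (.lit 0))
            (forUp .q (.lit 0) (.get1 .np (.var .j))
              (.setN .pr (.get .pred (.var .j) (.var .q)) ⨟
               .when (.ltN (.sub (.var .k) (.lit 1)) (.get1 .ord (.var .pr)))
                (.putN1 .ord (.var .pr) (.sub (.var .k) (.lit 1))))))) m₂ fun t m' =>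
          (m'.nv .status = 0 ∧ I.Infeasible ok ∧ t₂ t ≤ 150 * (n + 1)) ∨
          (m'.nv .status = 2 ∧ ∃ k o', I.RoundState ok B a (insert j H) o' m' ∧
            current B (insert j H) o' = Function.update (current B H o) j k ∧ k ≤ B j ∧
            t₂ t + 150 * (n + 1) * k ≤ 150 * (n + 1) * B j + 150) := by
      intro t₂ m₂ ht₂ hnv hna hrv hra
      have hk2 : m₂.nv .k = k := by simp [hnv]
      have hi2 : m₂.nv .i = B j := by simp [hnv, hi₁]
      have hj2 : m₂.nv .j = j := by simp [hnv, hj₁]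
      have hst2 : m₂.nv .status = 2 := by simp [hnv, hst₁]
      have hmov2 : m₂.nv .moved = m.nv .moved := by simp [hnv, hmov₁]
      have hinj : ∀ x : Fin n, (x : ℕ) = j ↔ x = j := fun x => Fin.ext_iff.symm
      simp only [run_seq, run_when, run_ite, Stmt.putN1, run_putN, run_setN]
      refine ⟨fun hlt => ?_, fun hlt => ?_⟩
      · simp only [BExp.Holds, NExp.eval, Mem.nv_putN, hk2, hi2] at hlt
        obtain ⟨e, he⟩ : ∃ e, B j = k + 1 + e := ⟨B j - (k + 1), by omega⟩
        have hcc := fun i => card_filter_update (g := current B H o) (j := j) (k := k)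
          (by rw [hcj]; omega) i
        rw [hcj, ← hcur] at hcc
        refine ⟨fun hz0 => ?_, fun hz0 => ?_⟩
        · refine Or.inl ⟨by simp [NExp.eval], fun σ hσ => ?_, ?_⟩
          · have hz1 := hcc (B j)
            rw [if_pos rfl] at hz1
            simp [BExp.Holds, NExp.eval, hi2, hk2, hna, hlt.ne', hcnt₁ (B j) hBj] at hz0
            rw [hz0, Finset.card_eq_zero, Finset.filter_eq_empty_iff] at hz1
            exact hpart.not_feasible_of_empty hbd hB hok.down haj hBj
              (fun x => hz1 (Finset.mem_univ x)) hσ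
          · refine (ht₂ _).trans ?_
            simp [NExp.time, BExp.time]; omega
        · have hne : ∃ x, current B (insert j H) (handled I o j k) x = B j := by
            refine (hcur' (B j)).resolve_right fun hno => hz0 ?_
            have hz1 := hcc (B j)
            rw [if_pos rfl, Finset.card_eq_zero.2 (Finset.filter_eq_empty_iff.2
              fun {x} _ => hno x)] at hz1
            simp [BExp.Holds, NExp.eval, hi2, hk2, hna, hlt.ne', hcnt₁ (B j) hBj]
            exact hz1.symm
          have hm2 : I.LoadedIn m₂ := by
            refine ⟨?_, ?_, ?_, ?_, ?_⟩
            · simpa [hnv] using hm₁.n_eq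
            · simpa [hrv] using hm₁.s_eq
            · simpa [hra] using hm₁.p_eq
            · simpa [hna] using hm₁.np_eq
            · simpa [hna] using hm₁.pred_eq
          refine (run_lowerPreds (I := I) (j := j) (o := fun x => if x = j then k else o x)
            ?_ ?_ ?_).agree.imp ?_
          · exact ⟨by simpa using hm2.n_eq, by simpa using hm2.s_eq, by simpa using hm2.p_eq,
              by simpa using hm2.np_eq, by simpa using hm2.pred_eq⟩
          · simpa using hj2
          · intro x
            simp [NExp.eval, hj2, hk2, hinj, hna, hord₁]
          · rintro t₃ m₃ ⟨⟨ht₃, ho₃⟩, ha₃⟩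
            refine Or.inr ⟨?_, k, handled I o j k, ⟨?_, ?_, hpart, ?_, ?_⟩, hcur, hkB, ?_⟩
            · rw [ha₃.nv _ (by decide)]; simpa using hst2
            · intro x
              rw [ho₃]
              simp only [handled, Mem.nv_putN, Mem.nv_setN, hk2]
              by_cases hx : x = j
              · subst hx
                simp [I.not_mem_preds_self]
              · simp [hx]
            · intro i hi
              rw [ha₃.na _ (by decide), hcc]
              have := hcnt₁ i hi
              simp only [Mem.na_putN, Mem.na_setN, NExp.eval, Mem.nv_putN, Mem.nv_setN, hi2, hk2,
                hna, reduceCtorEq, false_and, if_false, and_true, true_and, hcnt₁ (B j) hBj]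
              by_cases h1 : i = k
              · rw [if_pos h1, if_neg (by omega), if_neg (by omega), if_pos h1,
                  hcnt₁ k (by omega), h1]
              · by_cases h2 : i = B j
                · simp [h2, hlt.ne']
                · simp [h1, h2, this]
            · intro i h1 h2
              by_cases h3 : i = B j
              · rw [h3]; exact hne
              · obtain ⟨x, hx⟩ := h.ne i h1 h2
                refine ⟨x, ?_⟩
                have hxj : x ≠ j := by rintro rfl; exact h3 (by rw [← hx, hcj])
                rw [hcur, Function.update_of_ne hxj, hx]
            · rw [ha₃.nv _ (by decide)]
              constructor
              · intro h1
                simp [NExp.eval] at h1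
              · intro h1
                have := h1 j
                rw [hcur, Function.update_self] at this
                omega
            · refine (Nat.add_le_add_right (ht₂ _) _).trans ?_
              simp [NExp.time, BExp.time]
              -- The job moves `e + 1` places. This pays for the `d` search steps and for the `O(n)`
              -- update of the predecessors.
              have : d ≤ e + 1 := by omega
              rw [he]
              nlinarith [Nat.zero_le (n * e)]
      · simp only [BExp.Holds, NExp.eval, Mem.nv_putN, hk2, hi2] at hlt
        -- A job that stays was accepted at the first index tried, so the search took no iterations.
        have hkeq : k = B j := by omega
        have hd0 : d = 0 := by omega
        have hcur0 : current B (insert j H) (handled I o j k) = current B H o := by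
          rw [hcur, hkeq, ← hcj, Function.update_eq_self]
        refine Or.inr ⟨by simpa using hst2, k, handled I o j k, ⟨?_, ?_, hpart, ?_, ?_⟩, hcur, hkB,
          ?_⟩
        · intro x
          simp only [NExp.eval, Mem.na_putN, hj2, hinj, hk2, handled, and_true, true_and, hna,
            hord₁]
          by_cases hx : x = j
          · simp [hx]
          · simp only [hx, if_false]
            split_ifs with h1
            · have h2 := h.part.le x
              have h3 := hB.mono x j h1
              omega
            · rfl
        · intro i hi
          rw [hcur0, ← hcnt₁ i hi]
          simp [hna]
        · intro i h1 h2
          rw [hcur0]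
          exact h.ne i h1 h2
        · rw [hcur0, ← h.moved]
          simp [hmov2]
        · refine (Nat.add_le_add_right (ht₂ _) _).trans ?_
          simp [NExp.time, BExp.time, hkeq]
          omega
    rw [run_seq, run_setN, run_seq, run_when]
    refine ⟨fun hlt => ?_, fun hlt => ?_⟩
    · simp [BExp.Holds, NExp.eval, hj₁, hord₁, hk₁] at hlt
      rw [run_setN]
      refine rest _ _ (fun t => ?_) ?_ rfl rfl rfl
      · simp [NExp.time, BExp.time]; omega
      · funext z
        have : k = k₁ := by omega
        by_cases hz : z = .k <;> simp [NExp.eval, hz, hk₁, this]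
    · simp [BExp.Holds, NExp.eval, hj₁, hord₁, hk₁] at hlt
      refine rest _ _ (fun t => ?_) ?_ rfl rfl rfl
      · simp [NExp.time, BExp.time]; omega
      · funext z
        have : k = o j := by omega
        by_cases hz : z = .k <;> simp [NExp.eval, hz, hj₁, hord₁, this]

end

/-! ### A round of AUX2 -/

section

variable {n : ℕ} {m : Mem}

/-- The jobs handled in a round of AUX2 before the `c`-th job of batch `i`. -/
def handledBefore (B : Fin n → ℕ) (i c : ℕ) : Finset (Fin n) :=
  Finset.univ.filter fun x => i < B x ∨ x ∈ (members B i n).take c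

theorem handledBefore_succ (B : Fin n → ℕ) (i c : ℕ) (hc : c < (members B i n).length) :
    handledBefore B i (c + 1) = insert (members B i n)[c] (handledBefore B i c) := by
  ext x
  have : (members B i n).take (c + 1) = (members B i n).take c ++ [(members B i n)[c]] := by
    rw [List.take_add_one]; simp [hc]
  simp only [handledBefore, this, List.mem_append, List.mem_singleton, Finset.mem_filter,
    Finset.mem_univ, true_and, Finset.mem_insert]
  tauto

theorem notMem_handledBefore (B : Fin n → ℕ) (i c : ℕ) (hc : c < (members B i n).length) :
    (members B i n)[c] ∉ handledBefore B i c := by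
  have h1 : B (members B i n)[c] = i := (mem_members B i _).1 (List.getElem_mem hc)
  simp only [handledBefore, Finset.mem_filter, Finset.mem_univ, true_and, not_or]
  refine ⟨by omega, fun h => ?_⟩
  obtain ⟨d, hd, hd'⟩ := List.mem_iff_getElem.1 h
  rw [List.getElem_take] at hd'
  simp only [List.length_take] at hd
  have := (members_nodup B i n).getElem_inj_iff.1 hd'
  omega

theorem handledBefore_length (B : Fin n → ℕ) (i : ℕ) :
    handledBefore B (i + 1) (members B (i + 1) n).length = handledBefore B i 0 := by
  ext x
  simp only [handledBefore, List.take_length, mem_members, Finset.mem_filter, Finset.mem_univ,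
    true_and, List.take_zero, List.not_mem_nil, or_false]
  omega

theorem handledBefore_top (B : Fin n → ℕ) (hB : ∀ j, B j ≤ n) : handledBefore B n 0 = ∅ := by
  ext x
  have := hB x
  simp [handledBefore, this]

theorem handledBefore_bot (B : Fin n → ℕ) (hB : ∀ j, 0 < B j) :
    handledBefore B 0 0 = Finset.univ := by
  ext x
  simp [handledBefore, hB x]

theorem sum_update_add (g : Fin n → ℕ) (j : Fin n) (k : ℕ) :
    ∑ x, Function.update g j k x + g j = ∑ x, g x + k := by
  rw [← Finset.add_sum_erase _ _ (Finset.mem_univ j),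
    ← Finset.add_sum_erase _ g (Finset.mem_univ j),
    Function.update_self]
  have : ∑ x ∈ Finset.univ.erase j, Function.update g j k x = ∑ x ∈ Finset.univ.erase j, g x :=
    Finset.sum_congr rfl fun x hx => Function.update_of_ne (Finset.ne_of_mem_erase hx) _ _
  omega

theorem Inst.RoundState.congr {I : Inst n} {ok : ℝ → Prop} {B : Fin n → ℕ} {a : ℕ}
    {H : Finset (Fin n)} {o : Fin n → ℕ} {m' : Mem} (h : I.RoundState ok B a H o m)
    (h1 : m'.na .ord = m.na .ord) (h2 : m'.na .cnt = m.na .cnt)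
    (h3 : m'.nv .moved = m.nv .moved) : I.RoundState ok B a H o m' :=
  ⟨by rw [h1]; exact h.ord, by rw [h2]; exact h.cnt, h.part, h.ne, by rw [h3]; exact h.moved⟩

/-- The potential is `150 * (n + 1)` times the sum of the current set indices; in addition each
handled job has a budget of `180` steps, covering its constant cost and the loop overhead. -/
theorem run_adjustBatch {I : Inst n} {ok : ℝ → Prop} {B : Fin n → ℕ} {a i : ℕ} {o : Fin n → ℕ}
    (hm : I.LoadedIn m) (hok : BoundedBy ok m) (hB : I.IsCSF B a) (hbd : I.Bounding ok B)
    (hC : ∀ i ≤ n, m.ra .C i 0 = I.compl B a i) (hl : HoldsList m i (members B i n))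
    (hi : m.nv .i = i) (h : I.RoundState ok B a (handledBefore B i 0) o m)
    (hst : m.nv .status = 2) (hc : m.nv .c = 0) :
    Run I.oracle (.loop (.and (.ltN (.var .c) (.get1 .size (.var .i)))
        (.eqN (.var .status) (.lit 2)))
      (.setN .j (.get .bat (.var .i) (.var .c)) ⨟ handleJob ⨟ .setN .c (.add (.var .c) (.lit 1)))) m
      fun t m' =>
      (m'.nv .status = 0 ∧ I.Infeasible ok ∧
        t ≤ 150 * (n + 1) * (∑ x, current B (handledBefore B i 0) o x + 1) + 180 * (n + 1)) ∨
      (m'.nv .status = 2 ∧ ∃ o' H, H = handledBefore B i (members B i n).length ∧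
        I.RoundState ok B a H o' m' ∧
        t + 150 * (n + 1) * ∑ x, current B H o' x + 180 * (handledBefore B i 0).card ≤
          150 * (n + 1) * ∑ x, current B (handledBefore B i 0) o x + 180 * H.card + 10) := by
  set l := members B i n with hldef
  -- The variant is offset by one so that `0` is left for the state after a failure, where the test
  -- on `status` stops the loop.
  refine run_loop (v := l.length + 1) (fun v t m' =>
      (m'.nv .status = 0 ∧ I.Infeasible ok ∧ v = 0 ∧
        t ≤ 150 * (n + 1) * (∑ x, current B (handledBefore B i 0) o x + 1) + 180 * (n + 1) - 10) ∨
      (m'.nv .status = 2 ∧ ∃ o' c H, m'.nv .c = c ∧ c ≤ l.length ∧ v = l.length - c + 1 ∧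
        H = handledBefore B i c ∧ I.RoundState ok B a H o' m' ∧
        t + 150 * (n + 1) * ∑ x, current B H o' x + 180 * (handledBefore B i 0).card ≤
          150 * (n + 1) * ∑ x, current B (handledBefore B i 0) o x + 180 * H.card)) ?_ ?_ ?_
  · exact Or.inr ⟨hst, o, 0, _, hc, by omega, by omega, rfl, h, by omega⟩
  · rintro v t m' ha (⟨h1, -⟩ | ⟨h1, o', c, H, h2, h3, rfl, rfl, h4, h5⟩) h6
    · simp [BExp.Holds, NExp.eval, h1] at h6
    have hi' : m'.nv .i = i := (ha.nv _ (by decide)).trans hi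
    have hlt : c < l.length := by
      simp only [BExp.Holds, NExp.eval, h2, hi', ha.na .size (by decide), hl.1] at h6
      exact h6.1
    have hjval : m'.na .bat i c = l[c] := by
      rw [ha.na _ (by decide)]
      exact hl.2 c l[c] (by simp [hlt])
    have hBj : B l[c] = i := (mem_members B i _).1 (List.getElem_mem hlt)
    have hag : Agree (.setN .j (.get .bat (.var .i) (.var .c))) m'
        (m'.setN .j (NExp.eval m' (.get .bat (.var .i) (.var .c)))) :=
      (Exec.setN (f := I.oracle) _ _ _).agree
    have hm' : I.LoadedIn m' := hm.of_agree ha (by unfold KeepsInput; decide)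
    have hok' : BoundedBy ok m' := hok.of_agree ha (by decide) (by decide)
    have hcard := Finset.card_insert_of_notMem (notMem_handledBefore B i c hlt)
    rw [← handledBefore_succ B i c hlt] at hcard
    have hcardn : (handledBefore B i (c + 1)).card ≤ n := by
      simpa using Finset.card_le_univ (handledBefore B i (c + 1))
    rw [run_seq, run_setN, run_seq]
    refine (run_handleJob (I := I) (ok := ok) (B := B) (a := a) (H := handledBefore B i c) (o := o')
      (j := l[c]) (hm'.of_agree hag (by unfold KeepsInput; decide))
      (hok'.of_agree hag (by decide) (by decide)) hB hbd ?_
      (h4.congr (hag.na _ (by decide)) (hag.na _ (by decide)) (hag.nv _ (by decide))) ?_ ?_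
      (notMem_handledBefore B i c hlt) ?_ ?_).agree.imp ?_
    · intro k hk
      rw [hag.ra _ (by decide), ha.ra _ (by decide)]
      exact hC k hk
    · simp [NExp.eval, hi', h2, hjval]
    · simp [hi', hBj]
    -- Successors lie in later sets of `B`, which have been handled completely.
    · intro j' hj'
      have := hB.mono _ _ hj'
      simp only [handledBefore, Finset.mem_filter, Finset.mem_univ, true_and]
      left
      omega
    · simpa using h1
    · rintro t₁ m₁ ⟨h7, ha₁⟩
      have hc₁ : m₁.nv .c = c := by rw [ha₁.nv _ (by decide)]; simpa using h2
      rw [run_setN]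
      rcases h7 with ⟨h8, h9, h10⟩ | ⟨h8, k, o'', h9, h10, h11, h12⟩
      · refine ⟨0, by omega, Or.inl ⟨by simpa using h8, h9, rfl, ?_⟩⟩
        simp only [BExp.time, NExp.time]
        rw [Nat.mul_add]
        omega
      · refine ⟨l.length - (c + 1) + 1, by omega, Or.inr ⟨by simpa using h8, o'', c + 1, _,
          by simp [NExp.eval, hc₁], by omega, rfl, rfl, ?_, ?_⟩⟩
        · rw [handledBefore_succ B i c hlt]
          exact h9.congr rfl rfl (by simp)
        · have hsum := sum_update_add (current B (handledBefore B i c) o') l[c] k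
          rw [← h10, ← handledBefore_succ B i c hlt] at hsum
          have hcur : current B (handledBefore B i c) o' l[c] = B l[c] := by
            rw [current, if_neg (notMem_handledBefore B i c hlt)]
          rw [hcur] at hsum
          rw [hcard]
          have hmul := congrArg (150 * (n + 1) * ·) hsum
          simp only [Nat.mul_add (150 * (n + 1))] at hmul
          simp only [BExp.time, NExp.time]
          omega
  · rintro v t m' ha (⟨h1, h2, -, h3⟩ | ⟨h1, o', c, H, h2, h3, -, rfl, h4, h5⟩) h6
    · refine Or.inl ⟨h1, h2, ?_⟩
      simp only [BExp.time, NExp.time]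
      omega
    · have hi' : m'.nv .i = i := (ha.nv _ (by decide)).trans hi
      simp only [BExp.Holds, NExp.eval, h2, hi', ha.na .size (by decide), hl.1, h1,
        and_true, not_lt] at h6
      obtain rfl : c = l.length := by omega
      refine Or.inr ⟨h1, o', _, rfl, h4, ?_⟩
      simp only [BExp.time, NExp.time]
      omega

theorem run_adjust {I : Inst n} {ok : ℝ → Prop} {B : Fin n → ℕ} {a : ℕ}
    (hm : I.LoadedIn m) (hok : BoundedBy ok m) (hB : I.IsCSF B a) (hbd : I.Bounding ok B)
    (hC : ∀ i ≤ n, m.ra .C i 0 = I.compl B a i) (hF : Formed I B n m)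
    (hord : ∀ j : Fin n, m.na .ord j 0 = B j) (hst : m.nv .status = 2) :
    Run I.oracle adjust m fun t m' =>
      (m'.nv .status = 0 ∧ I.Infeasible ok ∧ t ≤ 600 * (n + 1) * (∑ x, B x + 1)) ∨
      (m'.nv .status = 2 ∧ ∃ o, I.RoundState ok B a Finset.univ o m' ∧
        t + 150 * (n + 1) * ∑ x, o x ≤ 150 * (n + 1) * ∑ x, B x + 300 * (n + 1)) := by
  rw [adjust, run_seq, run_setN, run_seq, run_setN]
  refine run_loop (v := n + 1) (fun v t m' =>
      (m'.nv .status = 0 ∧ I.Infeasible ok ∧ v = 0 ∧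
        t ≤ 150 * (n + 1) * (∑ x, B x + 1) + 420 * (n + 1)) ∨
      (m'.nv .status = 2 ∧ ∃ o i H, m'.nv .i = i ∧ i ≤ n ∧ v = i + 1 ∧
        H = handledBefore B i 0 ∧ I.RoundState ok B a H o m' ∧
        t + 150 * (n + 1) * ∑ x, current B H o x ≤
          150 * (n + 1) * ∑ x, B x + 180 * H.card + 40 * (n - i))) ?_ ?_ ?_
  · refine Or.inr ⟨by simpa using hst, B, n, ∅, by simp [NExp.eval, hm.n_eq], le_rfl, rfl,
      (handledBefore_top B hB.le_n).symm, ⟨by simpa using hord, ?_, .empty I ok B a, ?_, ?_⟩, ?_⟩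
    · intro i hi
      simpa [current] using hF.cnt_eq hi
    · simpa [current] using hB.surj
    · simp [current, NExp.eval]
    · simp [current]
  · rintro v t m' ha (⟨h1, -⟩ | ⟨h1, o, i, H, h2, h3, rfl, hH, h4, h5⟩) h6
    · simp [BExp.Holds, NExp.eval, h1] at h6
    have hpos : 0 < i := by
      simp only [BExp.Holds, NExp.eval, h2] at h6
      exact h6.1
    obtain ⟨k, rfl⟩ : ∃ k, i = k + 1 := ⟨i - 1, by omega⟩
    have hm' : I.LoadedIn m' := by
      refine Inst.LoadedIn.of_agree ?_ ha (by unfold KeepsInput; decide)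
      exact ⟨by simpa using hm.n_eq, by simpa using hm.s_eq, by simpa using hm.p_eq,
        by simpa using hm.np_eq, by simpa using hm.pred_eq⟩
    have hok' : BoundedBy ok m' := BoundedBy.of_agree (by simpa [BoundedBy] using hok) ha
      (by decide) (by decide)
    have hsum : ∀ x, current B H o x ≤ B x := fun x => by
      unfold current
      split_ifs
      · exact h4.part.le x
      · exact le_rfl
    have hsum' : ∑ x, current B H o x ≤ ∑ x, B x := Finset.sum_le_sum fun x _ => hsum x
    have hcardn : H.card ≤ n := by simpa using Finset.card_le_univ H
    rw [run_seq, run_setN, run_seq]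
    refine (run_adjustBatch (I := I) (ok := ok) (B := B) (a := a) (i := k + 1) (o := o)
      ?_ (by simpa [BoundedBy] using hok') hB hbd ?_ ?_ (by simpa using h2)
      (hH ▸ h4.congr rfl rfl (by simp)) (by simpa using h1) (by simp [NExp.eval])).agree.imp ?_
    · exact ⟨by simpa using hm'.n_eq, by simpa using hm'.s_eq, by simpa using hm'.p_eq,
        by simpa using hm'.np_eq, by simpa using hm'.pred_eq⟩
    · intro l hl
      rw [Mem.ra_setN, ha.ra _ (by decide)]
      simpa using hC l hl
    · refine ((hF (k + 1) h3).1).congr ?_ fun c => ?_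
      · rw [Mem.na_setN, ha.na _ (by decide)]; simp
      · rw [Mem.na_setN, ha.na _ (by decide)]; simp
    · rintro t₁ m₁ ⟨h7, ha₁⟩
      have hi₁ : m₁.nv .i = k + 1 := by rw [ha₁.nv _ (by decide)]; simpa using h2
      rw [run_setN]
      rw [← hH] at h7
      rcases h7 with ⟨h8, h9, h10⟩ | ⟨h8, o', H', h9, h10, h11⟩
      · refine ⟨0, by omega, Or.inl ⟨by simpa using h8, h9, rfl, ?_⟩⟩
        simp only [BExp.time, NExp.time]
        rw [Nat.mul_add] at h10 ⊢
        omega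
      · refine ⟨k + 1, by omega, Or.inr ⟨by simpa using h8, o', k, H', by simp [NExp.eval, hi₁],
          by omega, rfl, by rw [h9, handledBefore_length], h10.congr rfl rfl (by simp), ?_⟩⟩
        simp only [BExp.time, NExp.time]
        omega
  · rintro v t m' ha (⟨h1, h2, -, h3⟩ | ⟨h1, o, i, H, h2, h3, -, hH, h4, h5⟩) h6
    · refine Or.inl ⟨h1, h2, ?_⟩
      simp only [BExp.time, NExp.time]
      nlinarith [Nat.zero_le ((n + 1) * ∑ x, B x)]
    · simp only [BExp.Holds, NExp.eval, h2, h1, and_true, not_lt] at h6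
      obtain rfl : i = 0 := by omega
      rw [handledBefore_bot B fun j => hB.one_le.trans (hB.a_le j)] at hH
      subst hH
      have hcur : current B Finset.univ o = o := by funext x; simp [current]
      refine Or.inr ⟨h1, o, h4, ?_⟩
      rw [hcur] at h5
      simp only [BExp.time, NExp.time]
      simp at h5
      omega

end

/-! ### Algorithm AUX2 -/

section

variable {n : ℕ} {m : Mem}

/-- The memory holds the schedule without idle time for the ordinal numbers `F`, all its costs are
in `ok`, and `F` bounds the batch indices of all schedules with costs in `ok`. -/
structure Inst.Scheduled (I : Inst n) (ok : ℝ → Prop) (F : Fin n → ℕ) (a : ℕ) (m : Mem) :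
    Prop where
  csf : I.IsCSF F a
  bounding : I.Bounding ok F
  ord : ∀ j : Fin n, m.na .ord j 0 = F j
  compl : ∀ i ≤ n, m.ra .C i 0 = I.compl F a i
  start : ∀ i, 1 ≤ i → i ≤ n → m.ra .S i 0 = I.compl F a i - ∑ j with F j = i, I.p j
  good : ∀ j, ok (I.f j (I.compl F a (F j)))

/-- A round that neither fails nor returns a schedule decreases the sum of the ordinal numbers, and
this decrease also pays for forming and scheduling the batches. -/
theorem run_round {I : Inst n} {ok : ℝ → Prop} {B : Fin n → ℕ} {a : ℕ}
    (hm : I.LoadedIn m) (hok : BoundedBy ok m) (hB : I.IsCSF B a) (hbd : I.Bounding ok B)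
    (hord : ∀ j : Fin n, m.na .ord j 0 = B j) (hst : m.nv .status = 2) :
    Run I.oracle (formBatches ⨟ scheduleBatches ⨟ adjust ⨟
      .when (.and (.eqN (.var .status) (.lit 2)) (.eqN (.var .moved) (.lit 0)))
        (.setN .status (.lit 1))) m fun t m' =>
      (m'.nv .status = 0 ∧ I.Infeasible ok ∧ t ≤ 800 * (n + 1) * (∑ x, B x + 1)) ∨
      (m'.nv .status = 1 ∧ I.Scheduled ok B a m' ∧ t ≤ 480 * (n + 1)) ∨
      (m'.nv .status = 2 ∧ ∃ o a', I.IsCSF o a' ∧ I.Bounding ok o ∧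
        (∀ j : Fin n, m'.na .ord j 0 = o j) ∧ (∀ j, o j ≤ B j) ∧ ∑ x, o x < ∑ x, B x ∧
        t + 630 * (n + 1) * ∑ x, o x ≤ 630 * (n + 1) * ∑ x, B x) := by
  rw [run_seq]
  refine (run_formBatches (I := I) (B := B) hm hord).agree.imp ?_
  rintro t₁ m₁ ⟨⟨ht₁, hF₁⟩, ha₁⟩
  have hm₁ := hm.of_agree ha₁ (by unfold KeepsInput; decide)
  have hok₁ := hok.of_agree ha₁ (by decide) (by decide)
  have hst₁ : m₁.nv .status = 2 := (ha₁.nv _ (by decide)).trans hst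
  have hord₁ : ∀ j : Fin n, m₁.na .ord j 0 = B j := by rw [ha₁.na _ (by decide)]; exact hord
  rw [run_seq]
  refine (run_scheduleBatches (I := I) hm₁ hB hF₁).agree.imp ?_
  rintro t₂ m₂ ⟨⟨ht₂, hC₂, hS₂⟩, ha₂⟩
  have hm₂ := hm₁.of_agree ha₂ (by unfold KeepsInput; decide)
  have hok₂ := hok₁.of_agree ha₂ (by decide) (by decide)
  have hst₂ : m₂.nv .status = 2 := (ha₂.nv _ (by decide)).trans hst₁
  have hord₂ : ∀ j : Fin n, m₂.na .ord j 0 = B j := by rw [ha₂.na _ (by decide)]; exact hord₁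
  have hF₂ : Formed I B n m₂ := by
    intro i hi
    unfold HoldsList
    rw [ha₂.na .size (by decide), ha₂.na .bat (by decide), ha₂.na .cnt (by decide),
      ha₂.ra .bp (by decide)]
    exact hF₁ i hi
  rw [run_seq]
  refine (run_adjust hm₂ hok₂ hB hbd hC₂ hF₂ hord₂ hst₂).agree.imp ?_
  rintro t₃ m₃ ⟨⟨h1, h2, h3⟩ | ⟨h1, o, h2, h3⟩, ha₃⟩
  · rw [run_when]
    refine ⟨fun h => ?_, fun _ => Or.inl ⟨h1, h2, ?_⟩⟩
    · simp [BExp.Holds, NExp.eval, h1] at h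
    · simp only [BExp.time, NExp.time]
      nlinarith [Nat.zero_le ((n + 1) * ∑ x, B x)]
  · have hcur : current B Finset.univ o = o := by funext x; simp [current]
    have hmov := h2.moved
    rw [hcur] at hmov
    rw [run_when]
    refine ⟨fun h => ?_, fun h => ?_⟩
    · simp only [BExp.Holds, NExp.eval, h1, true_and, hmov] at h
      obtain rfl : o = B := funext h
      rw [run_setN]
      refine Or.inr (Or.inl ⟨by simp [NExp.eval], ⟨hB, hbd, by simpa using h2.ord, ?_, ?_,
        fun j => h2.part.stay j (Finset.mem_univ j) rfl⟩, ?_⟩)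
      · rw [Mem.ra_setN, ha₃.ra _ (by decide)]; exact hC₂
      · rw [Mem.ra_setN, ha₃.ra _ (by decide)]; exact hS₂
      · simp only [BExp.time, NExp.time]
        omega
    · simp only [BExp.Holds, NExp.eval, h1, true_and, hmov] at h
      have hne := h2.ne
      rw [hcur] at hne
      obtain ⟨a', ha'⟩ := h2.part.isCSF hB hne
      have hlt : ∑ x, o x < ∑ x, B x := by
        obtain ⟨x, hx⟩ := not_forall.1 h
        exact Finset.sum_lt_sum (fun x _ => h2.part.le x)
          ⟨x, Finset.mem_univ x, lt_of_le_of_ne (h2.part.le x) hx⟩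
      refine Or.inr (Or.inr ⟨h1, o, a', ha', h2.part.bounding hbd hB hok.down, h2.ord,
        h2.part.le, hlt, ?_⟩)
      obtain ⟨e, he⟩ : ∃ e, ∑ x, B x = ∑ x, o x + 1 + e := ⟨∑ x, B x - (∑ x, o x + 1), by omega⟩
      rw [he] at h3 ⊢
      simp only [BExp.time, NExp.time]
      nlinarith [Nat.zero_le (n * e)]

/-- The sum of the ordinal numbers is both variant and potential. On success only the last round is
not paid by moves, which leaves the term `500 * (n + 1)`; the potential remains available for later
calls. -/
theorem run_aux2 {I : Inst n} {ok : ℝ → Prop} {F₀ : Fin n → ℕ} {a₀ : ℕ}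
    (hm : I.LoadedIn m) (hok : BoundedBy ok m) (hF₀ : I.IsCSF F₀ a₀) (hbd : I.Bounding ok F₀)
    (hord : ∀ j : Fin n, m.na .ord j 0 = F₀ j) :
    Run I.oracle aux2 m fun t m' =>
      (m'.nv .status = 0 ∧ I.Infeasible ok ∧ t ≤ 1500 * (n + 1) * (∑ x, F₀ x + 1)) ∨
      (m'.nv .status = 1 ∧ ∃ F a, I.Scheduled ok F a m' ∧ (∀ j, F j ≤ F₀ j) ∧
        t + 650 * (n + 1) * ∑ x, F x ≤ 650 * (n + 1) * ∑ x, F₀ x + 500 * (n + 1)) := by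
  rw [aux2, run_seq, run_setN]
  refine run_loop (v := ∑ x, F₀ x + 1) (fun v t m' =>
      (m'.nv .status = 0 ∧ I.Infeasible ok ∧ v = 0 ∧
        t ≤ 1490 * (n + 1) * (∑ x, F₀ x + 1)) ∨
      (m'.nv .status = 1 ∧ v = 0 ∧ ∃ F a, I.Scheduled ok F a m' ∧ (∀ j, F j ≤ F₀ j) ∧
        t + 650 * (n + 1) * ∑ x, F x ≤ 650 * (n + 1) * ∑ x, F₀ x + 485 * (n + 1)) ∨
      (m'.nv .status = 2 ∧ ∃ o a', I.IsCSF o a' ∧ I.Bounding ok o ∧ v = ∑ x, o x + 1 ∧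
        (∀ j : Fin n, m'.na .ord j 0 = o j) ∧ (∀ j, o j ≤ F₀ j) ∧
        t + 650 * (n + 1) * ∑ x, o x ≤ 650 * (n + 1) * ∑ x, F₀ x)) ?_ ?_ ?_
  · exact Or.inr (Or.inr ⟨by simp [NExp.eval], F₀, a₀, hF₀, hbd, rfl, by simpa using hord,
      fun _ => le_rfl, by omega⟩)
  · rintro v t m' ha (⟨h1, -⟩ | ⟨h1, -⟩ | ⟨h1, B, a, hB, hbdB, rfl, hordB, hle, ht⟩) h2
    · simp [BExp.Holds, NExp.eval, h1] at h2
    · simp [BExp.Holds, NExp.eval, h1] at h2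
    have hm' : I.LoadedIn m' := by
      refine Inst.LoadedIn.of_agree ?_ ha (by unfold KeepsInput; decide)
      exact ⟨by simpa using hm.n_eq, by simpa using hm.s_eq, by simpa using hm.p_eq,
        by simpa using hm.np_eq, by simpa using hm.pred_eq⟩
    have hok' : BoundedBy ok m' := BoundedBy.of_agree (by simpa [BoundedBy] using hok) ha
      (by decide) (by decide)
    have hsum : ∑ x, B x ≤ ∑ x, F₀ x := Finset.sum_le_sum fun x _ => hle x
    refine (run_round hm' hok' hB hbdB hordB h1).imp ?_
    rintro t' m'' (⟨h3, h4, h5⟩ | ⟨h3, h4, h5⟩ | ⟨h3, o, a', h4, h5, h6, h7, h8, h9⟩)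
    · refine ⟨0, by omega, Or.inl ⟨h3, h4, rfl, ?_⟩⟩
      obtain ⟨e, he⟩ := Nat.exists_eq_add_of_le hsum
      rw [he] at ht ⊢
      simp only [BExp.time, NExp.time]
      generalize ∑ x, B x = S at *
      nlinarith [Nat.zero_le (n * S), Nat.zero_le (n * e)]
    · refine ⟨0, by omega, Or.inr (Or.inl ⟨h3, rfl, B, a, h4, hle, ?_⟩)⟩
      simp only [BExp.time, NExp.time]
      omega
    · refine ⟨_, by omega, Or.inr (Or.inr ⟨h3, o, a', h4, h5, rfl, h6,
        fun j => (h7 j).trans (hle j), ?_⟩)⟩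
      obtain ⟨e, he⟩ : ∃ e, ∑ x, B x = ∑ x, o x + 1 + e := ⟨∑ x, B x - (∑ x, o x + 1), by omega⟩
      rw [he] at ht h9
      simp only [BExp.time, NExp.time]
      nlinarith [Nat.zero_le (n * e)]
  · rintro v t m' ha (⟨h1, h2, -, h3⟩ | ⟨h1, -, F, a, h2, h3, h4⟩ | ⟨h1, -⟩) h5
    · refine Or.inl ⟨h1, h2, ?_⟩
      simp only [BExp.time, NExp.time]
      generalize ∑ x, F₀ x = S at *
      nlinarith [Nat.zero_le (n * S)]
    · refine Or.inr ⟨h1, F, a, h2, h3, ?_⟩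
      simp only [BExp.time, NExp.time]
      omega
    · simp [BExp.Holds, NExp.eval, h1] at h5

end

/-! ### The initial candidate set family -/

section

variable {n : ℕ} {f : ℕ → ℝ → ℝ} {m : Mem}

/-- Lengths of longest paths that start in a vertex. -/
theorem Inst.exists_height (I : Inst n) : ∃ h : Fin n → ℕ,
    (∀ i j, i ∈ I.preds j → h j < h i) ∧ ∀ i, 0 < h i → ∃ j, i ∈ I.preds j ∧ h i = h j + 1 := by
  classical
  let F : ∀ i : Fin n, (∀ j, Function.swap I.prec j i → ℕ) → ℕ := fun i rec =>
    Finset.univ.sup fun j => if hj : i ∈ I.preds j then rec j (I.prec_of_mem_preds hj) + 1 else 0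
  have hfix : ∀ i, I.prec_swap_wf.fix F i = Finset.univ.sup fun j =>
      if i ∈ I.preds j then I.prec_swap_wf.fix F j + 1 else 0 := by
    intro i
    rw [WellFounded.fix_eq]
    simp only [F]
    congr 1
  refine ⟨I.prec_swap_wf.fix F, fun i j hij => ?_, fun i hi => ?_⟩
  · have := Finset.le_sup (f := fun j => if i ∈ I.preds j then I.prec_swap_wf.fix F j + 1 else 0)
      (Finset.mem_univ j)
    rw [hfix i]
    simp only [hij, if_true] at this
    omega
  · have hne : (Finset.univ : Finset (Fin n)).Nonempty := ⟨i, Finset.mem_univ i⟩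
    obtain ⟨j, -, hj⟩ := Finset.exists_mem_eq_sup Finset.univ hne
      (fun j => if i ∈ I.preds j then I.prec_swap_wf.fix F j + 1 else 0)
    rw [← hfix i] at hj
    by_cases hij : i ∈ I.preds j
    · exact ⟨j, hij, by simpa [hij] using hj⟩
    · simp [hij] at hj
      omega

/-- The set of a job is `n` minus its height. A longest path passes through every smaller height, so
the heights have no gaps and, by counting, are less than `n`. -/
theorem Inst.exists_levels (I : Inst n) : ∃ (B : Fin n → ℕ) (a : ℕ), I.IsCSF B a ∧
    ∀ j, B j < n → ∃ j', j ∈ I.preds j' ∧ B j' = B j + 1 := by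
  obtain ⟨h, h1, h2⟩ := I.exists_height
  have hdown : ∀ i l, l ≤ h i → ∃ j, h j = l := by
    intro i l hl
    obtain ⟨d, hd⟩ : ∃ d, l + d = h i := ⟨h i - l, by omega⟩
    induction d generalizing l with
    | zero => exact ⟨i, by omega⟩
    | succ d ih =>
      obtain ⟨j, hj⟩ := ih (l + 1) (by omega) (by omega)
      obtain ⟨j', -, hj'⟩ := h2 j (by omega)
      exact ⟨j', by omega⟩
  have hlt : ∀ i, h i < n := by
    intro i
    have hsub : Finset.range (h i + 1) ⊆ Finset.univ.image h := by
      intro l hl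
      obtain ⟨j, hj⟩ := hdown i l (by simpa [Nat.lt_succ_iff] using hl)
      exact Finset.mem_image.2 ⟨j, Finset.mem_univ j, hj⟩
    have h3 := Finset.card_le_card hsub
    have h4 : (Finset.univ.image h).card ≤ n := by
      simpa using Finset.card_image_le (s := (Finset.univ : Finset (Fin n))) (f := h)
    rw [Finset.card_range] at h3
    omega
  obtain ⟨v, -, hv⟩ := Finset.exists_max_image Finset.univ h I.univ_nonempty
  have hv' : ∀ j, h j ≤ h v := fun j => hv j (Finset.mem_univ j)
  refine ⟨fun j => n - h j, n - h v, ⟨?_, by omega, fun j => ?_, fun j => by omega,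
    fun i hi hin => ?_, fun i j hij => ?_⟩, fun j hj => ?_⟩
  · have := hlt v; omega
  · have := hv' j; omega
  · obtain ⟨j, hj⟩ := hdown v (n - i) (by omega)
    exact ⟨j, by omega⟩
  · have := h1 i j hij
    have := hlt i
    omega
  · change n - h j < n at hj
    obtain ⟨j', hj', hh⟩ := h2 j (by omega)
    have := hlt j
    refine ⟨j', hj', ?_⟩
    change n - h j' = n - h j + 1
    omega

/-- Number of direct successors of `x` in `s`. -/
def Inst.outDeg (I : Inst n) (s : Finset (Fin n)) (x : Fin n) : ℕ :=
  ∑ j ∈ s, (I.preds j).count x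

/-! ### Out-degrees in the remaining graph -/

theorem Inst.outDeg_eq_zero (I : Inst n) (s : Finset (Fin n)) (x : Fin n) :
    I.outDeg s x = 0 ↔ ∀ j ∈ s, x ∉ I.preds j := by
  simp [outDeg, Finset.sum_eq_zero_iff, List.count_eq_zero]

/-- A job of a set below `i` still has a successor in the next set, while all successors of a job of
set `i` have been removed. Repeated removal of the vertices of out-degree zero thus produces exactly
`B`. -/
theorem outDeg_levels {I : Inst n} {B : Fin n → ℕ} {a : ℕ} (hB : I.IsCSF B a)
    (htight : ∀ j, B j < n → ∃ j', j ∈ I.preds j' ∧ B j' = B j + 1) {i : ℕ} (hi : i ≤ n)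
    (x : Fin n) : B x ≤ i ∧ I.outDeg (Finset.univ.filter (B · ≤ i)) x = 0 ↔ B x = i := by
  rw [I.outDeg_eq_zero]
  constructor
  · rintro ⟨h1, h2⟩
    by_contra h3
    obtain ⟨j, hj, hBj⟩ := htight x (by omega)
    exact h2 j (by simp only [Finset.mem_filter, Finset.mem_univ, true_and]; omega) hj
  · rintro rfl
    refine ⟨le_rfl, fun j hj hx => ?_⟩
    have := hB.mono x j hx
    simp only [Finset.mem_filter, Finset.mem_univ, true_and] at hj
    omega

theorem count_drop_eq {l : List (Fin n)} {q : ℕ} (hq : q < l.length) (x : Fin n) :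
    (l.drop q).count x = (l.drop (q + 1)).count x + if x = l[q] then 1 else 0 := by
  rw [List.drop_eq_getElem_cons hq, List.count_cons]
  by_cases h : x = l[q]
  · simp [h]
  · have h' : ¬ l[q] = x := fun h'' => h h''.symm
    simp [h, h']

theorem count_take_eq {l : List (Fin n)} {q : ℕ} (hq : q < l.length) (x : Fin n) :
    (l.take (q + 1)).count x = (l.take q).count x + if x = l[q] then 1 else 0 := by
  have htake : l.take (q + 1) = l.take q ++ [l[q]] := by
    rw [List.take_add_one]; simp [hq]
  rw [htake, List.count_append, List.count_singleton]
  by_cases h : x = l[q]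
  · simp [h]
  · have h' : ¬ l[q] = x := fun h'' => h h''.symm
    simp [h, h']

/-- Memory during the computation of the `i`-th set of the initial family: `l` lists the jobs in
the set before, and `R` are the current out-degrees. -/
structure LevelState (B : Fin n → ℕ) (i : ℕ) (l : List (Fin n)) (R : Fin n → ℕ) (m : Mem) :
    Prop where
  prev : HoldsList m (i + 1) l
  deg : ∀ x : Fin n, m.na .deg x 0 = R x
  ord : ∀ x : Fin n, i + 1 ≤ B x → m.na .ord x 0 = B x
  next : ∃ l' : List (Fin n), l'.Nodup ∧ HoldsList m i l' ∧ (∀ x, x ∈ l' ↔ B x ≤ i ∧ R x = 0) ∧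
    ∀ x ∈ l', m.na .ord (x : ℕ) 0 = i

theorem LevelState.congr {B : Fin n → ℕ} {i : ℕ} {l : List (Fin n)} {R : Fin n → ℕ} {m' : Mem}
    (h : LevelState B i l R m) (hna : m'.na = m.na) : LevelState B i l R m' := by
  obtain ⟨h1, h2, h3, h4⟩ := h
  constructor
  · simpa [HoldsList, hna] using h1
  · simpa [hna] using h2
  · simpa [hna] using h3
  · simpa [HoldsList, hna] using h4

/-- The degree of `pr` is positive before the removal, so `pr` is not yet listed; it is appended
exactly when the degree reaches zero, hence at most once. -/
theorem run_removeEdge {B : Fin n → ℕ} {i : ℕ} {l : List (Fin n)} {R R' : Fin n → ℕ} {pr : Fin n}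
    (h : LevelState B i l R m) (hi : m.nv .i = i) (hBi : B pr ≤ i)
    (hR : ∀ x, R x = R' x + if x = pr then 1 else 0) (hpr : m.nv .pr = pr) :
    Run f (.putN1 .deg (.var .pr) (.sub (.get1 .deg (.var .pr)) (.lit 1)) ⨟
         .when (.eqN (.get1 .deg (.var .pr)) (.lit 0))
          (.putN1 .ord (.var .pr) (.var .i) ⨟
           .putN .bat (.var .i) (.get1 .size (.var .i)) (.var .pr) ⨟
           .putN1 .size (.var .i) (.add (.get1 .size (.var .i)) (.lit 1)))) m fun t m' =>
      t ≤ 40 ∧ LevelState B i l R' m' := by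
  obtain ⟨l', hnd, hl', hmem, hord⟩ := h.next
  have hRpr : R pr = R' pr + 1 := by rw [hR pr, if_pos rfl]
  have hprl : pr ∉ l' := fun h' => by
    have := ((hmem pr).1 h').2
    omega
  have hinj : ∀ x : Fin n, (x : ℕ) = pr ↔ x = pr := fun x => Fin.ext_iff.symm
  have hdeg : ∀ x : Fin n, (if x = pr then R pr - 1 else R x) = R' x := by
    intro x
    by_cases hx : x = pr
    · rw [if_pos hx, hx]; omega
    · rw [if_neg hx, hR x, if_neg hx, add_zero]
  simp only [run_seq, run_when, Stmt.putN1, run_putN]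
  refine ⟨fun hz => ⟨by simp [NExp.time, BExp.time], ?_⟩,
    fun hz => ⟨by simp [NExp.time, BExp.time], ?_⟩⟩
  · simp [BExp.Holds, NExp.eval, hpr, h.deg] at hz
    have hz' : R' pr = 0 := by omega
    refine ⟨?_, fun x => ?_, fun x hx => ?_, l' ++ [pr], ?_, ?_, fun x => ?_, fun x hx => ?_⟩
    · refine h.prev.congr ?_ fun c => ?_ <;> simp [NExp.eval, hi]
    · simp only [Mem.na_putN, NExp.eval, Mem.nv_putN, hpr, hinj, h.deg, reduceCtorEq, false_and,
        if_false, and_true, true_and]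
      exact hdeg x
    · have hxp : x ≠ pr := by rintro rfl; omega
      simp [NExp.eval, hpr, hinj, hxp, h.ord x hx]
    · refine List.Nodup.append hnd (by simp) ?_
      simpa using hprl
    · refine hl'.append ?_ fun c => ?_
      · simp [NExp.eval, hi]
      · simp [NExp.eval, hi, hpr]
    · rw [List.mem_append, List.mem_singleton, hmem]
      by_cases hx : x = pr
      · simp [hx, hz', hBi]
      · simp [hx, hR x]
    · rw [List.mem_append, List.mem_singleton] at hx
      by_cases hxp : x = pr
      · simp [NExp.eval, hi, hpr, hxp]
      · simp [NExp.eval, hpr, hinj, hxp, hord x (hx.resolve_right hxp)]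
  · simp [BExp.Holds, NExp.eval, hpr, h.deg] at hz
    have hz' : R' pr ≠ 0 := by omega
    refine ⟨?_, fun x => ?_, fun x hx => ?_, l', hnd, ?_, fun x => ?_, fun x hx => ?_⟩
    · exact h.prev.congr (by simp) (by simp)
    · simp only [Mem.na_putN, NExp.eval, hpr, hinj, h.deg, and_true, true_and]
      exact hdeg x
    · simpa using h.ord x hx
    · exact hl'.congr (by simp) (by simp)
    · rw [hmem]
      by_cases hx : x = pr
      · rw [hx, hRpr]
        simp [hz']
      · rw [hR x, if_neg hx, add_zero]
    · simpa using hord x hx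

theorem run_level {I : Inst n} (hm : I.LoadedIn m) {B : Fin n → ℕ} {a : ℕ} (hB : I.IsCSF B a)
    {i : ℕ} {l : List (Fin n)} (hnd : l.Nodup) (hl : ∀ x, x ∈ l ↔ B x = i + 1)
    (hi : m.nv .i = i) (hk : m.nv .k = i + 1)
    (h : LevelState B i l (I.outDeg (Finset.univ.filter (B · ≤ i + 1))) m) :
    Run f (forUp .c (.lit 0) (.get1 .size (.var .k))
      (.setN .j (.get .bat (.var .k) (.var .c)) ⨟
       forUp .q (.lit 0) (.get1 .np (.var .j))
        (.setN .pr (.get .pred (.var .j) (.var .q)) ⨟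
         .putN1 .deg (.var .pr) (.sub (.get1 .deg (.var .pr)) (.lit 1)) ⨟
         .when (.eqN (.get1 .deg (.var .pr)) (.lit 0))
          (.putN1 .ord (.var .pr) (.var .i) ⨟
           .putN .bat (.var .i) (.get1 .size (.var .i)) (.var .pr) ⨟
           .putN1 .size (.var .i) (.add (.get1 .size (.var .i)) (.lit 1)))))) m fun t m' =>
      t ≤ 100 * (n + 1) * (n + 1) ∧
      LevelState B i l (I.outDeg (Finset.univ.filter (B · ≤ i))) m' := by
  have hlen : l.length ≤ n := by simpa using hnd.length_le_card
  set R₀ := I.outDeg (Finset.univ.filter (B · ≤ i)) with hR₀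
  have hstart : ∀ x, I.outDeg (Finset.univ.filter (B · ≤ i + 1)) x =
      R₀ x + (l.map fun j => (I.preds j).count x).sum := by
    intro x
    have hdisj : Disjoint (Finset.univ.filter (B · ≤ i)) l.toFinset := by
      rw [Finset.disjoint_left]
      intro y hy
      simp only [Finset.mem_filter, Finset.mem_univ, true_and] at hy
      rw [List.mem_toFinset, hl]
      omega
    have hun : Finset.univ.filter (B · ≤ i + 1) =
        (Finset.univ.filter (B · ≤ i)) ∪ l.toFinset := by
      ext y
      simp only [Finset.mem_filter, Finset.mem_univ, true_and, Finset.mem_union, List.mem_toFinset,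
        hl]
      omega
    rw [hR₀, Inst.outDeg, hun, Finset.sum_union hdisj, List.sum_toFinset _ hnd, Inst.outDeg]
  -- The current degree counts the edges into the remaining sets and those into jobs of `l` not yet
  -- processed.
  refine run_forUp 0 l.length (60 * (n + 1)) (fun c m' => LevelState B i l
    (fun x => R₀ x + ((l.drop c).map fun j => (I.preds j).count x).sum) m') (by decide) rfl
    (by omega) ?_ ?_ ?_ ?_
  · rw [List.drop_zero, ← funext hstart]
    exact h.congr rfl
  · intro c m' ha h1
    simp [NExp.eval, ha.nv .k (by decide), hk, h1.prev.1]
  · intro c m' _ hc ha hcv h1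
    have hm' := hm.of_agree ha (by unfold KeepsInput; decide)
    have hi' : m'.nv .i = i := (ha.nv _ (by decide)).trans hi
    have hk' : m'.nv .k = i + 1 := (ha.nv _ (by decide)).trans hk
    have hjv : m'.na .bat (i + 1) c = l[c] := h1.prev.2 c l[c] (by simp [hc])
    have hBj : B l[c] = i + 1 := (hl _).1 (List.getElem_mem hc)
    set j := l[c] with hj
    set m₁ := m'.setN .j (NExp.eval m' (.get .bat (.var .k) (.var .c))) with hm₁
    have hj₁ : m₁.nv .j = j := by simp [hm₁, NExp.eval, hk', hcv, hjv]
    have hi₁ : m₁.nv .i = i := by simp [hm₁, hi']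
    have hload₁ : I.LoadedIn m₁ := hm'.of_agree (Exec.setN (f := f) _ _ _).agree
      (by unfold KeepsInput; decide)
    have h1₁ : LevelState B i l _ m₁ := h1.congr rfl
    rw [run_seq, run_setN]
    have hlenp := I.length_preds_le j
    refine run_forUp 0 (I.preds j).length 45 (fun q m₂ => LevelState B i l (fun x => R₀ x +
      ((l.drop (c + 1)).map fun j => (I.preds j).count x).sum + ((I.preds j).drop q).count x) m₂)
      (by decide) rfl (by omega) ?_ ?_ ?_ ?_
    · refine LevelState.congr (m := m₁) ?_ rfl
      convert h1₁ using 2 with x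
      rw [List.drop_zero, List.drop_eq_getElem_cons hc, List.map_cons, List.sum_cons,
        ← hj]
      omega
    · intro q m₂ ha₂ _
      simp only [NExp.eval]
      rw [ha₂.nv .j (by decide), ha₂.na .np (by decide), hj₁]
      exact hload₁.np_eq j
    · intro q m₂ _ hq ha₂ hqv h2
      have hprv : m₂.na .pred (m₂.nv .j) q = (I.preds j)[q] := by
        rw [ha₂.nv .j (by decide), hj₁, ha₂.na .pred (by decide)]
        exact hload₁.pred_eq j ⟨q, hq⟩
      rw [run_seq, run_setN]
      have hBpr := hB.mono (I.preds j)[q] j (List.getElem_mem hq)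
      refine (run_removeEdge (i := i) (B := B) (l := l) (pr := (I.preds j)[q])
        (R := fun x => R₀ x + ((l.drop (c + 1)).map fun j => (I.preds j).count x).sum +
          ((I.preds j).drop q).count x)
          (R' := fun x => R₀ x + ((l.drop (c + 1)).map fun j => (I.preds j).count x).sum +
          ((I.preds j).drop (q + 1)).count x) ?_ ?_ (by omega) ?_ ?_).imp ?_
      · exact h2.congr rfl
      · rw [Mem.nv_setN, if_neg (by decide), ha₂.nv _ (by decide), hi₁]
      · intro x
        rw [count_drop_eq hq]
        omega
      · simp [NExp.eval, hqv, hprv]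
      · rintro t₃ m₃ ⟨h3, h4⟩
        refine ⟨?_, h4.congr rfl⟩
        simp only [NExp.time]
        omega
    · rintro t₂ m₂ _ ht₂ h2
      refine ⟨?_, ?_⟩
      · simp only [NExp.time] at ht₂ ⊢
        omega
      · refine LevelState.congr (m := m₂) ?_ rfl
        simpa using h2
  · intro t m' _ ht h1
    refine ⟨?_, by simpa using h1⟩
    simp only [NExp.time, Nat.sub_zero] at ht
    have := Nat.mul_le_mul_right (60 * (n + 1) + (1 + 1 + 1) + 7) hlen
    nlinarith

theorem run_initDegrees {I : Inst n} (hm : I.LoadedIn m) :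
    Run f (forUp .j (.lit 0) (.var .n) (.putN1 .deg (.var .j) (.lit 0)) ⨟
      forUp .j (.lit 0) (.var .n)
        (forUp .q (.lit 0) (.get1 .np (.var .j))
          (.setN .pr (.get .pred (.var .j) (.var .q)) ⨟
           .putN1 .deg (.var .pr) (.add (.get1 .deg (.var .pr)) (.lit 1))))) m fun t m' =>
      t ≤ 100 * (n + 1) * (n + 1) ∧ ∀ x : Fin n, m'.na .deg x 0 = I.outDeg Finset.univ x := by
  rw [run_seq]
  refine run_forUp 0 n 5 (fun q m' => ∀ x < q, m'.na .deg x 0 = 0) (by decide) rfl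
    (by omega) (by simp) ?_ ?_ ?_
  · intro i m' ha _
    simp [NExp.eval, ha.nv .n (by decide), hm.n_eq]
  · intro i m' _ hi ha hx h
    rw [Stmt.putN1, run_putN]
    refine ⟨by simp [NExp.time], fun x hxi => ?_⟩
    by_cases h1 : x = i
    · simp [NExp.eval, hx, h1]
    · simp [NExp.eval, hx, h1, h x (by omega)]
  intro t₁ m₁ ha₁ ht₁ h1
  have hm₁ := hm.of_agree ha₁ (by unfold KeepsInput; decide)
  refine run_forUp 0 n (40 * (n + 1)) (fun q m' => ∀ x : Fin n, m'.na .deg x 0 =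
    I.outDeg (Finset.univ.filter fun j : Fin n => (j : ℕ) < q) x) (by decide) rfl
    (by omega) ?_ ?_ ?_ ?_
  · intro x
    simp [Inst.outDeg, h1 x x.2]
  · intro i m' ha _
    simp [NExp.eval, ha.nv .n (by decide), hm₁.n_eq]
  · intro q m' _ hq ha hqv h
    have hm' := hm₁.of_agree ha (by unfold KeepsInput; decide)
    set j : Fin n := ⟨q, hq⟩ with hj
    have hjv : m'.nv .j = j := hqv
    have hlenp := I.length_preds_le j
    have hset : (Finset.univ.filter fun y : Fin n => (y : ℕ) < q + 1) =
        insert j (Finset.univ.filter fun y : Fin n => (y : ℕ) < q) := by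
      ext y
      simp only [Finset.mem_filter, Finset.mem_univ, true_and, Finset.mem_insert, Fin.ext_iff, hj]
      omega
    refine run_forUp 0 (I.preds j).length 25 (fun r m₂ => ∀ x : Fin n, m₂.na .deg x 0 =
      I.outDeg (Finset.univ.filter fun j : Fin n => (j : ℕ) < q) x + ((I.preds j).take r).count x)
      (by decide) rfl (by omega) (by simpa using h) ?_ ?_ ?_
    · intro r m₂ ha₂ _
      simp only [NExp.eval]
      rw [ha₂.nv .j (by decide), ha₂.na .np (by decide), hjv]
      exact hm'.np_eq j
    · intro r m₂ _ hr ha₂ hrv h2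
      have hprv : m₂.na .pred (m₂.nv .j) r = (I.preds j)[r] := by
        rw [ha₂.nv .j (by decide), hjv, ha₂.na .pred (by decide)]
        exact hm'.pred_eq j ⟨r, hr⟩
      simp only [run_seq, run_setN, run_putN, Stmt.putN1]
      refine ⟨by simp [NExp.time], fun x => ?_⟩
      rw [count_take_eq hr]
      by_cases hx : x = (I.preds j)[r]
      · have h3 := h2 (I.preds j)[r]
        simp [NExp.eval, hrv, hprv, hx, h3]
        omega
      · have hx' : ¬ (x : ℕ) = ((I.preds j)[r] : Fin n) := fun h => hx (Fin.ext h)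
        simp [NExp.eval, hrv, hprv, hx, hx', h2 x]
    · intro t₂ m₂ _ ht₂ h2
      refine ⟨?_, fun x => ?_⟩
      · simp only [NExp.time] at ht₂
        omega
      · rw [hset, Inst.outDeg, Finset.sum_insert (by simp [hj]), Mem.na_setN, h2 x,
          List.take_length, Inst.outDeg]
        omega
  · intro t₂ m₂ _ ht₂ h2
    refine ⟨?_, fun x => ?_⟩
    · simp only [NExp.time, Nat.sub_zero] at ht₁ ht₂
      nlinarith
    · simpa using h2 x

/-- The crude bound of `O(n ^ 2)` steps per set suffices here, since there are `n` sets. -/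
theorem run_initCSF {I : Inst n} (hm : I.LoadedIn m) {B : Fin n → ℕ} {a : ℕ} (hB : I.IsCSF B a)
    (htight : ∀ j, B j < n → ∃ j', j ∈ I.preds j' ∧ B j' = B j + 1) :
    Run f initCSF m fun t m' =>
      t ≤ 500 * (n + 1) * (n + 1) * (n + 1) ∧ ∀ x : Fin n, m'.na .ord x 0 = B x := by
  have hassoc : ∀ c d e : Stmt, ∀ Q, Run f ((c ⨟ d) ⨟ e) m Q → Run f (c ⨟ d ⨟ e) m Q := by
    intro c d e Q h
    simp only [run_seq, add_assoc] at h ⊢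
    exact h
  have hnpos := I.n_pos
  have hfull : Finset.univ.filter (B · ≤ n) = Finset.univ := by
    ext x; simp [hB.le_n x]
  have htop : ∀ x, I.outDeg Finset.univ x = 0 ↔ B x = n := fun x => by
    rw [← outDeg_levels hB htight le_rfl x, hfull]
    simp [hB.le_n x]
  refine hassoc _ _ _ _ ?_
  rw [run_seq]
  refine (run_initDegrees hm).agree.imp ?_
  rintro t₁ m₁ ⟨⟨ht₁, hdeg₁⟩, ha₁⟩
  have hm₁ := hm.of_agree ha₁ (by unfold KeepsInput; decide)
  rw [run_seq, Stmt.putN1, run_putN, run_seq]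
  refine run_forUp 0 n 40 (fun q m' => HoldsList m' n (members B n q) ∧
      (∀ x : Fin n, (x : ℕ) < q → B x = n → m'.na .ord x 0 = n)) (by decide) rfl (by omega) ?_ ?_
      ?_ ?_
  · simp [HoldsList, members, NExp.eval, hm₁.n_eq]
  · intro i m' ha _
    simp [NExp.eval, ha.nv .n (by decide), hm₁.n_eq]
  · rintro q m' _ hq ha hqv ⟨h1, h2⟩
    have hn' : m'.nv .n = n := by rw [ha.nv _ (by decide)]; simpa using hm₁.n_eq
    have hd : m'.na .deg q 0 = I.outDeg Finset.univ ⟨q, hq⟩ := by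
      rw [ha.na _ (by decide)]; simpa using hdeg₁ ⟨q, hq⟩
    have hcond : m'.na .deg q 0 = 0 ↔ B ⟨q, hq⟩ = n := by rw [hd]; exact htop _
    simp only [run_when, run_seq, run_putN, Stmt.putN1]
    refine ⟨fun h3 => ?_, fun h3 => ?_⟩ <;>
      simp only [BExp.Holds, NExp.eval, hqv, hcond] at h3 <;>
      refine ⟨by simp [NExp.time, BExp.time], ?_, fun x hx hBx => ?_⟩
    · rw [members_succ B n hq, if_pos h3]
      refine h1.append ?_ fun c => ?_
      · simp [NExp.eval, hn']
      · simp [NExp.eval, hn', hqv]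
    · by_cases hxq : (x : ℕ) = q
      · simp [NExp.eval, hn', hqv, hxq]
      · simp [NExp.eval, hqv, hxq, h2 x (by omega) hBx]
    · rw [members_succ B n hq, if_neg h3, List.append_nil]
      exact h1.congr (by simp) (by simp)
    · have hxq : (x : ℕ) ≠ q := by
        intro hxq
        obtain rfl : x = ⟨q, hq⟩ := Fin.ext hxq
        exact h3 hBx
      simpa using h2 x (by omega) hBx
  rintro t₂ m₂ ha₂ ht₂ ⟨hl₂, hord₂⟩
  have hm₂ : I.LoadedIn m₂ := by
    refine Inst.LoadedIn.of_agree ?_ ha₂ (by unfold KeepsInput; decide)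
    exact ⟨by simpa using hm₁.n_eq, by simpa using hm₁.s_eq, by simpa using hm₁.p_eq,
      by simpa using hm₁.np_eq, by simpa using hm₁.pred_eq⟩
  have hdeg₂ : ∀ x : Fin n, m₂.na .deg x 0 = I.outDeg Finset.univ x := by
    intro x
    rw [ha₂.na _ (by decide)]; simpa using hdeg₁ x
  rw [run_seq, run_setN]
  refine run_loop (v := n - 1) (fun v t m' => ∃ i, m'.nv .i = i ∧ v = i ∧ i < n ∧
    t ≤ (n - 1 - i) * (200 * (n + 1) * (n + 1)) ∧
    (∃ l : List (Fin n), l.Nodup ∧ (∀ x, x ∈ l ↔ B x = i + 1) ∧ HoldsList m' (i + 1) l) ∧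
    (∀ x : Fin n, m'.na .deg x 0 = I.outDeg (Finset.univ.filter (B · ≤ i + 1)) x) ∧
    (∀ x : Fin n, i + 1 ≤ B x → m'.na .ord x 0 = B x)) ?_ ?_ ?_
  · have h1 : n - 1 + 1 = n := by omega
    refine ⟨n - 1, by simp [NExp.eval, hm₂.n_eq], rfl, by omega, by omega, ?_, ?_, ?_⟩
    · refine ⟨members B n n, members_nodup _ _ _, fun x => ?_, ?_⟩
      · rw [mem_members, h1]
      · rw [h1]; exact hl₂.congr rfl fun _ => rfl
    · rw [h1, hfull]
      simpa using hdeg₂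
    · rw [h1]
      intro x hx
      have hBx := le_antisymm (hB.le_n x) hx
      rw [Mem.na_setN, hBx]
      exact hord₂ x x.2 hBx
  · rintro v t m' ha ⟨i, hiv, rfl, hin, ht, ⟨l, hnd, hl, hhl⟩, hdeg, hord⟩ h1
    simp only [BExp.Holds, NExp.eval, hiv] at h1
    obtain ⟨k, rfl⟩ : ∃ k, v = k + 1 := ⟨v - 1, by omega⟩
    have hm' : I.LoadedIn m' := by
      refine Inst.LoadedIn.of_agree ?_ ha (by unfold KeepsInput; decide)
      exact ⟨by simpa using hm₂.n_eq, by simpa using hm₂.s_eq, by simpa using hm₂.p_eq,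
        by simpa using hm₂.np_eq, by simpa using hm₂.pred_eq⟩
    -- Before the edges into the last set are removed, no job below it has out-degree zero; hence
    -- the new list correctly starts empty.
    have hpos : ∀ x, B x ≤ k + 1 → I.outDeg (Finset.univ.filter (B · ≤ k + 1 + 1)) x ≠ 0 := by
      intro x hx h0
      have := (outDeg_levels hB htight (show k + 1 + 1 ≤ n by omega) x).1 ⟨by omega, h0⟩
      omega
    rw [run_seq, Stmt.putN1, run_putN, run_seq, run_setN, run_seq]
    refine (run_level (I := I) (B := B) (a := a) (i := k + 1) (l := l) ?_ hB hnd hl ?_ ?_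
      ⟨?_, ?_, ?_, [], ?_⟩).agree.imp ?_
    · exact ⟨by simpa using hm'.n_eq, by simpa using hm'.s_eq, by simpa using hm'.p_eq,
        by simpa using hm'.np_eq, by simpa using hm'.pred_eq⟩
    · simpa using hiv
    · simp [NExp.eval, hiv]
    · refine hhl.congr ?_ fun c => ?_ <;> simp [NExp.eval, hiv]
    · simpa [NExp.eval] using hdeg
    · simpa [NExp.eval] using hord
    · refine ⟨by simp, by simp [HoldsList, NExp.eval, hiv], fun x => ?_, by simp⟩
      simp only [List.not_mem_nil, false_iff, not_and]
      exact hpos x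
    · rintro t₃ m₃ ⟨⟨ht₃, h3⟩, ha₃⟩
      obtain ⟨l', hnd', hl', hmem', hord'⟩ := h3.next
      have hi₃ : m₃.nv .i = k + 1 := by rw [ha₃.nv _ (by decide)]; simpa using hiv
      have hmem : ∀ x, x ∈ l' ↔ B x = k + 1 := fun x => by
        rw [hmem' x, outDeg_levels hB htight (by omega)]
      rw [run_setN]
      refine ⟨k, by omega, k, by simp [NExp.eval, hi₃], rfl, by omega, ?_,
        ⟨l', hnd', hmem, hl'.congr rfl fun _ => rfl⟩, by simpa using h3.deg, fun x hx => ?_⟩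
      · have hsub : n - 1 - k = (n - 1 - (k + 1)) + 1 := by omega
        rw [hsub, Nat.add_mul, Nat.one_mul]
        simp only [BExp.time, NExp.time]
        nlinarith
      · rw [Mem.na_setN]
        by_cases hx' : B x = k + 1
        · rw [hx', hord' x ((hmem x).2 hx')]
        · exact h3.ord x (by omega)
  · rintro v t m' ha ⟨i, hiv, rfl, hin, ht, -, -, hord⟩ h1
    simp only [BExp.Holds, NExp.eval, hiv] at h1
    obtain rfl : v = 0 := by omega
    refine ⟨?_, fun x => hord x (by have := hB.one_le; have := hB.a_le x; omega)⟩
    simp only [BExp.time, NExp.time] at ht₂ ⊢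
    have h2 : (n - 1 - 0) * (200 * (n + 1) * (n + 1)) ≤ n * (200 * (n + 1) * (n + 1)) :=
      Nat.mul_le_mul_right _ (by omega)
    have h3 : (n - 0) * (40 + 1 + 7) + 1 + 1 + 4 ≤ 60 * (n + 1) := by omega
    nlinarith [Nat.zero_le (n * n), Nat.zero_le (n * n * n)]

end

/-! ### Recording schedules -/

section

variable {n : ℕ} {m : Mem}

theorem Schedule.fmax_lt_iff {I : Inst n} {σ : Schedule n} {y : ℝ} :
    σ.fmax I < y ↔ ∀ j, I.f j (σ.C I j) < y := by
  simp [Schedule.fmax, Finset.sup'_lt_iff]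

theorem run_saveSchedule {I : Inst n} (hm : I.LoadedIn m) {ok : ℝ → Prop} {F : Fin n → ℕ} {a : ℕ}
    (h : I.Scheduled ok F a m) :
    Run I.oracle saveSchedule m fun t m' => t ≤ 200 * (n + 1) ∧ I.Realizes F a (outBest n m') ∧
      m'.rv .piC = (outBest n m').Cmax I ∧ m'.rv .y = (outBest n m').fmax I ∧
      m'.nv .inf = 0 := by
  set G : Fin n → ℝ := fun j => I.f j (I.compl F a (F j)) with hG
  have hCord : ∀ j : Fin n, m.ra .C (m.na .ord j 0) 0 = I.compl F a (F j) := fun j => by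
    rw [h.ord, h.compl _ (h.csf.le_n j)]
  have hcost : ∀ j : Fin n, I.oracle j (m.ra .C (m.na .ord j 0) 0) = G j := fun j => by
    rw [hCord, I.oracle_apply]
  have hcost0 : I.oracle 0 (m.ra .C (m.na .ord 0 0) 0) = G ⟨0, I.n_pos⟩ := hcost ⟨0, I.n_pos⟩
  rw [saveSchedule, run_seq, run_setR, run_seq]
  -- The register `fm` bounds the costs seen so far and is the cost of some job; it starts with job
  -- `0`, which exists as `n ≥ 1`. At the end it is the maximum.
  refine run_forUp 0 n 50 (fun q m' => (∀ x : Fin n, (x : ℕ) < q → m'.na .piB x 0 = F x) ∧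
    (∀ x : Fin n, (x : ℕ) < q → G x ≤ m'.rv .fm) ∧ ∃ x, m'.rv .fm = G x) (by decide) rfl
    (by omega) ?_ ?_ ?_ ?_
  · refine ⟨by simp, by simp, ⟨0, I.n_pos⟩, ?_⟩
    simpa [RExp.eval, NExp.eval] using hcost0
  · intro i m' ha _
    simp [NExp.eval, ha.nv .n (by decide), hm.n_eq]
  · rintro q m' _ hq ha hqv ⟨h1, h2, x₀, h3⟩
    have hord' : m'.na .ord = m.na .ord := by rw [ha.na _ (by decide)]; simp
    have hC' : m'.ra .C = m.ra .C := by rw [ha.ra _ (by decide)]; simp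
    have hc : I.oracle q (m.ra .C (m.na .ord q 0) 0) = G ⟨q, hq⟩ := hcost ⟨q, hq⟩
    have hoq : m.na .ord q 0 = F ⟨q, hq⟩ := h.ord ⟨q, hq⟩
    have hsplit : ∀ x : Fin n, (x : ℕ) < q + 1 → x = ⟨q, hq⟩ ∨ ((x : ℕ) < q ∧ (x : ℕ) ≠ q) := by
      intro x hx
      by_cases hxq : (x : ℕ) = q
      · exact Or.inl (Fin.ext hxq)
      · exact Or.inr ⟨by omega, hxq⟩
    simp only [run_seq, run_when, run_putN, run_setR, Stmt.putN1]
    refine ⟨fun h4 => ?_, fun h4 => ?_⟩ <;>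
      simp [BExp.Holds, NExp.eval, RExp.eval, hqv, hord', hC', hc] at h4 <;>
      refine ⟨by simp [NExp.time, RExp.time, BExp.time], fun x hx => ?_, fun x hx => ?_, ?_⟩
    · rcases hsplit x hx with rfl | ⟨hx, hx'⟩
      · simp [NExp.eval, hqv, hord', hoq]
      · simp [NExp.eval, hqv, hx', h1 x hx]
    · rcases hsplit x hx with rfl | ⟨hx, hx'⟩
      · simp [NExp.eval, RExp.eval, hqv, hord', hC', hc]
      · simpa [NExp.eval, RExp.eval, hqv, hord', hC', hc] using (h2 x hx).trans h4.le
    · exact ⟨⟨q, hq⟩, by simp [NExp.eval, RExp.eval, hqv, hord', hC', hc]⟩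
    · rcases hsplit x hx with rfl | ⟨hx, hx'⟩
      · simp [NExp.eval, hqv, hord', hoq]
      · simp [NExp.eval, hqv, hx', h1 x hx]
    · rcases hsplit x hx with rfl | ⟨hx, hx'⟩
      · simpa using h4
      · simpa using h2 x hx
    · exact ⟨x₀, by simpa using h3⟩
  rintro t₁ m₁ ha₁ ht₁ ⟨hB, hle, x₀, hx₀⟩
  have hn₁ : m₁.nv .n = n := by rw [ha₁.nv _ (by decide)]; simpa using hm.n_eq
  have hS₁ : m₁.ra .S = m.ra .S := by rw [ha₁.ra _ (by decide)]; simp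
  have hC₁ : m₁.ra .C = m.ra .C := by rw [ha₁.ra _ (by decide)]; simp
  have hfm : m₁.rv .fm = Finset.univ.sup' I.univ_nonempty G := by
    refine le_antisymm ?_ (Finset.sup'_le _ _ fun x _ => hle x x.2)
    rw [hx₀]
    exact Finset.le_sup' G (Finset.mem_univ x₀)
  rw [run_seq]
  refine run_forUp 1 (n + 1) 20 (fun i m' => ∀ i', 1 ≤ i' → i' < i →
    m'.ra .piS i' 0 = m.ra .S i' 0) (by decide) rfl (by omega) (fun i' _ _ => by omega) ?_ ?_ ?_
  · intro i m' ha _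
    simp [NExp.eval, ha.nv .n (by decide), hn₁]
  · intro i m' _ _ ha hiv h1
    rw [Stmt.putR1, run_putR]
    refine ⟨by simp [NExp.time, RExp.time], fun i' hi1 hi' => ?_⟩
    have hS' : m'.ra .S = m.ra .S := by rw [ha.ra _ (by decide), hS₁]
    by_cases hii : i' = i
    · simp [NExp.eval, RExp.eval, hiv, hii, hS']
    · simp [NExp.eval, hiv, hii, h1 i' hi1 (by omega)]
  rintro t₂ m₂ ha₂ ht₂ h2
  simp only [run_seq, run_setR, run_setN]
  have hreal : I.Realizes F a (outBest n m₂) := by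
    refine ⟨fun j => ?_, fun i hi hin => ?_⟩
    · change m₂.na .piB j 0 = F j
      rw [ha₂.na _ (by decide)]
      exact hB j j.2
    · change m₂.ra .piS i 0 = _
      rw [h2 i (h.csf.one_le.trans hi) (by omega), h.start i (h.csf.one_le.trans hi) hin]
  have hn₂ : m₂.nv .n = n := by rw [ha₂.nv _ (by decide), hn₁]
  have hC₂ : m₂.ra .C = m.ra .C := by rw [ha₂.ra _ (by decide), hC₁]
  have hfm₂ : m₂.rv .fm = m₁.rv .fm := ha₂.rv _ (by decide)
  refine ⟨?_, hreal, ?_, ?_, by simp [NExp.eval]⟩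
  · simp only [NExp.time, RExp.time] at ht₁ ht₂ ⊢
    omega
  · refine Eq.trans ?_ (hreal.Cmax_eq h.csf).symm
    simp [NExp.eval, RExp.eval, hn₂, hC₂, h.compl n le_rfl]
  · refine Eq.trans ?_ (hreal.fmax_eq h.csf).symm
    simp [NExp.eval, RExp.eval, hfm₂, hfm, hG]

/-- Start times are copied only for batches `1, …, n`, so the new entry need not equal the saved
schedule elsewhere. Older entries are unchanged as schedules. -/
theorem run_recordPoint {I : Inst n} {f : ℕ → ℝ → ℝ} (hm : I.LoadedIn m) :
    Run f recordPoint m fun t m' => t ≤ 100 * (n + 1) ∧ m'.nv .num = m.nv .num + 1 ∧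
      outPoint m' (m.nv .num + 1) = (m.rv .piC, m.rv .y) ∧
      (∀ j : Fin n, (outSchedule n m' (m.nv .num + 1)).batch j = (outBest n m).batch j) ∧
      (∀ i, 1 ≤ i → i ≤ n →
        (outSchedule n m' (m.nv .num + 1)).start i = (outBest n m).start i) ∧
      ∀ κ, κ ≠ m.nv .num + 1 →
        outPoint m' κ = outPoint m κ ∧ outSchedule n m' κ = outSchedule n m κ := by
  set K := m.nv .num + 1 with hK
  simp only [recordPoint, run_seq, Stmt.putR1, run_setN, run_putR]
  set m₀ := ((m.setN .num (NExp.eval m (.add (.var .num) (.lit 1)))).putR .omC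
    (NExp.eval (m.setN .num (NExp.eval m (.add (.var .num) (.lit 1)))) (.var .num))
    (NExp.eval (m.setN .num (NExp.eval m (.add (.var .num) (.lit 1)))) (.lit 0))
    (RExp.eval f (m.setN .num (NExp.eval m (.add (.var .num) (.lit 1)))) (.var .piC))).putR .omF
    (NExp.eval ((m.setN .num (NExp.eval m (.add (.var .num) (.lit 1)))).putR .omC
      (NExp.eval (m.setN .num (NExp.eval m (.add (.var .num) (.lit 1)))) (.var .num))
      (NExp.eval (m.setN .num (NExp.eval m (.add (.var .num) (.lit 1)))) (.lit 0))
      (RExp.eval f (m.setN .num (NExp.eval m (.add (.var .num) (.lit 1)))) (.var .piC)))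
      (.var .num))
    (NExp.eval ((m.setN .num (NExp.eval m (.add (.var .num) (.lit 1)))).putR .omC
      (NExp.eval (m.setN .num (NExp.eval m (.add (.var .num) (.lit 1)))) (.var .num))
      (NExp.eval (m.setN .num (NExp.eval m (.add (.var .num) (.lit 1)))) (.lit 0))
      (RExp.eval f (m.setN .num (NExp.eval m (.add (.var .num) (.lit 1)))) (.var .piC))) (.lit 0))
    (RExp.eval f ((m.setN .num (NExp.eval m (.add (.var .num) (.lit 1)))).putR .omC
      (NExp.eval (m.setN .num (NExp.eval m (.add (.var .num) (.lit 1)))) (.var .num))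
      (NExp.eval (m.setN .num (NExp.eval m (.add (.var .num) (.lit 1)))) (.lit 0))
      (RExp.eval f (m.setN .num (NExp.eval m (.add (.var .num) (.lit 1)))) (.var .piC)))
      (.var .y)) with hm₀
  have hnum₀ : m₀.nv .num = K := by simp [hm₀, NExp.eval, hK]
  have hn₀ : m₀.nv .n = n := by simpa [hm₀] using hm.n_eq
  have hna₀ : m₀.na = m.na := by simp [hm₀]
  have homC₀ : ∀ κ, m₀.ra .omC κ 0 = if κ = K then m.rv .piC else m.ra .omC κ 0 := fun κ => by
    simp [hm₀, NExp.eval, RExp.eval, hK]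
  have homF₀ : ∀ κ, m₀.ra .omF κ 0 = if κ = K then m.rv .y else m.ra .omF κ 0 := fun κ => by
    simp [hm₀, NExp.eval, RExp.eval, hK]
  have homS₀ : ∀ κ i, m₀.ra .omS κ i = m.ra .omS κ i := fun κ i => by simp [hm₀]
  have hpiS₀ : ∀ i, m₀.ra .piS i 0 = m.ra .piS i 0 := fun i => by simp [hm₀]
  clear_value m₀
  refine run_forUp 0 n 20 (fun q m' => (∀ x < q, m'.na .omB K x = m.na .piB x 0) ∧
    ∀ κ, κ ≠ K → m'.na .omB κ = m.na .omB κ) (by decide) rfl (by omega) ?_ ?_ ?_ ?_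
  · exact ⟨fun x hx => by omega, fun κ _ => by simp [hna₀]⟩
  · intro i m' ha _
    simp [NExp.eval, ha.nv .n (by decide), hn₀]
  · rintro q m' _ _ ha hqv ⟨h1, h2⟩
    have hnum' : m'.nv .num = K := (ha.nv _ (by decide)).trans hnum₀
    have hpiB' : m'.na .piB = m.na .piB := by rw [ha.na _ (by decide), hna₀]
    rw [run_putN]
    refine ⟨by simp [NExp.time], fun x hx => ?_, fun κ hκ => ?_⟩
    · by_cases hxq : x = q
      · simp [NExp.eval, hnum', hqv, hxq, hpiB']
      · simp [NExp.eval, hqv, hxq, h1 x (by omega)]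
    · funext x
      simp [NExp.eval, hnum', hκ, h2 κ hκ]
  rintro t₁ m₁ ha₁ ht₁ ⟨hB₁, hB₁'⟩
  have hnum₁ : m₁.nv .num = K := (ha₁.nv _ (by decide)).trans hnum₀
  have hn₁ : m₁.nv .n = n := (ha₁.nv _ (by decide)).trans hn₀
  refine run_forUp 1 (n + 1) 20 (fun i m' =>
    (∀ i', 1 ≤ i' → i' < i → m'.ra .omS K i' = m.ra .piS i' 0) ∧
    ∀ κ, κ ≠ K → m'.ra .omS κ = m.ra .omS κ) (by decide) rfl (by omega) ?_ ?_ ?_ ?_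
  · refine ⟨fun i' _ _ => by omega, fun κ _ => ?_⟩
    funext i
    rw [Mem.ra_setN, ha₁.ra _ (by decide), homS₀]
  · intro i m' ha _
    simp [NExp.eval, ha.nv .n (by decide), hn₁]
  · rintro i m' _ _ ha hiv ⟨h1, h2⟩
    have hnum' : m'.nv .num = K := (ha.nv _ (by decide)).trans hnum₁
    have hpiS' : ∀ i, m'.ra .piS i 0 = m.ra .piS i 0 := fun i => by
      rw [ha.ra _ (by decide), ha₁.ra _ (by decide), hpiS₀]
    rw [run_putR]
    refine ⟨by simp [NExp.time, RExp.time], fun i' hi1 hi' => ?_, fun κ hκ => ?_⟩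
    · by_cases hii : i' = i
      · simp [NExp.eval, RExp.eval, hnum', hiv, hii, hpiS']
      · simp [NExp.eval, hiv, hii, h1 i' hi1 (by omega)]
    · funext x
      simp [NExp.eval, hnum', hκ, h2 κ hκ]
  rintro t₂ m₂ ha₂ ht₂ ⟨hS₂, hS₂'⟩
  have homB₂ : m₂.na .omB = m₁.na .omB := ha₂.na _ (by decide)
  have homC₂ : m₂.ra .omC = m₀.ra .omC := by rw [ha₂.ra _ (by decide), ha₁.ra _ (by decide)]
  have homF₂ : m₂.ra .omF = m₀.ra .omF := by rw [ha₂.ra _ (by decide), ha₁.ra _ (by decide)]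
  refine ⟨?_, (ha₂.nv _ (by decide)).trans hnum₁, ?_, fun j => ?_, fun i hi hin => ?_,
    fun κ hκ => ⟨?_, ?_⟩⟩
  · simp only [NExp.time, RExp.time] at ht₁ ht₂ ⊢
    omega
  · simp [outPoint, homC₂, homF₂, homC₀, homF₀]
  · change m₂.na .omB K j = m.na .piB j 0
    rw [homB₂, hB₁ j j.2]
  · exact hS₂ i hi (by omega)
  · simp [outPoint, homC₂, homF₂, homC₀, homF₀, hκ]
  · simp only [outSchedule, homB₂, hB₁' κ hκ, hS₂' κ hκ]

end

/-! ### Pareto optimality and Algorithm MAIN2 -/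

section

variable {n : ℕ} {m : Mem}

/-- If `τ` were neither cheaper than `π` nor at the same point, `π` would dominate it. -/
theorem Schedule.ParetoOptimal.eq_or_lt {I : Inst n} {τ π : Schedule n} (hτ : τ.ParetoOptimal I)
    (hπ : π.Feasible I) (h : π.Cmax I ≤ τ.Cmax I) :
    τ.fmax I < π.fmax I ∨ (τ.Cmax I, τ.fmax I) = (π.Cmax I, π.fmax I) := by
  rcases lt_or_ge (τ.fmax I) (π.fmax I) with h1 | h1
  · exact Or.inl h1
  · right
    by_contra h2
    refine hτ.2 ⟨π, hπ, h, h1, ?_⟩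
    by_contra! h3
    exact h2 (Prod.ext (le_antisymm h3.1 h) (le_antisymm h3.2 h1))

/-- The entries of the output list are Pareto optimal schedules with their points, in order of
increasing makespan. -/
structure Inst.Listed (I : Inst n) (m : Mem) : Prop where
  pareto : ∀ κ ∈ Set.Icc 1 (m.nv .num), (outSchedule n m κ).ParetoOptimal I ∧
    outPoint m κ = ((outSchedule n m κ).Cmax I, (outSchedule n m κ).fmax I)
  mono : StrictMonoOn (fun κ => (outPoint m κ).1) (Set.Icc 1 (m.nv .num))

/-- `v` is a point of the output list. -/
def Recorded (m : Mem) (v : ℝ × ℝ) : Prop := ∃ κ ∈ Set.Icc 1 (m.nv .num), outPoint m κ = v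

/-- The schedule that has been found last: it has minimum makespan among the schedules with at most
its maximum cost. -/
structure Inst.Current (I : Inst n) (F : Fin n → ℕ) (a : ℕ) (m : Mem) : Prop where
  csf : I.IsCSF F a
  bounding : I.Bounding (· < m.rv .y) F
  real : I.Realizes F a (outBest n m)
  piC_eq : m.rv .piC = (outBest n m).Cmax I
  y_eq : m.rv .y = (outBest n m).fmax I
  inf_eq : m.nv .inf = 0
  min : ∀ σ : Schedule n, σ.Feasible I → σ.fmax I ≤ m.rv .y → m.rv .piC ≤ σ.Cmax I

/-- The output list contains all Pareto optimal points except that of the schedule found last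
and those with smaller maximum cost. -/
structure Inst.Collected (I : Inst n) (m : Mem) : Prop extends I.Listed m where
  lt : ∀ κ ∈ Set.Icc 1 (m.nv .num), (outPoint m κ).1 < m.rv .piC
  complete : ∀ τ : Schedule n, τ.ParetoOptimal I → τ.fmax I < m.rv .y ∨
    Recorded m (τ.Cmax I, τ.fmax I) ∨ (τ.Cmax I, τ.fmax I) = (m.rv .piC, m.rv .y)

theorem outBest_congr {m m' : Mem} (h1 : m'.na .piB = m.na .piB) (h2 : m'.ra .piS = m.ra .piS) :
    outBest n m' = outBest n m := by
  simp [outBest, h1, h2]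

theorem Inst.Current.of_agree {I : Inst n} {F : Fin n → ℕ} {a : ℕ} {c : Stmt} {m' : Mem}
    (h : I.Current F a m) (ha : Agree c m m')
    (hc : .piB ∉ c.wNA ∧ .piS ∉ c.wRA ∧ .piC ∉ c.wR ∧ .y ∉ c.wR ∧ .inf ∉ c.wN) :
    I.Current F a m' := by
  have h1 : outBest n m' = outBest n m := outBest_congr (ha.na _ hc.1) (ha.ra _ hc.2.1)
  have h2 := ha.rv _ hc.2.2.1
  have h3 := ha.rv _ hc.2.2.2.1
  have h4 := ha.nv _ hc.2.2.2.2
  exact ⟨h.csf, by rw [h3]; exact h.bounding, by rw [h1]; exact h.real,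
    by rw [h1, h2]; exact h.piC_eq, by rw [h1, h3]; exact h.y_eq, by rw [h4]; exact h.inf_eq,
    by rw [h2, h3]; exact h.min⟩

/-- The program `c` does not change the output list. -/
def KeepsList (c : Stmt) : Prop :=
  .num ∉ c.wN ∧ .omC ∉ c.wRA ∧ .omF ∉ c.wRA ∧ .omS ∉ c.wRA ∧ .omB ∉ c.wNA

theorem outPoint_agree {c : Stmt} {m' : Mem} (ha : Agree c m m') (hc : KeepsList c) (κ : ℕ) :
    outPoint m' κ = outPoint m κ := by
  simp [outPoint, ha.ra _ hc.2.1, ha.ra _ hc.2.2.1]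

theorem outSchedule_agree {c : Stmt} {m' : Mem} (ha : Agree c m m') (hc : KeepsList c) (κ : ℕ) :
    outSchedule n m' κ = outSchedule n m κ := by
  simp [outSchedule, ha.ra _ hc.2.2.2.1, ha.na _ hc.2.2.2.2]

theorem Recorded.of_agree {c : Stmt} {m' : Mem} {v : ℝ × ℝ} (h : Recorded m v)
    (ha : Agree c m m') (hc : KeepsList c) : Recorded m' v := by
  obtain ⟨κ, h1, h2⟩ := h
  exact ⟨κ, by rw [ha.nv _ hc.1]; exact h1, by rw [outPoint_agree ha hc]; exact h2⟩

theorem Inst.Listed.of_agree {I : Inst n} {c : Stmt} {m' : Mem} (h : I.Listed m)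
    (ha : Agree c m m') (hc : KeepsList c) : I.Listed m' := by
  have hn := ha.nv _ hc.1
  refine ⟨fun κ hκ => ?_, ?_⟩
  · rw [hn] at hκ
    rw [outPoint_agree ha hc, outSchedule_agree ha hc]
    exact h.pareto κ hκ
  · simp only [outPoint_agree ha hc, hn]
    exact h.mono

theorem Inst.Collected.of_agree {I : Inst n} {c : Stmt} {m' : Mem} (h : I.Collected m)
    (ha : Agree c m m') (hc : KeepsList c) (hc' : .piC ∉ c.wR ∧ .y ∉ c.wR) :
    I.Collected m' := by
  refine ⟨h.toListed.of_agree ha hc, fun κ hκ => ?_, fun τ hτ => ?_⟩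
  · rw [ha.nv _ hc.1] at hκ
    rw [outPoint_agree ha hc, ha.rv _ hc'.1]
    exact h.lt κ hκ
  · rw [ha.rv _ hc'.1, ha.rv _ hc'.2]
    exact (h.complete τ hτ).imp_right (Or.imp_left fun h => h.of_agree ha hc)

/-- A schedule dominating the saved one would have a smaller makespan at no larger cost, excluded by
`Current.min`, or a smaller cost at no larger makespan, excluded by `hsep`. -/
theorem run_recordPoint_pareto {I : Inst n} {f : ℕ → ℝ → ℝ} {F : Fin n → ℕ} {a : ℕ}
    (hm : I.LoadedIn m) (hcur : I.Current F a m) (hcol : I.Collected m)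
    (hsep : ∀ σ : Schedule n, σ.Feasible I → σ.fmax I < m.rv .y → m.rv .piC < σ.Cmax I) :
    Run f recordPoint m fun t m' => t ≤ 100 * (n + 1) ∧ I.Listed m' ∧
      (∀ κ ∈ Set.Icc 1 (m'.nv .num), (outPoint m' κ).1 ≤ m.rv .piC) ∧
      ∀ τ : Schedule n, τ.ParetoOptimal I →
        τ.fmax I < m.rv .y ∨ Recorded m' (τ.Cmax I, τ.fmax I) := by
  refine (run_recordPoint hm).imp ?_
  rintro t m' ⟨ht, hnum, hpt, hbatch, hstart, hold⟩
  set K := m.nv .num + 1 with hK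
  have hreal : I.Realizes F a (outSchedule n m' K) := by
    refine ⟨fun j => (hbatch j).trans (hcur.real.batch_eq j), fun i hi hin => ?_⟩
    rw [hstart i (hcur.csf.one_le.trans hi) hin, hcur.real.start_eq i hi hin]
  have hCeq : (outSchedule n m' K).Cmax I = m.rv .piC := by
    rw [hreal.Cmax_eq hcur.csf, hcur.piC_eq, hcur.real.Cmax_eq hcur.csf]
  have hfeq : (outSchedule n m' K).fmax I = m.rv .y := by
    rw [hreal.fmax_eq hcur.csf, hcur.y_eq, hcur.real.fmax_eq hcur.csf]
  have hpareto : (outSchedule n m' K).ParetoOptimal I := by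
    refine ⟨hreal.feasible hcur.csf, ?_⟩
    rintro ⟨σ, hσ, h1, h2, h3⟩
    rw [hCeq] at h1 h3
    rw [hfeq] at h2 h3
    rcases h3 with h3 | h3
    · exact absurd (hcur.min σ hσ h2) (not_le.2 h3)
    · exact absurd (hsep σ hσ h3) (not_lt.2 h1)
  have hmem : ∀ κ ∈ Set.Icc 1 (m'.nv .num), κ = K ∨ κ ≠ K ∧ κ ∈ Set.Icc 1 (m.nv .num) := by
    intro κ hκ
    simp only [hnum, Set.mem_Icc] at hκ ⊢
    omega
  have hKmem : K ∈ Set.Icc 1 (m'.nv .num) := by simp [hnum, hK]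
  have hsub : ∀ κ ∈ Set.Icc 1 (m.nv .num), κ ∈ Set.Icc 1 (m'.nv .num) ∧ κ ≠ K := by
    intro κ hκ
    simp only [hnum, Set.mem_Icc] at hκ ⊢
    omega
  refine ⟨ht, ⟨fun κ hκ => ?_, fun κ hκ κ' hκ' hlt => ?_⟩, fun κ hκ => ?_, fun τ hτ => ?_⟩
  · rcases hmem κ hκ with rfl | ⟨h1, h2⟩
    · exact ⟨hpareto, by rw [hpt, hCeq, hfeq]⟩
    · rw [(hold κ h1).1, (hold κ h1).2]
      exact hcol.pareto κ h2
  · have hκK : κ ≠ K ∧ κ ∈ Set.Icc 1 (m.nv .num) := by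
      rcases hmem κ hκ with rfl | h1
      · simp only [hnum, Set.mem_Icc] at hκ'
        omega
      · exact h1
    simp only
    rw [(hold κ hκK.1).1]
    rcases hmem κ' hκ' with rfl | ⟨h1, h2⟩
    · rw [hpt]; exact hcol.lt κ hκK.2
    · rw [(hold κ' h1).1]
      exact hcol.mono hκK.2 h2 hlt
  · rcases hmem κ hκ with rfl | ⟨h1, h2⟩
    · rw [hpt]
    · rw [(hold κ h1).1]
      exact (hcol.lt κ h2).le
  · rcases hcol.complete τ hτ with h1 | ⟨κ, h1, h2⟩ | h1
    · exact Or.inl h1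
    · refine Or.inr ⟨κ, (hsub κ h1).1, ?_⟩
      rw [(hold κ (hsub κ h1).2).1, h2]
    · exact Or.inr ⟨K, hKmem, by rw [hpt, h1]⟩

/-- Since `F` bounds all schedules with costs in `ok`, the saved schedule has minimum makespan among
them, not only among those with at most its own cost. The stronger form is needed to compare it with
Pareto optimal schedules of cost between the new and the old bound. -/
theorem run_saveSchedule_current {I : Inst n} (hm : I.LoadedIn m) {ok : ℝ → Prop}
    {F : Fin n → ℕ} {a : ℕ} (h : I.Scheduled ok F a m) (hok : ∀ x y, x ≤ y → ok y → ok x) :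
    Run I.oracle saveSchedule m fun t m' => t ≤ 200 * (n + 1) ∧ I.Current F a m' ∧
      ok (m'.rv .y) ∧ m'.rv .piC = m.ra .C n 0 ∧
      ∀ σ : Schedule n, σ.Feasible I → ok (σ.fmax I) → m'.rv .piC ≤ σ.Cmax I := by
  refine (run_saveSchedule hm h).imp ?_
  rintro t m' ⟨ht, hreal, hC, hy, hinf⟩
  have hoky : ok (m'.rv .y) := by
    rw [hy, hreal.fmax_eq h.csf]
    obtain ⟨j, -, hj⟩ := Finset.exists_mem_eq_sup' I.univ_nonempty
      fun j => I.f j (I.compl F a (F j))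
    rw [hj]
    exact h.good j
  have hlow : ∀ σ : Schedule n, σ.Feasible I → ok (σ.fmax I) → m'.rv .piC ≤ σ.Cmax I := by
    intro σ hσ hokσ
    rw [hC, hreal.Cmax_eq h.csf]
    refine hσ.compl_le_Cmax h.csf (h.bounding.batch_le h.csf.le_n hok hσ fun j => ?_)
    exact hok _ _ (Finset.le_sup' (fun j => I.f j (σ.C I j)) (Finset.mem_univ j)) hokσ
  refine ⟨ht, ⟨h.csf, h.bounding.imp fun x hx => hok _ _ (le_of_lt hx) hoky, hreal, hC, hy, hinf,
    fun σ hσ hle => hlow σ hσ (hok _ _ hle hoky)⟩, hoky, ?_, hlow⟩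
  rw [hC, hreal.Cmax_eq h.csf, h.compl n le_rfl]

theorem Inst.IsCSF.unique {I : Inst n} {F : Fin n → ℕ} {a a' : ℕ} (h : I.IsCSF F a)
    (h' : I.IsCSF F a') : a = a' := by
  obtain ⟨x, hx⟩ := h.surj a le_rfl h.a_le_n
  obtain ⟨x', hx'⟩ := h'.surj a' le_rfl h'.a_le_n
  have h1 := h'.a_le x
  have h2 := h.a_le x'
  omega

/-- What Algorithm MAIN2 has to deliver. -/
structure Inst.Solved (I : Inst n) (m : Mem) : Prop extends I.Listed m where
  complete : ∀ τ : Schedule n, τ.ParetoOptimal I → Recorded m (τ.Cmax I, τ.fmax I)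
  feasible : (outBest n m).Feasible I
  optimal : ∀ σ : Schedule n, σ.Feasible I → (outBest n m).fmax I ≤ σ.fmax I

theorem Inst.Current.boundedBy {I : Inst n} {F : Fin n → ℕ} {a : ℕ} (h : I.Current F a m) :
    BoundedBy (· < m.rv .y) m := fun r => by simp [h.inf_eq]

/-- One iteration of Algorithm MAIN2 after the first one. -/
theorem run_improve {I : Inst n} {F : Fin n → ℕ} {a : ℕ} (hm : I.LoadedIn m)
    (hcur : I.Current F a m) (hord : ∀ j : Fin n, m.na .ord j 0 = F j) (hcol : I.Collected m)
    (hu : 0 < m.nv .u) (hgo : m.nv .go = 1) :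
    Run I.oracle (aux2 ⨟
     .ite (.eqN (.var .status) (.lit 1))
      (.when (.and (.ltN (.lit 0) (.var .u)) (.ltR (.var .piC) (.get1 .C (.var .n)))) recordPoint ⨟
       saveSchedule ⨟
       .setN .u (.add (.var .u) (.lit 1)))
      (recordPoint ⨟ .setN .go (.lit 0))) m fun t m' =>
      (m'.nv .go = 0 ∧ I.Solved m' ∧ t ≤ 1700 * (n + 1) * (∑ x, F x + 1)) ∨
      (m'.nv .go = 1 ∧ 0 < m'.nv .u ∧ ∃ F' a', I.Current F' a' m' ∧
        (∀ j : Fin n, m'.na .ord j 0 = F' j) ∧ I.Collected m' ∧ ∑ x, F' x < ∑ x, F x ∧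
        t + 1600 * (n + 1) * ∑ x, F' x ≤ 1600 * (n + 1) * ∑ x, F x) := by
  have hok := hcur.boundedBy
  rw [run_seq]
  refine (run_aux2 hm hok hcur.csf hcur.bounding hord).agree.imp ?_
  rintro t₁ m₁ ⟨hres, ha₁⟩
  have hm₁ := hm.of_agree ha₁ (by unfold KeepsInput; decide)
  have hcur₁ := hcur.of_agree ha₁ (by decide)
  have hcol₁ := hcol.of_agree ha₁ (by unfold KeepsList; decide) (by decide)
  have hgo₁ : m₁.nv .go = 1 := (ha₁.nv _ (by decide)).trans hgo
  have hu₁ : 0 < m₁.nv .u := by rw [ha₁.nv _ (by decide)]; exact hu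
  have hy₁ : m₁.rv .y = m.rv .y := ha₁.rv _ (by decide)
  rcases hres with ⟨hst, hinf, ht₁⟩ | ⟨hst, F', a', hsch, hle, ht₁⟩
  · have hno : ∀ σ : Schedule n, σ.Feasible I → ¬ σ.fmax I < m₁.rv .y := fun σ hσ h1 => by
      rw [hy₁, Schedule.fmax_lt_iff] at h1
      exact hinf σ hσ h1
    rw [run_ite]
    refine ⟨fun h => ?_, fun _ => ?_⟩
    · simp [BExp.Holds, NExp.eval, hst] at h
    rw [run_seq]
    refine (run_recordPoint_pareto hm₁ hcur₁ hcol₁ fun σ hσ h1 => absurd h1 (hno σ hσ)).agree.imp ?_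
    rintro t₂ m₂ ⟨⟨ht₂, hlist, -, hcomp⟩, ha₂⟩
    have hcur₂ := hcur₁.of_agree ha₂ (by decide)
    rw [run_setN]
    refine Or.inl ⟨by simp [NExp.eval], ⟨?_, ?_, ?_, ?_⟩, ?_⟩
    · exact hlist.of_agree (Exec.setN (f := I.oracle) .go (.lit 0) m₂).agree
        (by unfold KeepsList; decide)
    · intro τ hτ
      have := (hcomp τ hτ).resolve_left (hno τ hτ.1)
      exact this.of_agree (Exec.setN (f := I.oracle) .go (.lit 0) m₂).agree
        (by unfold KeepsList; decide)
    · exact hcur₂.real.feasible hcur.csf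
    · intro σ hσ
      have h1 := not_lt.1 (hno σ hσ)
      have h2 : m₂.rv .y = m₁.rv .y := ha₂.rv _ (by decide)
      rw [← h2, hcur₂.y_eq] at h1
      exact h1
    · simp only [BExp.time, NExp.time]
      clear * - ht₁ ht₂
      generalize ∑ x, F x = S at ht₁ ⊢
      nlinarith [Nat.zero_le (n * S)]
  -- If no job had moved, the old schedule would have all its costs strictly below its own maximum
  -- cost.
  · have hlt : ∑ x, F' x < ∑ x, F x := by
      refine Finset.sum_lt_sum (fun x _ => hle x) ?_
      by_contra! hge
      obtain rfl : F' = F := funext fun x => le_antisymm (hle x) (hge x (Finset.mem_univ x))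
      obtain rfl := hcur.csf.unique hsch.csf
      have h1 : (outBest n m).fmax I < m.rv .y := by
        rw [Schedule.fmax_lt_iff]
        intro j
        rw [hcur.real.C_eq hcur.csf]
        exact hsch.good j
      rw [hcur.y_eq] at h1
      exact lt_irrefl _ h1
    have htime : ∀ t, t ≤ t₁ + 400 * (n + 1) →
        t + 1600 * (n + 1) * ∑ x, F' x ≤ 1600 * (n + 1) * ∑ x, F x := by
      intro t ht
      obtain ⟨e, he⟩ : ∃ e, ∑ x, F x = ∑ x, F' x + 1 + e :=
        ⟨∑ x, F x - (∑ x, F' x + 1), by omega⟩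
      rw [he] at ht₁ ⊢
      nlinarith [Nat.zero_le (n * e)]
    -- The new schedule is feasible and cheaper than the old one, which has minimum makespan for its
    -- cost; so makespans never decrease.
    have hpiC₁ : m₁.rv .piC ≤ m₁.ra .C n 0 := by
      have hreal : I.Realizes F' a' ⟨F', fun i => I.compl F' a' i - ∑ j with F' j = i, I.p j⟩ :=
        ⟨fun _ => rfl, fun _ _ _ => rfl⟩
      have h1 := hcur₁.min _ (hreal.feasible hsch.csf) (by
        rw [hy₁]
        refine le_of_lt ?_
        rw [Schedule.fmax_lt_iff]
        intro j
        rw [hreal.C_eq hsch.csf]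
        exact hsch.good j)
      rwa [hreal.Cmax_eq hsch.csf, ← hsch.compl n le_rfl] at h1
    rw [run_ite]
    refine ⟨fun _ => ?_, fun h => ?_⟩
    swap
    · simp [BExp.Holds, NExp.eval, hst] at h
    -- the rest of the iteration after the entry for the previous schedule has been made, if any
    have rest : ∀ (t₂ : ℕ → ℕ) m₂, (∀ t, t₂ t ≤ t₁ + 150 * (n + 1) + t) → I.LoadedIn m₂ →
        I.Scheduled (· < m.rv .y) F' a' m₂ → I.Listed m₂ → m₂.nv .go = 1 →
        (∀ κ ∈ Set.Icc 1 (m₂.nv .num), (outPoint m₂ κ).1 < m₂.ra .C n 0) →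
        (∀ τ : Schedule n, τ.ParetoOptimal I → τ.fmax I < m.rv .y ∨
          Recorded m₂ (τ.Cmax I, τ.fmax I) ∨
          m₂.ra .C n 0 ≤ τ.Cmax I ∧ τ.fmax I = m.rv .y) →
        Run I.oracle (saveSchedule ⨟ .setN .u (.add (.var .u) (.lit 1))) m₂ fun t m' =>
          (m'.nv .go = 0 ∧ I.Solved m' ∧ t₂ t ≤ 1700 * (n + 1) * (∑ x, F x + 1)) ∨
          (m'.nv .go = 1 ∧ 0 < m'.nv .u ∧ ∃ F' a', I.Current F' a' m' ∧
            (∀ j : Fin n, m'.na .ord j 0 = F' j) ∧ I.Collected m' ∧ ∑ x, F' x < ∑ x, F x ∧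
            t₂ t + 1600 * (n + 1) * ∑ x, F' x ≤ 1600 * (n + 1) * ∑ x, F x) := by
      intro t₂ m₂ ht₂ hm₂ hsch₂ hlist₂ hgo₂ hlt₂ hcomp₂
      rw [run_seq]
      refine (run_saveSchedule_current hm₂ hsch₂ hok.down).agree.imp ?_
      rintro t₃ m₃ ⟨⟨ht₃, hcur₃, hy₃, hC₃, hlow₃⟩, ha₃⟩
      rw [run_setN]
      have ha₄ := (Exec.setN (f := I.oracle) .u (.add (.var .u) (.lit 1)) m₃).agree
      have hlist₃ := hlist₂.of_agree ha₃ (by unfold KeepsList; decide)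
      have hcol₃ : I.Collected m₃ := by
        refine ⟨hlist₃, fun κ hκ => ?_, fun τ hτ => ?_⟩
        · rw [ha₃.nv _ (by decide)] at hκ
          rw [outPoint_agree ha₃ (by unfold KeepsList; decide), hC₃]
          exact hlt₂ κ hκ
        · have hfeas₃ := hcur₃.real.feasible hsch₂.csf
          -- The makespan hypothesis holds for every Pareto optimal schedule still missing: by
          -- minimality if its cost is below the old bound, and otherwise by equality of the old and
          -- new makespans.
          have key : m₃.rv .piC ≤ τ.Cmax I → τ.fmax I < m₃.rv .y ∨
              (τ.Cmax I, τ.fmax I) = (m₃.rv .piC, m₃.rv .y) := by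
            rw [hcur₃.piC_eq, hcur₃.y_eq]
            exact hτ.eq_or_lt hfeas₃
          rcases hcomp₂ τ hτ with h1 | h1 | ⟨h1, -⟩
          · exact (key (hlow₃ τ hτ.1 h1)).imp_right Or.inr
          · exact Or.inr (Or.inl (h1.of_agree ha₃ (by unfold KeepsList; decide)))
          · exact (key (by rw [hC₃]; exact h1)).imp_right Or.inr
      refine Or.inr ⟨?_, by simp [NExp.eval], F', a', hcur₃.of_agree ha₄ (by decide), ?_,
        hcol₃.of_agree ha₄ (by unfold KeepsList; decide) (by decide), hlt, htime _ ?_⟩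
      · rw [ha₄.nv _ (by decide), ha₃.nv _ (by decide), hgo₂]
      · rw [ha₄.na _ (by decide), ha₃.na _ (by decide)]
        exact hsch₂.ord
      · refine (ht₂ _).trans ?_
        simp only [NExp.time]
        omega
    rw [run_seq, run_when]
    refine ⟨fun hcond => ?_, fun hcond => ?_⟩
    · simp only [BExp.Holds, NExp.eval, RExp.eval, hm₁.n_eq] at hcond
      have hCn : I.compl F' a' n = m₁.ra .C n 0 := (hsch.compl n le_rfl).symm
      -- Every schedule cheaper than the saved one has at least the makespan of the new schedule,
      -- which is strictly larger here.
      refine (run_recordPoint_pareto hm₁ hcur₁ hcol₁ fun σ hσ h1 => ?_).agree.imp ?_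
      · refine hcond.2.trans_le ?_
        rw [← hCn]
        rw [hy₁, Schedule.fmax_lt_iff] at h1
        exact hσ.compl_le_Cmax hsch.csf (hsch.bounding.batch_le hsch.csf.le_n hok.down hσ h1)
      · rintro t₂ m₂ ⟨⟨ht₂, hlist, hle₂, hcomp⟩, ha₂⟩
        have hC₂ : m₂.ra .C = m₁.ra .C := ha₂.ra _ (by decide)
        refine rest _ m₂ (fun t => ?_) (hm₁.of_agree ha₂ (by unfold KeepsInput; decide))
          ⟨hsch.csf, hsch.bounding, ?_, ?_, ?_, hsch.good⟩ hlist
          ((ha₂.nv _ (by decide)).trans hgo₁) (fun κ hκ => ?_) fun τ hτ => ?_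
        · simp only [BExp.time, NExp.time, RExp.time]
          omega
        · rw [ha₂.na _ (by decide)]; exact hsch.ord
        · rw [hC₂]; exact hsch.compl
        · rw [ha₂.ra _ (by decide)]; exact hsch.start
        · rw [hC₂]
          exact (hle₂ κ hκ).trans_lt hcond.2
        · rw [← hy₁]
          exact (hcomp τ hτ).imp_right Or.inl
    · simp only [BExp.Holds, NExp.eval, RExp.eval, hm₁.n_eq, hu₁, true_and, not_lt] at hcond
      -- With equal makespans the old schedule is dominated by the new one and is dropped without
      -- losing a Pareto optimal point.
      have hCeq : m₁.rv .piC = m₁.ra .C n 0 := le_antisymm hpiC₁ hcond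
      refine rest _ m₁ (fun t => ?_) hm₁ hsch hcol₁.toListed hgo₁ (fun κ hκ => ?_) fun τ hτ => ?_
      · simp only [BExp.time, NExp.time, RExp.time]
        omega
      · rw [← hCeq]
        exact hcol₁.lt κ hκ
      · rw [← hy₁, ← hCeq]
        refine (hcol₁.complete τ hτ).imp_right (Or.imp_right fun h1 => ?_)
        rw [Prod.mk.injEq] at h1
        exact ⟨h1.1.ge, h1.2⟩

/-- The first iteration of Algorithm MAIN2. -/
theorem run_first {I : Inst n} {F : Fin n → ℕ} {a : ℕ} (hm : I.LoadedIn m)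
    (hF : I.IsCSF F a) (hbd : I.Bounding (fun _ => True) F)
    (hord : ∀ j : Fin n, m.na .ord j 0 = F j) (hu : m.nv .u = 0) (hinf : m.nv .inf = 1)
    (hnum : m.nv .num = 0) (hgo : m.nv .go = 1) :
    Run I.oracle (aux2 ⨟
     .ite (.eqN (.var .status) (.lit 1))
      (.when (.and (.ltN (.lit 0) (.var .u)) (.ltR (.var .piC) (.get1 .C (.var .n)))) recordPoint ⨟
       saveSchedule ⨟
       .setN .u (.add (.var .u) (.lit 1)))
      (recordPoint ⨟ .setN .go (.lit 0))) m fun t m' =>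
      m'.nv .go = 1 ∧ 0 < m'.nv .u ∧ ∃ F' a', I.Current F' a' m' ∧
        (∀ j : Fin n, m'.na .ord j 0 = F' j) ∧ I.Collected m' ∧ ∑ x, F' x ≤ ∑ x, F x ∧
        t + 650 * (n + 1) * ∑ x, F' x ≤ 650 * (n + 1) * ∑ x, F x + 800 * (n + 1) := by
  have hok : BoundedBy (fun _ => True) m := fun r => by simp [hinf]
  rw [run_seq]
  refine (run_aux2 hm hok hF hbd hord).agree.imp ?_
  rintro t₁ m₁ ⟨hres, ha₁⟩
  have hm₁ := hm.of_agree ha₁ (by unfold KeepsInput; decide)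
  have hu₁ : m₁.nv .u = 0 := (ha₁.nv _ (by decide)).trans hu
  rcases hres with ⟨-, hno, -⟩ | ⟨hst, F', a', hsch, hle, ht₁⟩
  -- Without a cost bound AUX2 cannot fail: the initial family itself gives a feasible schedule.
  · have hreal : I.Realizes F a ⟨F, fun i => I.compl F a i - ∑ j with F j = i, I.p j⟩ :=
      ⟨fun _ => rfl, fun _ _ _ => rfl⟩
    exact absurd (fun _ => trivial) (hno _ (hreal.feasible hF))
  rw [run_ite]
  refine ⟨fun _ => ?_, fun h => ?_⟩
  swap
  · simp [BExp.Holds, NExp.eval, hst] at h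
  rw [run_seq, run_when]
  refine ⟨fun h => ?_, fun _ => ?_⟩
  · simp [BExp.Holds, NExp.eval, hu₁] at h
  rw [run_seq]
  refine (run_saveSchedule_current hm₁ hsch hok.down).agree.imp ?_
  rintro t₃ m₃ ⟨⟨ht₃, hcur₃, -, hC₃, hlow₃⟩, ha₃⟩
  rw [run_setN]
  have ha₄ := (Exec.setN (f := I.oracle) .u (.add (.var .u) (.lit 1)) m₃).agree
  have hnum₃ : m₃.nv .num = 0 := by
    rw [ha₃.nv _ (by decide), ha₁.nv _ (by decide), hnum]
  have hcol₃ : I.Collected m₃ := by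
    refine ⟨⟨fun κ hκ => ?_, fun κ hκ => ?_⟩, fun κ hκ => ?_, fun τ hτ => ?_⟩
    · simp only [hnum₃, Set.mem_Icc] at hκ; omega
    · simp only [hnum₃, Set.mem_Icc] at hκ; omega
    · simp only [hnum₃, Set.mem_Icc] at hκ; omega
    · have h1 := hlow₃ τ hτ.1 trivial
      rw [hcur₃.piC_eq] at h1
      rw [hcur₃.piC_eq, hcur₃.y_eq]
      exact (hτ.eq_or_lt (hcur₃.real.feasible hsch.csf) h1).imp_right Or.inr
  refine ⟨?_, by simp [NExp.eval], F', a', hcur₃.of_agree ha₄ (by decide), ?_,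
    hcol₃.of_agree ha₄ (by unfold KeepsList; decide) (by decide),
    Finset.sum_le_sum fun x _ => hle x, ?_⟩
  · rw [ha₄.nv _ (by decide), ha₃.nv _ (by decide), ha₁.nv _ (by decide), hgo]
  · rw [ha₄.na _ (by decide), ha₃.na _ (by decide)]
    exact hsch.ord
  · simp only [BExp.time, NExp.time, RExp.time]
    omega

theorem run_main2 {I : Inst n} (hm : I.LoadedIn m) :
    Run I.oracle main2 m fun t m' => t ≤ 30000 * n ^ 3 ∧ I.Solved m' := by
  obtain ⟨B, a, hB, htight⟩ := I.exists_levels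
  have hbd := I.bounding_of_tight (fun _ => True) htight
  have hnpos := I.n_pos
  have hsumB : ∑ x, B x ≤ n * n := by
    have := Finset.sum_le_card_nsmul Finset.univ B n fun x _ => hB.le_n x
    simpa using this
  rw [main2, run_seq]
  refine (run_initCSF hm hB htight).agree.imp ?_
  rintro t₀ m₀ ⟨⟨ht₀, hord₀⟩, ha₀⟩
  have hm₀ := hm.of_agree ha₀ (by unfold KeepsInput; decide)
  simp only [run_seq, run_setN]
  set m₁ := (((m₀.setN .u (NExp.eval m₀ (.lit 0))).setN .inf
    (NExp.eval (m₀.setN .u (NExp.eval m₀ (.lit 0))) (.lit 1))).setN .num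
    (NExp.eval ((m₀.setN .u (NExp.eval m₀ (.lit 0))).setN .inf
      (NExp.eval (m₀.setN .u (NExp.eval m₀ (.lit 0))) (.lit 1))) (.lit 0))).setN .go
    (NExp.eval (((m₀.setN .u (NExp.eval m₀ (.lit 0))).setN .inf
      (NExp.eval (m₀.setN .u (NExp.eval m₀ (.lit 0))) (.lit 1))).setN .num
      (NExp.eval ((m₀.setN .u (NExp.eval m₀ (.lit 0))).setN .inf
        (NExp.eval (m₀.setN .u (NExp.eval m₀ (.lit 0))) (.lit 1))) (.lit 0))) (.lit 1)) with hm₁def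
  have hm₁ : I.LoadedIn m₁ :=
    ⟨by simpa [hm₁def] using hm₀.n_eq, by simpa [hm₁def] using hm₀.s_eq,
      by simpa [hm₁def] using hm₀.p_eq, by simpa [hm₁def] using hm₀.np_eq,
      by simpa [hm₁def] using hm₀.pred_eq⟩
  have hord₁ : ∀ j : Fin n, m₁.na .ord j 0 = B j := by simpa [hm₁def] using hord₀
  have hu₁ : m₁.nv .u = 0 := by simp [hm₁def, NExp.eval]
  have hinf₁ : m₁.nv .inf = 1 := by simp [hm₁def, NExp.eval]
  have hnum₁ : m₁.nv .num = 0 := by simp [hm₁def, NExp.eval]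
  have hgo₁ : m₁.nv .go = 1 := by simp [hm₁def, NExp.eval]
  clear_value m₁
  -- Three phases: before the first iteration, when no schedule is saved; after termination; and in
  -- between, with the sum of the ordinal numbers as variant and potential.
  refine run_loop (v := ∑ x, B x + 2) (fun v t m' =>
    (t = 0 ∧ m' = m₁ ∧ v = ∑ x, B x + 2) ∨
    (v = 0 ∧ m'.nv .go = 0 ∧ I.Solved m' ∧ t ≤ 2600 * (n + 1) * (∑ x, B x + 1)) ∨
    (m'.nv .go = 1 ∧ 0 < m'.nv .u ∧ ∃ F a, I.Current F a m' ∧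
      (∀ j : Fin n, m'.na .ord j 0 = F j) ∧ I.Collected m' ∧ v = ∑ x, F x + 1 ∧
      ∑ x, F x ≤ ∑ x, B x ∧
      t + 1610 * (n + 1) * ∑ x, F x ≤ 1610 * (n + 1) * ∑ x, B x + 810 * (n + 1))) ?_ ?_ ?_
  · exact Or.inl ⟨rfl, rfl, rfl⟩
  · rintro v t m' ha (⟨rfl, rfl, rfl⟩ | ⟨-, h1, -⟩ | ⟨h1, h2, F, a', h3, h4, h5, rfl, h6, h7⟩) hgo
    · refine (run_first hm₁ hB hbd hord₁ hu₁ hinf₁ hnum₁ hgo₁).imp ?_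
      rintro t' m'' ⟨h1, h2, F, a', h3, h4, h5, h6, h7⟩
      refine ⟨_, by omega, Or.inr (Or.inr ⟨h1, h2, F, a', h3, h4, h5, rfl, h6, ?_⟩)⟩
      simp only [BExp.time, NExp.time]
      obtain ⟨e, he⟩ := Nat.exists_eq_add_of_le h6
      rw [he] at h7 ⊢
      nlinarith [Nat.zero_le (n * e)]
    · simp [BExp.Holds, NExp.eval, h1] at hgo
    · refine (run_improve (hm₁.of_agree ha (by unfold KeepsInput; decide)) h3 h4 h5 h2 h1).imp ?_
      rintro t' m'' (⟨k1, k2, k3⟩ | ⟨k1, k2, F', a'', k3, k4, k5, k6, k7⟩)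
      · refine ⟨0, by omega, Or.inr (Or.inl ⟨rfl, k1, k2, ?_⟩)⟩
        simp only [BExp.time, NExp.time]
        obtain ⟨e, he⟩ := Nat.exists_eq_add_of_le h6
        rw [he] at h7 ⊢
        clear * - h7 k3
        generalize ∑ x, F x = S at h7 k3 ⊢
        nlinarith [Nat.zero_le (n * S), Nat.zero_le (n * e)]
      · refine ⟨_, by omega, Or.inr (Or.inr ⟨k1, k2, F', a'', k3, k4, k5, rfl, by omega, ?_⟩)⟩
        simp only [BExp.time, NExp.time]
        obtain ⟨e, he⟩ : ∃ e, ∑ x, F x = ∑ x, F' x + 1 + e :=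
          ⟨∑ x, F x - (∑ x, F' x + 1), by omega⟩
        rw [he] at h7 k7
        nlinarith [Nat.zero_le (n * e)]
  · rintro v t m' ha (⟨rfl, rfl, rfl⟩ | ⟨-, h1, h2, h3⟩ | ⟨h1, -⟩) hgo
    · simp [BExp.Holds, NExp.eval, hgo₁] at hgo
    · refine ⟨?_, h2⟩
      simp only [BExp.time, NExp.time]
      clear * - ht₀ h3 hsumB hnpos
      generalize ∑ x, B x = S at h3 hsumB
      -- As `n ≥ 1`, powers of `n + 1` are absorbed: `(n + 1) ^ 3 ≤ 8 * n ^ 3` and `(n + 1) * (n * n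
      -- + 1) ≤ 4 * n ^ 3`.
      obtain ⟨k, rfl⟩ := Nat.exists_eq_add_of_le' hnpos
      have h4 : (k + 1 + 1) * S ≤ (k + 1 + 1) * ((k + 1) * (k + 1)) := Nat.mul_le_mul_left _ hsumB
      nlinarith [Nat.zero_le (k ^ 3), Nat.zero_le (k ^ 2)]
    · simp [BExp.Holds, NExp.eval, h1] at hgo

end

end SBatch

/-! ### The main theorem -/

theorem theorem3 :
    ∃ c : ℕ, ∀ (n : ℕ) (I : SBatch.Inst n) (m : SBatch.Mem), I.LoadedIn m →
      ∃ (t : ℕ) (m' : SBatch.Mem),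
        -- MAIN2 terminates after at most `c * n ^ 3` steps
        SBatch.Exec I.oracle SBatch.main2 m t m' ∧ t ≤ c * n ^ 3 ∧
        -- the output list consists of exactly the Pareto optimal points, without repetition
        SBatch.outPoint m' '' Set.Icc 1 (m'.nv .num) = SBatch.paretoPoints I ∧
        StrictMonoOn (fun κ => (SBatch.outPoint m' κ).1) (Set.Icc 1 (m'.nv .num)) ∧
        -- each with a corresponding Pareto optimal schedule
        (∀ κ ∈ Set.Icc 1 (m'.nv .num),
          (SBatch.outSchedule n m' κ).ParetoOptimal I ∧
          SBatch.outPoint m' κ =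
            ((SBatch.outSchedule n m' κ).Cmax I, (SBatch.outSchedule n m' κ).fmax I)) ∧
        -- and the schedule `π*` is optimal for the single criterion `f_max`
        (SBatch.outBest n m').Feasible I ∧
        (∀ σ : SBatch.Schedule n, σ.Feasible I →
          (SBatch.outBest n m').fmax I ≤ σ.fmax I) := by
  refine ⟨30000, fun n I m hm => ?_⟩
  obtain ⟨t, m', hexec, ht, hsolved⟩ := SBatch.run_main2 hm
  refine ⟨t, m', hexec, ht, Set.Subset.antisymm ?_ ?_, hsolved.mono, hsolved.pareto,
    hsolved.feasible, hsolved.optimal⟩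
  · rintro _ ⟨κ, hκ, rfl⟩
    exact ⟨_, hsolved.pareto κ hκ⟩
  · rintro _ ⟨τ, hτ, rfl⟩
    exact hsolved.complete τ hτ
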